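/- **Graphs.** A *graph* (Joyal–Kock) is a diagram of finite sets $i\curvearrowright A\xleftarrow{\,s\,}H\xrightarrow{\,p\,}V$ with $i$ a fixpoint-free involution on the set $A$ of arcs and $s$ injective; $H$ is the set of half-edges (flags), $V$ the set of vertices. Its *ports* are the arcs in $A\setminus s(H)$; an edge is an $i$-orbit, and an *isolated edge* is one disjoint from $s(H)$. An *etale map* consists of maps on $A,H,V$ commuting with $i,s,p$ whose square over $p$ is a pullback; $\mathbf{Gr}$ is the category of graphs and etale maps. A graph is *effective* if it is non-empty and has no isolated edges. An etale map is a *cover* if it is surjective on arcs and vertices, and a *reduced cover* if moreover no proper open subgraph of its domain still covers (between graphs without isolated edges: if it is bijective on vertices). The corolla $[n]$ on a finite set $n$ has one vertex, with flags $n$ and ports $n$. **Restricted Kleisli category.** A *graphical species* $F$ is a presheaf on the category of elementary graphs (the unit graph $I$, i.e. a single edge without vertices, and the corollas), i.e. a set $F[I]$ of colours with an involution, and for each finite set $n$ a set $F[n]$ of operations, functorial in bijections of $n$, with compatible projections $F[n]\to F[I]$ for the ports of $[n]$. Graphs embed fully faithfully in species. Let $\overline F[I]=F[I]$, and let $\overline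 F[n]$ be the set of isomorphism classes of effective graphs $G$ with a bijection of their set of ports with $n$ and a morphism of species $G\to F$. Then $F\mapsto\overline F$ is a monad, with unit given by corollas and multiplication by substitution of graphs into vertices. Let $\widetilde{\mathbf{Gr}}$ be the full subcategory of its Kleisli category on the graphs without isolated edges. Reduced covers are regarded as (free) morphisms in it. A Kleisli morphism $R\to Y$, i.e. a morphism of species $R\to\overline Y$, assigns to each vertex $x$ of $R$ an effective graph $S_x\to Y$ whose ports are the flags at $x$; gluing the $S_x$ as prescribed by $R$ gives a graph $S$ (a colimit) with an etale map $S\to Y$, and the morphism is *generic* if this map is invertible. **Borisov–Manin category.** A (finite) BM graph is $\tau=(V_\tau,F_\tau,\partial_\tau,j_\tau)$ with finite sets of vertices and flags, a map $\partial_\tau:F_\tau\to V_\tau$ and an involution $j_\tau$ on $F_\tau$; the fixpoints of $j_\tau$ are the *tails*, its two-element orbits the *edges*. A morphism $h:\tau\to\sigma$ is a triple $(h^F,h_V,j_h)$ with $h^F:F_\sigma\to F_\tau$ injective, $h_V:V_\tau\to V_\sigma$ surjective, $h^F(F_\sigma)$ stable under $j_\tau$, and $j_h$ a fixpoint-free involution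 on $F_\tau\setminus h^F(F_\sigma)$ that agrees with $j_\tau$ on edges, such that $h_V\partial_\tau h^F=\partial_\sigma$, such that $h_V\partial_\tau f=h_V\partial_\tau j_h f$ for $f\notin h^F(F_\sigma)$, and such that $(h^F)^{-1}$ maps edges of $\tau$ to edges of $\sigma$. The composite of $g:\tau\to\sigma$ and $c:\sigma\to\rho$ has $(c\circ g)_V=c_V g_V$, $(c\circ g)^F=g^Fc^F$, and its involution is $j_g$ off $g^F(F_\sigma)$ and $j_c$, transported along $g^F$, on the rest. Let $\mathbf{BM}$ be the resulting category. A *grafting* is a morphism with $h_V$ and $h^F$ bijective; a *compression* is a morphism with $h^F$ bijective on tails. They form wide subcategories $\mathbf{BM}_{\rm gr}$ and $\mathbf{BM}_{\rm comp}$. **The functors.** A BM graph $\tau$ gives a graph without isolated edges with $V=V_\tau$, $H=F_\tau$, $A=F_\tau\sqcup\{\text{tails}\}$, $s$ the inclusion, $p=\partial_\tau$, where $i$ is $j_\tau$ on flags in edges and exchanges each tail in $F_\tau$ with its copy. On morphisms, $\Phi_1:\mathbf{BM}_{\rm gr}\to\widetilde{\mathbf{Gr}}_{\rm rc}$ (the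 wide subcategory of reduced covers) sends a grafting $h$ to the etale map that is $h_V$ on vertices and $(h^F)^{-1}$ on half-edges. The functor $\Phi_2:\mathbf{BM}_{\rm comp}\to\widetilde{\mathbf{Gr}}_{\rm gen}^{\rm op}$ (generic morphisms, reversed) sends a compression $h:\sigma\to\rho$ to the Kleisli morphism $\Phi(\rho)\to\Phi(\sigma)$ given by $h^F$ on arcs and sending a vertex $x$ of $\rho$ to the graph $S_x$ that $h$ contracts to $x$: its vertices are $h_V^{-1}(x)$, its half-edges the flags of $\sigma$ at these vertices, its inner edges the edges among them contracted by $h$, and its ports are in bijection, via $h^F$, with the flags of $\rho$ at $x$. **Statement.** $\Phi_1$ and $\Phi_2$ are equivalences of categories, and the commutation laws correspond under them. That is, let $h:\tau\to\omega$ be a compression and $k:\omega\to\rho$ a grafting. Then there are a BM graph $\sigma$, a grafting $g:\tau\to\sigma$ and a compression $c:\sigma\to\rho$ with $c\circ g=k\circ h$; and for all such $\sigma,g,c$ the square $$\begin{array}{ccc}\Phi(\omega)&\xrightarrow{\ \Phi_1(k)\ }&\Phi(\rho)\\ {\scriptstyle\Phi_2(h)}\big\downarrow&&\big\downarrow{\scriptstyle\Phi_2(c)}\\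 \Phi(\tau)&\xrightarrow{\ \Phi_1(g)\ }&\Phi(\sigma)\end{array}$$ is a pushout square in $\widetilde{\mathbf{Gr}}$. -/

import Mathlib

open CategoryTheory

noncomputable section

namespace JK

/-! ### Graphs and etale morphisms -/

/-- A graph: a diagram of finite sets `A ← H → V` with a fixpoint-free involution `i` on the set
`A` of arcs and an injective `s : H → A`; `H` is the set of half-edges (flags), `V` the set of
vertices. -/
structure JKGraph where
  A : Type
  H : Type
  V : Type
  finA : Finite A
  finH : Finite H
  finV : Finite V
  i : A → A
  s : H → A
  p : H → V
  i_i : ∀ a, i (i a) = a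
  i_ne : ∀ a, i a ≠ a
  s_inj : Function.Injective s

namespace JKGraph

attribute [instance] finA finH finV

/-- Etale morphisms: the right-hand square `H' → V'` over `H → V` is a pullback. -/
@[ext]
structure Hom (X Y : JKGraph) where
  a : X.A → Y.A
  h : X.H → Y.H
  v : X.V → Y.V
  a_i : ∀ x, a (X.i x) = Y.i (a x)
  a_s : ∀ x, a (X.s x) = Y.s (h x)
  v_p : ∀ x, v (X.p x) = Y.p (h x)
  pull : ∀ (w : X.V) (y : Y.H), Y.p y = v w → ∃! x, X.p x = w ∧ h x = y

/-- The category of graphs and etale morphisms. -/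
instance : Category JKGraph where
  Hom := Hom
  id X := ⟨id, id, id, fun _ => rfl, fun _ => rfl, fun _ => rfl,
    fun w y hy => ⟨y, ⟨hy, rfl⟩, fun _ hz => hz.2⟩⟩
  comp {X Y Z} f g :=
    { a := g.a ∘ f.a
      h := g.h ∘ f.h
      v := g.v ∘ f.v
      a_i := fun x => by simp [f.a_i, g.a_i]
      a_s := fun x => by simp [f.a_s, g.a_s]
      v_p := fun x => by simp [f.v_p, g.v_p]
      pull := fun w z hz => by
        obtain ⟨y, ⟨hy1, hy2⟩, hy3⟩ := g.pull (f.v w) z hz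
        obtain ⟨x, ⟨hx1, hx2⟩, hx3⟩ := f.pull w y hy1
        refine ⟨x, ⟨hx1, by simp [hx2, hy2]⟩, ?_⟩
        rintro x' ⟨h1, h2⟩
        refine hx3 x' ⟨h1, hy3 _ ⟨?_, h2⟩⟩
        rw [← f.v_p, h1] }

@[ext]
theorem hom_ext {X Y : JKGraph} {f g : X ⟶ Y} (ha : ∀ x, Hom.a f x = Hom.a g x)
    (hh : ∀ x, Hom.h f x = Hom.h g x) (hv : ∀ x, Hom.v f x = Hom.v g x) : f = g :=
  Hom.ext (funext ha) (funext hh) (funext hv)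

@[simp] theorem id_a (X : JKGraph) (x : X.A) : Hom.a (𝟙 X) x = x := rfl
@[simp] theorem id_h (X : JKGraph) (x : X.H) : Hom.h (𝟙 X) x = x := rfl
@[simp] theorem id_v (X : JKGraph) (x : X.V) : Hom.v (𝟙 X) x = x := rfl
@[simp] theorem comp_a {X Y Z : JKGraph} (f : X ⟶ Y) (g : Y ⟶ Z) (x : X.A) :
    Hom.a (f ≫ g) x = Hom.a g (Hom.a f x) := rfl
@[simp] theorem comp_h {X Y Z : JKGraph} (f : X ⟶ Y) (g : Y ⟶ Z) (x : X.H) :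
    Hom.h (f ≫ g) x = Hom.h g (Hom.h f x) := rfl
@[simp] theorem comp_v {X Y Z : JKGraph} (f : X ⟶ Y) (g : Y ⟶ Z) (x : X.V) :
    Hom.v (f ≫ g) x = Hom.v g (Hom.v f x) := rfl

/-- The ports of a graph (its interface): the arcs not in the image of `s`. -/
abbrev Port (X : JKGraph) : Type := {a : X.A // a ∉ Set.range X.s}

/-- The flags at a vertex. -/
abbrev Fl (X : JKGraph) (x : X.V) : Type := {h : X.H // X.p h = x}

instance (X : JKGraph) (x : X.V) : Finite (X.Fl x) :=
  inferInstanceAs (Finite {h : X.H // X.p h = x})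

/-- No isolated edges: each edge has at least one of its two arcs in the image of `s`. -/
def NoIsolatedEdges (X : JKGraph) : Prop := ∀ a, a ∈ Set.range X.s ∨ X.i a ∈ Set.range X.s

/-- Effective graphs: nonempty and without isolated edges. (A graph without isolated edges is
nonempty precisely when it has a vertex.) -/
def Effective (X : JKGraph) : Prop := Nonempty X.V ∧ X.NoIsolatedEdges

/-- The corolla on a finite set `n`: one vertex, with set of flags `n` and set of ports `n`
(the ports being the arcs `Sum.inl k`). -/
abbrev corolla (n : Type) [Finite n] : JKGraph where
  A := n ⊕ n
  H := n
  V := Unit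
  finA := inferInstance
  finH := inferInstance
  finV := inferInstance
  i := Sum.swap
  s := Sum.inr
  p := fun _ => ()
  i_i := by simp
  i_ne := by rintro (a | a) <;> simp
  s_inj := Sum.inr_injective

variable {X Y : JKGraph} {n m : Type} [Finite n] [Finite m]

/-- The etale map out of a corolla that hits the vertex `x` and identifies the flags of the
corolla with those at `x`; port `k` goes to the arc pointing towards `x` along flag `e k`. -/
def mkCor (x : X.V) (e : n ≃ X.Fl x) : Hom (corolla n) X where
  a := Sum.elim (fun k => X.i (X.s (e k).1)) (fun k => X.s (e k).1)
  h := fun k => (e k).1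
  v := fun _ => x
  a_i := by rintro (a | a) <;> simp [X.i_i]
  a_s := by simp
  v_p := fun k => (e k).2.symm
  pull := by
    rintro ⟨⟩ y hy
    refine ⟨e.symm ⟨y, hy⟩, ⟨rfl, by simp⟩, ?_⟩
    rintro k ⟨_, rfl⟩
    exact (e.symm_apply_apply k).symm

theorem hom_a_inl (q : corolla n ⟶ X) (k : n) :
    Hom.a q (Sum.inl k) = X.i (X.s (Hom.h q k)) := by
  have := Hom.a_i q (Sum.inr k)
  have h2 := Hom.a_s q k
  exact this.trans (congrArg X.i h2)

theorem hom_a_inr (q : corolla n ⟶ X) (k : n) :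
    Hom.a q (Sum.inr k) = X.s (Hom.h q k) := Hom.a_s q k

theorem cor_ext {q q' : corolla n ⟶ X} (hh : ∀ k : n, Hom.h q k = Hom.h q' k)
    (hv : Hom.v q () = Hom.v q' ()) : q = q' := by
  ext x
  · rcases x with k | k
    · rw [hom_a_inl, hom_a_inl, hh]
    · rw [hom_a_inr, hom_a_inr, hh]
  · exact hh x
  · exact hv

/-- An etale map is bijective on the flags at each vertex. -/
def flMap (f : X ⟶ Y) (w : X.V) : X.Fl w ≃ Y.Fl (Hom.v f w) :=
  Equiv.ofBijective (fun k => ⟨Hom.h f k.1, by rw [← Hom.v_p f, k.2]⟩) (by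
    constructor
    · rintro ⟨k, hk⟩ ⟨l, hl⟩ hkl
      obtain ⟨z, -, hz⟩ := Hom.pull f w (Hom.h f l) (by rw [← Hom.v_p f, hl])
      exact Subtype.ext ((hz k ⟨hk, congrArg Subtype.val hkl⟩).trans (hz l ⟨hl, rfl⟩).symm)
    · rintro ⟨y, hy⟩
      obtain ⟨z, ⟨hz1, hz2⟩, -⟩ := Hom.pull f w y hy
      exact ⟨⟨z, hz1⟩, Subtype.ext hz2⟩)

@[simp] theorem flMap_val (f : X ⟶ Y) (w : X.V) (k : X.Fl w) :
    (flMap f w k).1 = Hom.h f k.1 := rfl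

/-- The flags of a corolla mapping to `X`, as flags at a vertex of `X`. -/
def flEquiv (q : corolla n ⟶ X) : n ≃ X.Fl (Hom.v q ()) :=
  (⟨fun k => ⟨k, rfl⟩, fun k => k.1, fun _ => rfl, fun _ => rfl⟩ :
    n ≃ (corolla n).Fl ()).trans (flMap q ())

@[simp] theorem flEquiv_val (q : corolla n ⟶ X) (k : n) : (flEquiv q k).1 = Hom.h q k := rfl

/-- The corolla at a vertex `x`. -/
def star (X : JKGraph) (x : X.V) : corolla (X.Fl x) ⟶ X := mkCor x (Equiv.refl _)

@[simp] theorem star_h (x : X.V) (k : X.Fl x) : Hom.h (X.star x) k = k.1 := rfl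
@[simp] theorem star_v (x : X.V) (u : Unit) : Hom.v (X.star x) u = x := rfl

/-- The map of corollas induced by a bijection. -/
def corMap (σ : m ≃ n) : corolla m ⟶ corolla n :=
  mkCor (X := corolla n) () (σ.trans ⟨fun k => ⟨k, rfl⟩, fun k => k.1, fun _ => rfl, fun _ => rfl⟩)

@[simp] theorem corMap_h (σ : m ≃ n) (k : m) : Hom.h (corMap σ) k = σ k := rfl
@[simp] theorem corMap_v (σ : m ≃ n) (k : Unit) : Hom.v (corMap σ) k = () := rfl
@[simp] theorem corMap_a_inl (σ : m ≃ n) (k : m) :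
  Hom.a (corMap σ) (Sum.inl k) = Sum.inl (σ k) := rfl

theorem eq_corMap_star (q : corolla n ⟶ X) :
    q = corMap (flEquiv q) ≫ X.star (Hom.v q ()) :=
  cor_ext (fun _ => rfl) rfl

end JKGraph

open JKGraph

/-! ### Graphical species -/

/-- A graphical species, i.e. a presheaf on the category of elementary graphs (the unit graph and
the corollas), given explicitly: its value `Col` on the unit graph, an involutive set (of colours);
its value `Op n` on the corolla on each finite set `n` (operations), functorial in bijections, with
the equivariant projections to `Col` corresponding to the ports of the corolla. (The projections
for the opposite arcs are got by applying the involution. Operations are allowed to form a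
`Type 1`, since isomorphism classes of finite graphs do.) -/
structure Species where
  Col : Type
  inv : Col → Col
  inv_inv : ∀ c, inv (inv c) = c
  Op : (n : Type) → [Finite n] → Type 1
  act : ∀ {n m : Type} [Finite n] [Finite m], (m ≃ n) → Op n → Op m
  act_refl : ∀ {n : Type} [Finite n] (x : Op n), act (Equiv.refl n) x = x
  act_trans : ∀ {n m k : Type} [Finite n] [Finite m] [Finite k] (σ : m ≃ n) (τ : k ≃ m) (x : Op n),
    act τ (act σ x) = act (τ.trans σ) x
  col : ∀ {n : Type} [Finite n], Op n → n → Col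
  col_act : ∀ {n m : Type} [Finite n] [Finite m] (σ : m ≃ n) (x : Op n) (k : m),
    col (act σ x) k = col x (σ k)

namespace Species

/-- Morphisms of graphical species: natural transformations. -/
@[ext]
structure Hom (F G : Species) where
  c : F.Col → G.Col
  o : ∀ {n : Type} [Finite n], F.Op n → G.Op n
  c_inv : ∀ x, c (F.inv x) = G.inv (c x)
  o_act : ∀ {n m : Type} [Finite n] [Finite m] (σ : m ≃ n) (x : F.Op n),
    o (F.act σ x) = G.act σ (o x)
  col_o : ∀ {n : Type} [Finite n] (x : F.Op n) (k : n), G.col (o x) k = c (F.col x k)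

instance : Category Species where
  Hom := Hom
  id F := ⟨id, id, fun _ => rfl, fun _ _ => rfl, fun _ _ => rfl⟩
  comp f g := ⟨g.c ∘ f.c, g.o ∘ f.o, fun x => by simp [f.c_inv, g.c_inv],
    fun σ x => by simp [f.o_act, g.o_act], fun x k => by simp [f.col_o, g.col_o]⟩

@[ext]
theorem hom_ext {F G : Species} {f g : F ⟶ G} (hc : ∀ x, Hom.c f x = Hom.c g x)
    (ho : ∀ (n : Type) [Finite n] (x : F.Op n), Hom.o f x = Hom.o g x) : f = g :=
  Hom.ext (funext hc) (by funext n _ x; exact ho n x)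

@[simp] theorem id_c (F : Species) (x : F.Col) : Hom.c (𝟙 F) x = x := rfl
@[simp] theorem id_o (F : Species) {n : Type} [Finite n] (x : F.Op n) : Hom.o (𝟙 F) x = x := rfl
@[simp] theorem comp_c {F G K : Species} (f : F ⟶ G) (g : G ⟶ K) (x : F.Col) :
    Hom.c (f ≫ g) x = Hom.c g (Hom.c f x) := rfl
@[simp] theorem comp_o {F G K : Species} (f : F ⟶ G) (g : G ⟶ K) {n : Type} [Finite n]
    (x : F.Op n) : Hom.o (f ≫ g) x = Hom.o g (Hom.o f x) := rfl

end Species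

/-- The species represented by a graph: colours are arcs (maps from the unit graph), operations are
etale maps from corollas. This is the fully faithful embedding of graphs in species. -/
def y : JKGraph ⥤ Species where
  obj X :=
    { Col := X.A
      inv := X.i
      inv_inv := X.i_i
      Op := fun n _ => ULift.{1} (corolla n ⟶ X)
      act := fun σ q => ⟨corMap σ ≫ q.down⟩
      act_refl := fun q => by
        apply ULift.ext
        exact cor_ext (fun _ => rfl) rfl
      act_trans := fun σ τ q => by
        apply ULift.ext
        exact cor_ext (fun _ => rfl) rfl
      col := fun q k => JKGraph.Hom.a q.down (Sum.inl k)
      col_act := fun _ _ _ => rfl }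
  map f :=
    { c := JKGraph.Hom.a f
      o := fun q => ⟨q.down ≫ f⟩
      c_inv := JKGraph.Hom.a_i f
      o_act := fun _ _ => rfl
      col_o := fun _ _ => rfl }

@[simp] theorem y_inv (X : JKGraph) (a : X.A) : (y.obj X).inv a = X.i a := rfl
@[simp] theorem y_map_c {X Y : JKGraph} (f : X ⟶ Y) (a : X.A) :
    Species.Hom.c (y.map f) a = JKGraph.Hom.a f a := rfl
@[simp] theorem y_map_o {X Y : JKGraph} (f : X ⟶ Y) {n : Type} [Finite n] (q : corolla n ⟶ X) :
    Species.Hom.o (y.map f) ⟨q⟩ = (⟨q ≫ f⟩ : ULift.{1} (corolla n ⟶ Y)) := rfl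

section Dec

variable {X Y : JKGraph} {F G : Species}

/-- The value of a decoration at a vertex. -/
def at' (d : y.obj X ⟶ F) (x : X.V) : F.Op (X.Fl x) := Species.Hom.o d ⟨X.star x⟩

theorem dec_o (d : y.obj X ⟶ F) {n : Type} [Finite n] (q : corolla n ⟶ X) :
    Species.Hom.o d ⟨q⟩ = F.act (flEquiv q) (at' d (JKGraph.Hom.v q ())) := by
  have := Species.Hom.o_act d (flEquiv q) ⟨X.star (JKGraph.Hom.v q ())⟩
  rw [at', ← this]
  congr 1
  exact ULift.ext _ _ (eq_corMap_star q)

theorem col_at (d : y.obj X ⟶ F) (x : X.V) (k : X.Fl x) :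
    F.col (at' d x) k = Species.Hom.c d (X.i (X.s k.1)) :=
  Species.Hom.col_o d _ k

theorem dec_ext {d d' : y.obj X ⟶ F} (hc : ∀ a, Species.Hom.c d a = Species.Hom.c d' a)
    (ho : ∀ x, at' d x = at' d' x) : d = d' := by
  apply Species.hom_ext hc
  rintro n _ ⟨q⟩
  rw [dec_o, dec_o, ho]

theorem at_comp (d : y.obj X ⟶ F) (f : F ⟶ G) (x : X.V) :
    at' (d ≫ f) x = Species.Hom.o f (at' d x) := rfl

theorem flEquiv_star_comp (f : X ⟶ Y) (x : X.V) : flEquiv (X.star x ≫ f) = flMap f x :=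
  Equiv.ext fun _ => rfl

theorem at_map (f : X ⟶ Y) (d : y.obj Y ⟶ F) (x : X.V) :
    at' (y.map f ≫ d) x = F.act (flMap f x) (at' d (JKGraph.Hom.v f x)) := by
  have := dec_o d (X.star x ≫ f)
  rw [flEquiv_star_comp] at this
  exact this

/-- A decoration of a graph amounts to colours on the arcs and operations on the vertices. -/
def mkDec (c : X.A → F.Col) (c_i : ∀ a, c (X.i a) = F.inv (c a)) (o : ∀ x, F.Op (X.Fl x))
    (hco : ∀ x k, F.col (o x) k = c (X.i (X.s k.1))) : y.obj X ⟶ F where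
  c := c
  o := fun q => F.act (flEquiv q.down) (o (JKGraph.Hom.v q.down ()))
  c_inv := c_i
  o_act := by
    rintro n m _ _ σ ⟨q⟩
    rw [F.act_trans]
    exact congrArg (fun e => F.act e (o (JKGraph.Hom.v q ()))) (Equiv.ext fun _ => rfl)
  col_o := by
    rintro n _ ⟨q⟩ k
    rw [F.col_act, hco]
    exact congrArg c (hom_a_inl q k).symm

@[simp] theorem mkDec_c (c : X.A → F.Col) (c_i) (o : ∀ x, F.Op (X.Fl x)) (hco) (a : X.A) :
    Species.Hom.c (mkDec c c_i o hco) a = c a := rfl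

@[simp] theorem mkDec_at (c : X.A → F.Col) (c_i) (o : ∀ x, F.Op (X.Fl x)) (hco) (x : X.V) :
    at' (mkDec c c_i o hco) x = o x := by
  have : flEquiv (X.star x) = Equiv.refl _ := Equiv.ext fun _ => rfl
  change F.act (flEquiv (X.star x)) (o x) = o x
  rw [this]
  exact F.act_refl (o x)

end Dec

section Full

variable {X Y : JKGraph}

/-- Fullness of the embedding of graphs in species. -/
def yPre (f : y.obj X ⟶ y.obj Y) : X ⟶ Y :=
  have key : ∀ (w : X.V) (k : X.Fl w), JKGraph.Hom.h (at' f w).down k =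
      JKGraph.Hom.h (at' f (X.p k.1)).down ⟨k.1, rfl⟩ := by
    rintro w ⟨k, rfl⟩
    rfl
  { a := Species.Hom.c f
    h := fun h => JKGraph.Hom.h (at' f (X.p h)).down ⟨h, rfl⟩
    v := fun x => JKGraph.Hom.v (at' f x).down ()
    a_i := Species.Hom.c_inv f
    a_s := fun h => by
      have h1 := col_at f (X.p h) ⟨h, rfl⟩
      have h2 := hom_a_inl (at' f (X.p h)).down ⟨h, rfl⟩
      have h3 : Species.Hom.c f (X.i (X.s h)) = Y.i (Species.Hom.c f (X.s h)) :=
        Species.Hom.c_inv f _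
      have h4 := congrArg Y.i ((h3.symm.trans h1.symm).trans h2)
      exact (Y.i_i _).symm.trans (h4.trans (Y.i_i _))
    v_p := fun h => JKGraph.Hom.v_p (at' f (X.p h)).down ⟨h, rfl⟩
    pull := fun w z hz => by
      obtain ⟨k, ⟨-, hk⟩, hu⟩ := JKGraph.Hom.pull (at' f w).down () z hz
      refine ⟨k.1, ⟨k.2, by rw [← key w k]; exact hk⟩, ?_⟩
      rintro x ⟨hx, hx2⟩
      have := hu ⟨x, hx⟩ ⟨rfl, by rw [key w ⟨x, hx⟩]; exact hx2⟩
      exact congrArg Subtype.val this }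

theorem y_yPre (f : y.obj X ⟶ y.obj Y) : y.map (yPre f) = f := by
  refine dec_ext (fun _ => rfl) fun x => ?_
  have : X.star x ≫ yPre f = (at' f x).down := cor_ext (by rintro ⟨k, rfl⟩; rfl) rfl
  exact ULift.ext _ _ this

theorem y_inj {f g : X ⟶ Y} (h : y.map f = y.map g) : f = g := by
  have hs : ∀ x, X.star x ≫ f = X.star x ≫ g := fun x =>
    congrArg ULift.down (congrArg (fun t => at' t x) h)
  ext x
  · exact congrArg (fun t => Species.Hom.c t x) h
  · exact congrArg (fun t : corolla (X.Fl (X.p x)) ⟶ Y =>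
      JKGraph.Hom.h t (⟨x, rfl⟩ : X.Fl (X.p x))) (hs (X.p x))
  · exact congrArg (fun t => JKGraph.Hom.v t ()) (hs x)

/-- The embedding of graphs in species is fully faithful. -/
def yFF : y.FullyFaithful where
  preimage := yPre
  map_preimage := y_yPre
  preimage_map _ := y_inj (y_yPre _)

end Full

/-! ### The monad -/

/-- An effective `n`-graph: an effective graph together with a bijection of its set of ports with
`n` (the set of ports of the corolla on `n`). -/
structure Shell (n : Type) [Finite n] : Type 1 where
  G : JKGraph
  eff : G.Effective
  port : n ≃ G.Port

/-- An effective `n`-graph decorated by a graphical species `F`, i.e. an effective `n`-graph `G`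
with a morphism `G ⟶ F` of species. -/
structure Piece (F : Species) (n : Type) [Finite n] : Type 1 extends Shell n where
  dec : y.obj G ⟶ F

namespace Shell

variable {n m : Type} [Finite n] [Finite m]

/-- Relabelling of ports. -/
@[simps]
def relabel (σ : m ≃ n) (S : Shell n) : Shell m where
  G := S.G
  eff := S.eff
  port := σ.trans S.port

theorem arc_cases (S : Shell n) (a : S.G.A) :
    (a ∈ Set.range S.G.s ∧ S.G.i a ∈ Set.range S.G.s) ∨
      (∃ k, a = (S.port k).1) ∨ ∃ k, a = S.G.i (S.port k).1 := by
  by_cases h1 : a ∈ Set.range S.G.s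
  · by_cases h2 : S.G.i a ∈ Set.range S.G.s
    · exact Or.inl ⟨h1, h2⟩
    · exact Or.inr (Or.inr ⟨S.port.symm ⟨_, h2⟩, by simp [S.G.i_i]⟩)
  · exact Or.inr (Or.inl ⟨S.port.symm ⟨_, h1⟩, by simp⟩)

theorem iport_mem (S : Shell n) (k : n) : S.G.i (S.port k).1 ∈ Set.range S.G.s :=
  (S.eff.2 (S.port k).1).resolve_left (S.port k).2

end Shell

namespace Piece

variable {F F' : Species} {n m : Type} [Finite n] [Finite m]

/-- Isomorphism of decorated `n`-graphs: an isomorphism of graphs compatible with the specified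
bijections on ports and with the decorations. -/
def Rel (P Q : Piece F n) : Prop :=
  ∃ θ : P.G ≅ Q.G, (∀ k, JKGraph.Hom.a θ.hom (P.port k).1 = (Q.port k).1) ∧
    y.map θ.hom ≫ Q.dec = P.dec

theorem rel_of {P Q : Piece F n} (f : y.obj P.G ⟶ y.obj Q.G) (g : y.obj Q.G ⟶ y.obj P.G)
    (hfg : f ≫ g = 𝟙 _) (hgf : g ≫ f = 𝟙 _)
    (hp : ∀ k, Species.Hom.c f (P.port k).1 = (Q.port k).1) (hd : f ≫ Q.dec = P.dec) :
    Rel P Q := by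
  refine ⟨yFF.preimageIso ⟨f, g, hfg, hgf⟩, hp, ?_⟩
  have : y.map (yFF.preimage f) = f := yFF.map_preimage f
  rw [← hd]
  exact congrArg (· ≫ Q.dec) this

theorem rel_refl (P : Piece F n) : Rel P P := ⟨Iso.refl _, fun _ => rfl, by simp⟩

/-- The groupoid of decorated `n`-graphs gives a set of isomorphism classes. -/
def setoid (F : Species) (n : Type) [Finite n] : Setoid (Piece F n) where
  r := Rel
  iseqv :=
    { refl := rel_refl
      symm := by
        rintro P Q ⟨θ, h1, h2⟩
        refine ⟨θ.symm, fun k => ?_, ?_⟩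
        · rw [← h1 k, ← JKGraph.comp_a]
          simp
        · rw [← h2, ← Category.assoc, ← y.map_comp]
          simp
      trans := by
        rintro P Q R ⟨θ, h1, h2⟩ ⟨ψ, h3, h4⟩
        refine ⟨θ ≪≫ ψ, fun k => ?_, ?_⟩
        · simp [h1, h3]
        · simp [h2, h4] }

/-- Relabelling of ports. -/
def relabel (σ : m ≃ n) (P : Piece F n) : Piece F m where
  toShell := P.toShell.relabel σ
  dec := P.dec

/-- Change of decorations. -/
def map (f : F ⟶ F') (P : Piece F n) : Piece F' n where
  toShell := P.toShell
  dec := P.dec ≫ f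

/-- The isomorphism class of a decorated `n`-graph. -/
def cls (P : Piece F n) : Quotient (setoid F n) := Quotient.mk _ P

theorem cls_eq {P Q : Piece F n} : cls P = cls Q ↔ Rel P Q :=
  ⟨fun h => Quotient.exact h, fun h => Quotient.sound (s := setoid F n) h⟩

theorem relabel_rel (σ : m ≃ n) {P Q : Piece F n} (h : Rel P Q) :
    Rel (relabel σ P) (relabel σ Q) := by
  obtain ⟨θ, h1, h2⟩ := h
  exact ⟨θ, fun k => h1 (σ k), h2⟩

theorem map_rel (f : F ⟶ F') {P Q : Piece F n} (h : Rel P Q) : Rel (map f P) (map f Q) := by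
  obtain ⟨θ, h1, h2⟩ := h
  refine ⟨θ, h1, ?_⟩
  change y.map θ.hom ≫ Q.dec ≫ f = P.dec ≫ f
  rw [← h2, Category.assoc]

end Piece

open Piece

/-- The species `F̄` of `F`-decorated effective graphs: same colours as `F`, and the operations on
`n` are the isomorphism classes of effective `n`-graphs decorated by `F`. -/
def bar (F : Species) : Species where
  Col := F.Col
  inv := F.inv
  inv_inv := F.inv_inv
  Op := fun n _ => Quotient (setoid F n)
  act := fun σ => Quotient.lift (fun P => cls (relabel σ P))
    fun _ _ h => cls_eq.2 (relabel_rel σ h)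
  act_refl := by
    rintro n _ ⟨P⟩
    rfl
  act_trans := by
    rintro n m k _ _ _ σ τ ⟨P⟩
    rfl
  col := fun {n} _ => Quotient.lift (fun P k => Species.Hom.c P.dec (P.port k).1) (by
    rintro P Q ⟨θ, h1, h2⟩
    funext k
    rw [← h1, ← h2]
    rfl)
  col_act := by
    rintro n m _ _ σ ⟨P⟩ k
    rfl

@[simp] theorem bar_act {F : Species} {n m : Type} [Finite n] [Finite m] (σ : m ≃ n)
    (P : Piece F n) : (bar F).act σ (cls P) = cls (relabel σ P) := rfl

theorem bar_col {F : Species} {n : Type} [Finite n] (P : Piece F n) (k : n) :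
    (bar F).col (cls P) k = Species.Hom.c P.dec (P.port k).1 := rfl

/-- The action of `F ↦ F̄` on morphisms: change of decorations. -/
def barMap {F F' : Species} (f : F ⟶ F') : bar F ⟶ bar F' where
  c := @Species.Hom.c F F' f
  o := Quotient.lift (fun P => cls (map f P)) fun _ _ h => cls_eq.2 (map_rel f h)
  c_inv := @Species.Hom.c_inv F F' f
  o_act := by
    rintro n m _ _ σ ⟨P⟩
    rfl
  col_o := by
    rintro n _ ⟨P⟩ k
    rfl

theorem barMap_cls {F F' : Species} (f : F ⟶ F') {n : Type} [Finite n]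
    (P : Piece F n) : Species.Hom.o (barMap f) (cls P) = cls (map f P) := rfl

/-- The endofunctor `F ↦ F̄`. -/
def barFunctor : Species ⥤ Species where
  obj := bar
  map := barMap
  map_id F := by
    refine Species.hom_ext (fun _ => rfl) ?_
    rintro n _ ⟨P⟩
    exact cls_eq.2 ⟨Iso.refl _, fun _ => rfl, by simp [Piece.map]⟩
  map_comp f g := by
    refine Species.hom_ext (fun _ => rfl) ?_
    rintro n _ ⟨P⟩
    exact cls_eq.2 ⟨Iso.refl _, fun _ => rfl, by simp [Piece.map]⟩

/-- The corolla on `n`, as an `n`-graph. -/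
def corShell (n : Type) [Finite n] : Shell n where
  G := corolla n
  eff := ⟨⟨()⟩, by rintro (a | a) <;> simp⟩
  port := Equiv.ofBijective (fun k => ⟨Sum.inl k, by simp⟩) ⟨fun a b h => by simpa using h, by
    rintro ⟨a | a, ha⟩
    · exact ⟨a, rfl⟩
    · exact absurd ⟨a, rfl⟩ ha⟩

@[simp] theorem corShell_port {n : Type} [Finite n] (k : n) :
    ((corShell n).port k).1 = Sum.inl k := rfl

/-- The canonical identification of `n` with the flags of the corolla on `n`. -/
def corFl (n : Type) [Finite n] : n ≃ (corolla n).Fl () :=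
  ⟨fun k => ⟨k, rfl⟩, fun k => k.1, fun _ => rfl, fun _ => rfl⟩

/-- The corolla decorated by a single operation. -/
def corDec {F : Species} {n : Type} [Finite n] (x : F.Op n) : y.obj (corolla n) ⟶ F :=
  mkDec (X := corolla n) (Sum.elim (F.col x) (fun k => F.inv (F.col x k)))
    (by rintro (a | a) <;> simp [F.inv_inv])
    (fun _ => F.act (corFl n).symm x)
    (by
      rintro ⟨⟩ k
      rw [F.col_act]
      rfl)

theorem cor_dec_ext {F : Species} {n : Type} [Finite n] {d d' : y.obj (corolla n) ⟶ F}
    (h : Species.Hom.o d ⟨𝟙 (corolla n)⟩ = Species.Hom.o d' ⟨𝟙 (corolla n)⟩) : d = d' := by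
  have hc : ∀ k : n, Species.Hom.c d (Sum.inl k : n ⊕ n) = Species.Hom.c d' (Sum.inl k : n ⊕ n) :=
    fun k => (Species.Hom.col_o d ⟨𝟙 (corolla n)⟩ k).symm.trans
      ((congrArg (fun t => F.col t k) h).trans (Species.Hom.col_o d' ⟨𝟙 (corolla n)⟩ k))
  refine Species.hom_ext ?_ ?_
  · rintro (k | k)
    · exact hc k
    · exact (Species.Hom.c_inv d (Sum.inl k : n ⊕ n)).trans
        ((congrArg F.inv (hc k)).trans (Species.Hom.c_inv d' (Sum.inl k : n ⊕ n)).symm)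
  · rintro m _ ⟨q⟩
    have hq : (⟨q⟩ : (y.obj (corolla n)).Op m) =
        (y.obj (corolla n)).act ((flEquiv q).trans (corFl n).symm) ⟨𝟙 (corolla n)⟩ :=
      ULift.ext _ _ (cor_ext (fun k => rfl) rfl)
    rw [hq]
    exact (Species.Hom.o_act d _ _).trans
      ((congrArg (F.act _) h).trans (Species.Hom.o_act d' _ _).symm)

theorem corDec_at {F : Species} {n : Type} [Finite n] (x : F.Op n) :
    at' (corDec x) () = F.act (corFl n).symm x :=
  mkDec_at (X := corolla n) _ _ _ _ _

theorem corDec_id {F : Species} {n : Type} [Finite n] (x : F.Op n) :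
    Species.Hom.o (corDec x) ⟨𝟙 (corolla n)⟩ = x := by
  have : F.act (flEquiv (𝟙 (corolla n))) (F.act (corFl n).symm x) = x := by
    rw [F.act_trans]
    have : (flEquiv (𝟙 (corolla n))).trans (corFl n).symm = Equiv.refl n := Equiv.ext fun _ => rfl
    exact (congrArg (fun e => F.act e x) this).trans (F.act_refl x)
  exact this

/-- The unit of the monad: an operation is regarded as a decorated corolla. -/
def etaApp (F : Species) : F ⟶ bar F where
  c := id
  o {n} _ x := cls ⟨corShell n, corDec x⟩
  c_inv := fun _ => rfl
  o_act := by
    rintro n m _ _ σ x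
    refine cls_eq.2 ⟨⟨corMap σ, corMap σ.symm, cor_ext (fun k => σ.symm_apply_apply k) rfl,
      cor_ext (fun k => σ.apply_symm_apply k) rfl⟩,
      fun k => rfl, ?_⟩
    refine cor_dec_ext ?_
    refine Eq.trans ?_ (corDec_id _).symm
    have := Species.Hom.o_act (corDec x) σ ⟨𝟙 (corolla n)⟩
    rw [corDec_id] at this
    refine Eq.trans ?_ this
    exact congrArg (Species.Hom.o (corDec x)) (ULift.ext _ _ (cor_ext (fun _ => rfl) rfl))
  col_o := fun _ _ => rfl

theorem eta_nat {F F' : Species} (f : F ⟶ F') :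
    f ≫ etaApp F' = etaApp F ≫ barMap f := by
  refine Species.hom_ext (fun _ => rfl) ?_
  intro n _ x
  refine cls_eq.2 ⟨Iso.refl _, fun _ => rfl, ?_⟩
  refine cor_dec_ext ?_
  refine Eq.trans ?_ (corDec_id _).symm
  change Species.Hom.o f (Species.Hom.o (corDec x) ⟨𝟙 (corolla n)⟩) = _
  rw [corDec_id]

theorem chase {C : Type*} [Category C] {W X Y Z : C} {i : W ⟶ X} {f : X ⟶ Y} {g : Y ⟶ Z}
    {j : W ⟶ Y} {r : W ⟶ Z} (h : i ≫ f = j) (h2 : j ≫ g = r) : i ≫ f ≫ g = r := by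
  rw [← Category.assoc, h, h2]

theorem chase2 {C : Type*} [Category C] {W X Y Z : C} {i : W ⟶ X} {f : X ⟶ Y} {g : Y ⟶ Z}
    {j : X ⟶ Z} {r : W ⟶ Z} (h : f ≫ g = j) (h2 : i ≫ j = r) : (i ≫ f) ≫ g = r := by
  rw [Category.assoc, h, h2]

theorem y_cancel {X Y : JKGraph} (θ : X ≅ Y) {K : Species} (f : y.obj X ⟶ K) :
    y.map θ.hom ≫ y.map θ.inv ≫ f = f := by
  rw [← Category.assoc, ← y.map_comp, Iso.hom_inv_id, y.map_id, Category.id_comp]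

section Glue

variable (R : JKGraph) (P : ∀ x : R.V, Shell (R.Fl x))

/-- The inner arcs of a graph: those belonging to inner edges. -/
abbrev JKGraph.Inner (X : JKGraph) : Type :=
  {a : X.A // a ∈ Set.range X.s ∧ X.i a ∈ Set.range X.s}

open Classical in
/-- Where the arcs of the graph substituted into the vertex `x` of `R` go: inner arcs are kept,
port `k` is identified with the arc of `R` pointing towards `x` along the flag `k`. -/
def glueArc (x : R.V) (a : (P x).G.A) : R.A ⊕ Σ x, (P x).G.Inner :=
  if h1 : a ∈ Set.range (P x).G.s then
    if h2 : (P x).G.i a ∈ Set.range (P x).G.s then Sum.inr ⟨x, a, h1, h2⟩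
    else Sum.inl (R.s ((P x).port.symm ⟨_, h2⟩).1)
  else Sum.inl (R.i (R.s ((P x).port.symm ⟨a, h1⟩).1))

variable {R}

theorem glueArc_inner (x : R.V) (a : (P x).G.Inner) : glueArc R P x a.1 = Sum.inr ⟨x, a⟩ := by
  rw [glueArc, dif_pos a.2.1, dif_pos a.2.2]

theorem glueArc_port (x : R.V) (k : R.Fl x) :
    glueArc R P x ((P x).port k).1 = Sum.inl (R.i (R.s k.1)) := by
  rw [glueArc, dif_neg ((P x).port k).2]
  simp

theorem glueArc_iport (x : R.V) (k : R.Fl x) :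
    glueArc R P x ((P x).G.i ((P x).port k).1) = Sum.inl (R.s k.1) := by
  have h : ((P x).G.i ((P x).G.i ((P x).port k).1)) ∉ Set.range (P x).G.s := by
    rw [(P x).G.i_i]
    exact ((P x).port k).2
  rw [glueArc, dif_pos ((P x).iport_mem k), dif_neg h]
  simp [(P x).G.i_i]

theorem glueArc_i (x : R.V) (a : (P x).G.A) :
    glueArc R P x ((P x).G.i a) =
      Sum.map R.i (fun t => ⟨t.1, (P t.1).G.i t.2.1, t.2.2.2, by
        rw [(P t.1).G.i_i]; exact t.2.2.1⟩) (glueArc R P x a) := by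
  rcases (P x).arc_cases a with h | ⟨k, rfl⟩ | ⟨k, rfl⟩
  · rw [glueArc_inner P x ⟨a, h⟩]
    exact glueArc_inner P x ⟨(P x).G.i a, h.2, by rw [(P x).G.i_i]; exact h.1⟩
  · rw [glueArc_iport, glueArc_port]
    simp [R.i_i]
  · rw [glueArc_iport, (P x).G.i_i, glueArc_port]
    simp

variable (R)

/-- Substitution of graphs `P x` into the vertices `x` of `R`, i.e. the graph obtained by gluing
together the graphs `P x` according to the same recipe that assembles `R` from its corollas. -/
@[reducible]
def glue : JKGraph where
  A := R.A ⊕ Σ x, (P x).G.Inner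
  H := Σ x, (P x).G.H
  V := Σ x, (P x).G.V
  finA := inferInstance
  finH := inferInstance
  finV := inferInstance
  i := Sum.map R.i (fun t => ⟨t.1, (P t.1).G.i t.2.1, t.2.2.2, by
        rw [(P t.1).G.i_i]; exact t.2.2.1⟩)
  s := fun t => glueArc R P t.1 ((P t.1).G.s t.2)
  p := fun t => ⟨t.1, (P t.1).G.p t.2⟩
  i_i := by
    rintro (a | ⟨x, a, ha⟩)
    · simp [R.i_i]
    · simp [(P x).G.i_i]
  i_ne := by
    rintro (a | ⟨x, a, ha⟩)
    · simp [R.i_ne]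
    · simp [(P x).G.i_ne]
  s_inj := by
    rintro ⟨x, h⟩ ⟨x', h'⟩ e
    dsimp only at e
    have key : ∀ (x : R.V) (h : (P x).G.H),
        (∃ ha, glueArc R P x ((P x).G.s h) = Sum.inr ⟨x, (P x).G.s h, ha⟩) ∨
        ∃ k, (P x).G.s h = (P x).G.i ((P x).port k).1 ∧
          glueArc R P x ((P x).G.s h) = Sum.inl (R.s k.1) := by
      intro x h
      rcases (P x).arc_cases ((P x).G.s h) with ha | ⟨k, hk⟩ | ⟨k, hk⟩
      · exact Or.inl ⟨ha, glueArc_inner P x ⟨_, ha⟩⟩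
      · exact absurd ⟨h, hk⟩ ((P x).port k).2
      · exact Or.inr ⟨k, hk, by rw [hk, glueArc_iport]⟩
    rcases key x h with ⟨ha, e1⟩ | ⟨k, hk, e1⟩ <;>
      rcases key x' h' with ⟨ha', e2⟩ | ⟨k', hk', e2⟩ <;> rw [e1, e2] at e
    · have e3 := Sum.inr_injective e
      obtain ⟨rfl, e4⟩ := Sigma.mk.inj e3
      have e5 := congrArg Subtype.val (eq_of_heq e4)
      rw [(P x).G.s_inj e5]
    · cases e
    · cases e
    · have e3 := R.s_inj (Sum.inl_injective e)
      obtain ⟨k, rfl⟩ := k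
      obtain ⟨k', rfl⟩ := k'
      dsimp only at e3
      subst e3
      have e5 := hk.trans hk'.symm
      rw [(P _).G.s_inj e5]

/-- The canonical etale map from the graph substituted into `x`. -/
def glueι (x : R.V) : (P x).G ⟶ glue R P where
  a := glueArc R P x
  h := fun h => ⟨x, h⟩
  v := fun v => ⟨x, v⟩
  a_i := glueArc_i P x
  a_s := fun _ => rfl
  v_p := fun _ => rfl
  pull := by
    rintro w ⟨x', h⟩ e
    obtain ⟨rfl, e4⟩ := Sigma.mk.inj e
    refine ⟨h, ⟨eq_of_heq e4, rfl⟩, ?_⟩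
    rintro h' ⟨-, e5⟩
    exact eq_of_heq (Sigma.mk.inj e5).2

theorem glue_arc_cases (a : (glue R P).A) :
    (∃ b : R.A, a = Sum.inl b) ∨ ∃ x, ∃ b : (P x).G.A, a = JKGraph.Hom.a (glueι R P x) b := by
  rcases a with b | ⟨x, b⟩
  · exact Or.inl ⟨b, rfl⟩
  · exact Or.inr ⟨x, b.1, (glueArc_inner P x b).symm⟩

theorem glueι_port (x : R.V) (k : R.Fl x) :
    JKGraph.Hom.a (glueι R P x) ((P x).port k).1 = Sum.inl (R.i (R.s k.1)) :=
  glueArc_port P x k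

theorem glue_range_s (b : R.A) :
    (Sum.inl b : (glue R P).A) ∈ Set.range (glue R P).s ↔ b ∈ Set.range R.s := by
  constructor
  · rintro ⟨⟨x, h⟩, e⟩
    change glueArc R P x ((P x).G.s h) = _ at e
    rcases (P x).arc_cases ((P x).G.s h) with ha | ⟨k, hk⟩ | ⟨k, hk⟩
    · have := e.symm.trans (glueArc_inner P x ⟨_, ha⟩)
      cases this
    · exact absurd ⟨h, hk⟩ ((P x).port k).2
    · rw [hk, glueArc_iport] at e
      exact ⟨k.1, Sum.inl_injective e⟩
  · rintro ⟨k, rfl⟩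
    obtain ⟨h, hh⟩ := (P (R.p k)).iport_mem ⟨k, rfl⟩
    refine ⟨⟨R.p k, h⟩, ?_⟩
    change glueArc R P (R.p k) ((P (R.p k)).G.s h) = _
    rw [hh, glueArc_iport]

theorem glue_inner_mem (x : R.V) (b : (P x).G.Inner) :
    (Sum.inr ⟨x, b⟩ : (glue R P).A) ∈ Set.range (glue R P).s := by
  obtain ⟨b, ⟨h, rfl⟩, hb⟩ := b
  exact ⟨⟨x, h⟩, glueArc_inner P x ⟨_, ⟨h, rfl⟩, hb⟩⟩

theorem glue_noIsolatedEdges (hR : R.NoIsolatedEdges) : (glue R P).NoIsolatedEdges := by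
  rintro (b | ⟨x, b⟩)
  · exact (hR b).imp (glue_range_s R P b).2 (glue_range_s R P (R.i b)).2
  · exact Or.inl (glue_inner_mem R P x b)

theorem glue_effective (hR : R.Effective) : (glue R P).Effective := by
  refine ⟨?_, glue_noIsolatedEdges R P hR.2⟩
  obtain ⟨x⟩ := hR.1
  obtain ⟨v⟩ := (P x).eff.1
  exact ⟨⟨x, v⟩⟩

/-- The ports of `R` are the ports of the graph obtained by substitution. -/
def gluePort : R.Port ≃ (glue R P).Port :=
  Equiv.ofBijective (fun b => ⟨Sum.inl b.1, fun h => b.2 ((glue_range_s R P b.1).1 h)⟩) (by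
    constructor
    · intro b b' h
      exact Subtype.ext (Sum.inl_injective (congrArg Subtype.val h))
    · rintro ⟨b | ⟨x, b⟩, hb⟩
      · exact ⟨⟨b, fun h => hb ((glue_range_s R P b).2 h)⟩, rfl⟩
      · exact absurd (glue_inner_mem R P x b) hb)

@[simp] theorem gluePort_val (b : R.Port) : (gluePort R P b).1 = Sum.inl b.1 := rfl

variable {K : Species}

theorem glue_ext {f g : y.obj (glue R P) ⟶ K}
    (h : ∀ b : R.A, Species.Hom.c f (Sum.inl b : R.A ⊕ _) = Species.Hom.c g (Sum.inl b : R.A ⊕ _))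
    (hι : ∀ x, y.map (glueι R P x) ≫ f = y.map (glueι R P x) ≫ g) : f = g := by
  refine dec_ext ?_ ?_
  · intro a
    obtain ⟨b, rfl⟩ | ⟨x, b, rfl⟩ := glue_arc_cases R P a
    · exact h b
    · exact congrArg (fun t => Species.Hom.c t b) (hι x)
  · rintro ⟨x, v⟩
    have h1 := congrArg (fun t => at' t v) (hι x)
    simp only [at_map] at h1
    have h2 := congrArg (K.act (flMap (glueι R P x) v).symm) h1
    rw [K.act_trans, K.act_trans, Equiv.symm_trans_self, K.act_refl, K.act_refl] at h2
    exact h2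

theorem glue_c_aux (c : R.A → K.Col) (c_i : ∀ a, c (R.i a) = K.inv (c a))
    (d : ∀ x, y.obj (P x).G ⟶ K)
    (hd : ∀ x k, Species.Hom.c (d x) ((P x).port k).1 = c (R.i (R.s k.1)))
    (x : R.V) (a : (P x).G.A) :
    Sum.elim c (fun t : Σ x, (P x).G.Inner => Species.Hom.c (d t.1) t.2.1) (glueArc R P x a) =
      Species.Hom.c (d x) a := by
  rcases (P x).arc_cases a with h | ⟨k, rfl⟩ | ⟨k, rfl⟩
  · rw [glueArc_inner P x ⟨a, h⟩]
    rfl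
  · rw [glueArc_port, hd]
    rfl
  · rw [glueArc_iport]
    have h1 : Species.Hom.c (d x) ((P x).G.i ((P x).port k).1) =
      K.inv (Species.Hom.c (d x) ((P x).port k).1) := Species.Hom.c_inv (d x) _
    rw [h1, hd, ← c_i, R.i_i]
    rfl

/-- The universal property of substitution: a decoration of the graph obtained by substitution
is given by decorations of the graphs `P x` that agree along the edges of `R`. -/
def glueDesc (c : R.A → K.Col) (c_i : ∀ a, c (R.i a) = K.inv (c a))
    (d : ∀ x, y.obj (P x).G ⟶ K)
    (hd : ∀ x k, Species.Hom.c (d x) ((P x).port k).1 = c (R.i (R.s k.1))) : y.obj (glue R P) ⟶ K :=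
  mkDec (X := glue R P)
    (Sum.elim c (fun t : Σ x, (P x).G.Inner => Species.Hom.c (d t.1) t.2.1))
    (by
      rintro (a | ⟨x, a⟩)
      · exact c_i a
      · exact Species.Hom.c_inv (d x) a.1)
    (fun t => K.act (flMap (glueι R P t.1) t.2).symm (at' (d t.1) t.2))
    (by
      rintro ⟨x, v⟩ k
      obtain ⟨k, rfl⟩ := (flMap (glueι R P x) v).surjective k
      refine (K.col_act (flMap (glueι R P x) v).symm (at' (d x) v) _).trans ?_
      rw [Equiv.symm_apply_apply, col_at]
      refine (glue_c_aux R P c c_i d hd x _).symm.trans ?_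
      congr 1
      exact JKGraph.Hom.a_i (glueι R P x) ((P x).G.s k.1))

@[simp] theorem glueDesc_inl (c : R.A → K.Col) (c_i : ∀ a, c (R.i a) = K.inv (c a))
    (d : ∀ x, y.obj (P x).G ⟶ K)
    (hd : ∀ x k, Species.Hom.c (d x) ((P x).port k).1 = c (R.i (R.s k.1))) (b : R.A) :
    Species.Hom.c (glueDesc R P c c_i d hd) (Sum.inl b : R.A ⊕ _) = c b := rfl

theorem glueDesc_at (c : R.A → K.Col) (c_i : ∀ a, c (R.i a) = K.inv (c a))
    (d : ∀ x, y.obj (P x).G ⟶ K)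
    (hd : ∀ x k, Species.Hom.c (d x) ((P x).port k).1 = c (R.i (R.s k.1))) (x : R.V) (v : (P x).G.V) :
    at' (glueDesc R P c c_i d hd) ⟨x, v⟩ =
      K.act (flMap (glueι R P x) v).symm (at' (d x) v) :=
  mkDec_at (X := glue R P) _ _ _ _ _

@[simp] theorem glueι_desc (c : R.A → K.Col) (c_i : ∀ a, c (R.i a) = K.inv (c a))
    (d : ∀ x, y.obj (P x).G ⟶ K)
    (hd : ∀ x k, Species.Hom.c (d x) ((P x).port k).1 = c (R.i (R.s k.1))) (x : R.V) :
    y.map (glueι R P x) ≫ glueDesc R P c c_i d hd = d x := by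
  refine dec_ext (glue_c_aux R P c c_i d hd x) ?_
  intro v
  rw [at_map]
  refine (congrArg (K.act (flMap (glueι R P x) v)) (glueDesc_at R P c c_i d hd x v)).trans ?_
  rw [K.act_trans, Equiv.self_trans_symm, K.act_refl]

end Glue

section Sub

variable {F F' : Species} {n m : Type} [Finite n] [Finite m]

/-- Erasing the circles: from an effective `n`-graph `R` whose vertices are decorated by effective
`F`-graphs `P x` with matching interfaces, get a single `F`-decorated effective `n`-graph. -/
def substPiece (R : Shell n) (c : R.G.A → F.Col) (c_i : ∀ a, c (R.G.i a) = F.inv (c a))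
    (P : ∀ x : R.G.V, Piece F (R.G.Fl x))
    (hP : ∀ x k, Species.Hom.c (P x).dec ((P x).port k).1 = c (R.G.i (R.G.s k.1))) :
    Piece F n where
  G := glue R.G (fun x => (P x).toShell)
  eff := glue_effective R.G (fun x => (P x).toShell) R.eff
  port := R.port.trans (gluePort R.G fun x => (P x).toShell)
  dec := glueDesc R.G (fun x => (P x).toShell) c c_i (fun x => (P x).dec) hP

theorem substPiece_ι (R : Shell n) (c : R.G.A → F.Col) (c_i : ∀ a, c (R.G.i a) = F.inv (c a))
    (P : ∀ x : R.G.V, Piece F (R.G.Fl x))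
    (hP : ∀ x k, Species.Hom.c (P x).dec ((P x).port k).1 = c (R.G.i (R.G.s k.1))) (x : R.G.V) :
    y.map (glueι R.G (fun x => (P x).toShell) x) ≫ (substPiece R c c_i P hP).dec = (P x).dec :=
  glueι_desc R.G (fun x => (P x).toShell) c c_i (fun x => (P x).dec) hP x

theorem substPiece_at (R : Shell n) (c : R.G.A → F.Col) (c_i : ∀ a, c (R.G.i a) = F.inv (c a))
    (P : ∀ x : R.G.V, Piece F (R.G.Fl x))
    (hP : ∀ x k, Species.Hom.c (P x).dec ((P x).port k).1 = c (R.G.i (R.G.s k.1))) (x : R.G.V)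
    (v : (P x).G.V) :
    at' (X := glue R.G fun x => (P x).toShell) (substPiece R c c_i P hP).dec ⟨x, v⟩ =
      F.act (flMap (glueι R.G (fun x => (P x).toShell) x) v).symm (at' (P x).dec v) :=
  glueDesc_at R.G (fun x => (P x).toShell) c c_i (fun x => (P x).dec) hP x v

theorem substPiece_rel {R R' : Shell n} {c : R.G.A → F.Col}
    {c_i : ∀ a, c (R.G.i a) = F.inv (c a)}
    {c' : R'.G.A → F.Col} {c_i' : ∀ a, c' (R'.G.i a) = F.inv (c' a)}
    {P : ∀ x : R.G.V, Piece F (R.G.Fl x)} {P' : ∀ x : R'.G.V, Piece F (R'.G.Fl x)}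
    {hP : ∀ x k, Species.Hom.c (P x).dec ((P x).port k).1 = c (R.G.i (R.G.s k.1))}
    {hP' : ∀ x k, Species.Hom.c (P' x).dec ((P' x).port k).1 = c' (R'.G.i (R'.G.s k.1))}
    (θ : R.G ≅ R'.G) (hport : ∀ k, JKGraph.Hom.a θ.hom (R.port k).1 = (R'.port k).1)
    (hc : ∀ a, c' (JKGraph.Hom.a θ.hom a) = c a)
    (h : ∀ x, Rel (P x) (relabel (flMap θ.hom x) (P' (JKGraph.Hom.v θ.hom x)))) :
    Rel (substPiece R c c_i P hP) (substPiece R' c' c_i' P' hP') := by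
  choose ψ h1 h2 using h
  have hinv : ∀ a, JKGraph.Hom.a θ.inv (JKGraph.Hom.a θ.hom a) = a := fun a =>
    congrArg (fun t => JKGraph.Hom.a t a) θ.hom_inv_id
  have hinv' : ∀ a, JKGraph.Hom.a θ.hom (JKGraph.Hom.a θ.inv a) = a := fun a =>
    congrArg (fun t => JKGraph.Hom.a t a) θ.inv_hom_id
  let e : R.G.V ≃ R'.G.V := ⟨JKGraph.Hom.v θ.hom, JKGraph.Hom.v θ.inv,
    fun v => congrArg (fun t => JKGraph.Hom.v t v) θ.hom_inv_id,
    fun v => congrArg (fun t => JKGraph.Hom.v t v) θ.inv_hom_id⟩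
  let S := glue R.G (fun x => (P x).toShell)
  let S' := glue R'.G (fun x => (P' x).toShell)
  let ι := glueι R.G (fun x => (P x).toShell)
  let ι' := glueι R'.G (fun x => (P' x).toShell)
  let f : y.obj S ⟶ y.obj S' := glueDesc (K := y.obj S') R.G (fun x => (P x).toShell)
    (fun a => (Sum.inl (JKGraph.Hom.a θ.hom a) : R'.G.A ⊕ _))
    (fun a => congrArg Sum.inl (JKGraph.Hom.a_i θ.hom a))
    (fun x => y.map (ψ x).hom ≫ y.map (ι' (e x)))
    (by
      intro x k
      change JKGraph.Hom.a (ι' (e x)) (JKGraph.Hom.a (ψ x).hom ((P x).port k).1) = _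
      rw [h1]
      refine (glueι_port R'.G (fun x => (P' x).toShell) (e x) (flMap θ.hom x k)).trans ?_
      congr 1
      rw [JKGraph.Hom.a_i, JKGraph.Hom.a_s]
      rfl)
  let d' : ∀ x', y.obj (P' x').G ⟶ y.obj S := e.piCongrLeft (fun x' => y.obj (P' x').G ⟶ y.obj S)
    (fun x => y.map (ψ x).inv ≫ y.map (ι x))
  have hd' : ∀ x, d' (e x) = y.map (ψ x).inv ≫ y.map (ι x) := fun x =>
    e.piCongrLeft_apply_apply _ _ x
  let g : y.obj S' ⟶ y.obj S := glueDesc (K := y.obj S) R'.G (fun x => (P' x).toShell)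
    (fun a => (Sum.inl (JKGraph.Hom.a θ.inv a) : R.G.A ⊕ _))
    (fun a => congrArg Sum.inl (JKGraph.Hom.a_i θ.inv a))
    d'
    (by
      intro x' k
      obtain ⟨x, rfl⟩ := e.surjective x'
      obtain ⟨k, rfl⟩ := (flMap θ.hom x).surjective k
      rw [hd']
      change JKGraph.Hom.a (ι x) (JKGraph.Hom.a (ψ x).inv
        ((P' (e x)).port (flMap θ.hom x k)).1) = _
      have h3 : JKGraph.Hom.a (ψ x).inv ((P' (e x)).port (flMap θ.hom x k)).1 =
          ((P x).port k).1 := by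
        refine (congrArg (JKGraph.Hom.a (ψ x).inv) (h1 x k).symm).trans ?_
        exact congrArg (fun t => JKGraph.Hom.a t ((P x).port k).1) (ψ x).hom_inv_id
      rw [h3]
      refine (glueι_port R.G (fun x => (P x).toShell) x k).trans ?_
      congr 1
      rw [flMap_val, ← JKGraph.Hom.a_s, ← JKGraph.Hom.a_i, hinv])
  have hf : ∀ x, y.map (ι x) ≫ f = y.map (ψ x).hom ≫ y.map (ι' (e x)) := fun x =>
    glueι_desc R.G (fun x => (P x).toShell) _ _ _ _ x
  have hg : ∀ x, y.map (ι' (e x)) ≫ g = y.map (ψ x).inv ≫ y.map (ι x) := fun x =>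
    (glueι_desc R'.G (fun x => (P' x).toShell) _ _ _ _ (e x)).trans (hd' x)
  refine rel_of f g ?_ ?_ ?_ ?_
  · refine glue_ext R.G (fun x => (P x).toShell) (fun b => congrArg Sum.inl (hinv b)) fun x => ?_
    refine Eq.trans (b := y.map (ι x)) ?_ (Category.comp_id _).symm
    refine chase (hf x) (chase2 (hg x) ?_)
    exact y_cancel (ψ x) (y.map (ι x))
  · refine glue_ext R'.G (fun x => (P' x).toShell) (fun b => congrArg Sum.inl (hinv' b))
      fun x' => ?_
    obtain ⟨x, rfl⟩ := e.surjective x'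
    refine Eq.trans (b := y.map (ι' (e x))) ?_ (Category.comp_id _).symm
    refine chase (hg x) (chase2 (hf x) ?_)
    exact y_cancel (ψ x).symm (y.map (ι' (e x)))
  · intro k
    exact congrArg Sum.inl (hport k)
  · refine glue_ext R.G (fun x => (P x).toShell) hc fun x => ?_
    refine chase (hf x) (chase2 (glueι_desc R'.G (fun x => (P' x).toShell) _ _ _ _ (e x)) ?_)
    refine Eq.trans (h2 x) ?_
    exact (substPiece_ι R c c_i P hP x).symm

end Sub

section Mu

variable {F F' : Species} {n m : Type} [Finite n] [Finite m]

theorem rep_col {X : JKGraph} (d : y.obj X ⟶ bar F) (x : X.V) (P : Piece F (X.Fl x))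
    (h : cls P = at' d x) (k : X.Fl x) :
    Species.Hom.c P.dec (P.port k).1 = Species.Hom.c d (X.i (X.s k.1)) := by
  rw [← bar_col, h]
  exact col_at d x k

/-- Substitution into a graph decorated by isomorphism classes of decorated graphs, with respect
to representatives `P` of the classes. -/
def muOf (Q : Piece (bar F) n) (P : ∀ x : Q.G.V, Piece F (Q.G.Fl x))
    (hP : ∀ x, cls (P x) = at' Q.dec x) : Piece F n :=
  substPiece Q.toShell (Species.Hom.c Q.dec) (Species.Hom.c_inv Q.dec) P
    (fun x => rep_col Q.dec x (P x) (hP x))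

theorem muOf_rel {Q Q' : Piece (bar F) n} (h : Rel Q Q') {P : ∀ x : Q.G.V, Piece F (Q.G.Fl x)}
    {hP : ∀ x, cls (P x) = at' Q.dec x} {P' : ∀ x : Q'.G.V, Piece F (Q'.G.Fl x)}
    {hP' : ∀ x, cls (P' x) = at' Q'.dec x} : Rel (muOf Q P hP) (muOf Q' P' hP') := by
  obtain ⟨θ, h1, h2⟩ := h
  refine substPiece_rel θ h1 (fun a => congrArg (fun t : y.obj Q.G ⟶ bar F => Species.Hom.c t a) h2) fun x => ?_
  rw [← cls_eq, hP, ← bar_act, hP', ← h2, at_map]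

/-- Chosen representatives. -/
def rep {X : JKGraph} (d : y.obj X ⟶ bar F) (x : X.V) : Piece F (X.Fl x) :=
  Quotient.out (s := setoid F (X.Fl x)) (at' d x)

theorem rep_spec {X : JKGraph} (d : y.obj X ⟶ bar F) (x : X.V) : cls (rep d x) = at' d x :=
  Quotient.out_eq (s := setoid F (X.Fl x)) (at' d x)

/-- The multiplication of the monad: a graph whose vertices are decorated by `F`-graphs is turned
into a single `F`-graph by substitution. -/
def muApp (F : Species) : bar (bar F) ⟶ bar F where
  c := id
  o := Quotient.lift (fun Q => cls (muOf Q (rep Q.dec) (rep_spec Q.dec)))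
    fun _ _ h => cls_eq.2 (muOf_rel h)
  c_inv := fun _ => rfl
  o_act := by
    rintro n m _ _ σ ⟨Q⟩
    rfl
  col_o := by
    rintro n _ ⟨Q⟩ k
    rfl

theorem muApp_cls (Q : Piece (bar F) n) (P : ∀ x : Q.G.V, Piece F (Q.G.Fl x))
    (hP : ∀ x, cls (P x) = at' Q.dec x) :
    Species.Hom.o (muApp F) (cls Q) = cls (muOf Q P hP) :=
  cls_eq.2 (muOf_rel (rel_refl Q))

theorem mu_nat (f : F ⟶ F') : barMap (barMap f) ≫ muApp F' = muApp F ≫ barMap f := by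
  refine Species.hom_ext (fun _ => rfl) ?_
  rintro n _ ⟨Q⟩
  refine (muApp_cls (Piece.map (barMap f) Q) (fun x => Piece.map f (rep Q.dec x)) ?_).trans ?_
  · intro x
    exact congrArg (Species.Hom.o (barMap f)) (rep_spec Q.dec x)
  · refine cls_eq.2 ⟨Iso.refl _, fun _ => rfl, ?_⟩
    refine Eq.trans ?_ (Category.id_comp _)
    refine congrArg₂ (· ≫ ·) (y.map_id _) ?_
    refine glue_ext Q.G (fun x => (rep Q.dec x).toShell) (fun _ => rfl) fun x => ?_
    refine Eq.trans ?_ (glueι_desc Q.G (fun x => (rep Q.dec x).toShell) _ _ _ _ x).symm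
    exact chase (glueι_desc Q.G (fun x => (rep Q.dec x).toShell) _ _ _ _ x) rfl

theorem star_ext {X : JKGraph} {d d' : y.obj X ⟶ F}
    (hc : ∀ a, Species.Hom.c d a = Species.Hom.c d' a)
    (ho : ∀ x, y.map (X.star x) ≫ d = y.map (X.star x) ≫ d') : d = d' :=
  dec_ext hc fun x => congrArg
    (fun t : y.obj (corolla (X.Fl x)) ⟶ F => Species.Hom.o t ⟨𝟙 (corolla (X.Fl x))⟩) (ho x)

theorem star_dec {X : JKGraph} (d : y.obj X ⟶ F) (x : X.V) :
    y.map (X.star x) ≫ d = corDec (at' d x) :=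
  cor_dec_ext (corDec_id (at' d x)).symm

theorem mu_left_unit (F : Species) : etaApp (bar F) ≫ muApp F = 𝟙 (bar F) := by
  refine Species.hom_ext (fun _ => rfl) ?_
  rintro n _ ⟨P⟩
  let Q : Piece (bar F) n := ⟨corShell n, corDec (cls P)⟩
  let P' : ∀ x : Q.G.V, Piece F (Q.G.Fl x) := fun _ => relabel (corFl n).symm P
  have hP' : ∀ x, cls (P' x) = at' Q.dec x := fun _ => (corDec_at (F := bar F) (cls P)).symm
  refine (muApp_cls Q P' hP').trans (cls_eq.2 ?_)
  let sh := fun x => (P' x).toShell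
  let f : y.obj (glue Q.G sh) ⟶ y.obj P.G := glueDesc (K := y.obj P.G) Q.G sh
    (Sum.elim (fun k => (P.port k).1) (fun k => P.G.i (P.port k).1))
    (by
      rintro (k | k)
      · rfl
      · exact (P.G.i_i _).symm)
    (fun _ => 𝟙 _) (fun _ _ => rfl)
  let g : y.obj P.G ⟶ y.obj (glue Q.G sh) := y.map (glueι Q.G sh ())
  have hf : g ≫ f = 𝟙 _ := glueι_desc Q.G sh _ _ _ _ ()
  refine rel_of f g ?_ hf ?_ ?_
  · refine glue_ext Q.G sh ?_ ?_
    · rintro (k | k)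
      · exact glueArc_port sh () ((corFl n) k)
      · exact glueArc_iport sh () ((corFl n) k)
    · rintro ⟨⟩
      refine Eq.trans (b := g) ?_ (Category.comp_id _).symm
      exact chase hf (Category.id_comp _)
  · intro k
    rfl
  · refine glue_ext Q.G sh ?_ ?_
    · rintro (k | k)
      · rfl
      · exact Species.Hom.c_inv P.dec (P.port k).1
    · rintro ⟨⟩
      refine Eq.trans ?_ (glueι_desc Q.G sh _ _ _ _ ()).symm
      exact chase hf (Category.id_comp _)

theorem mu_right_unit (F : Species) : barMap (etaApp F) ≫ muApp F = 𝟙 (bar F) := by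
  refine Species.hom_ext (fun _ => rfl) ?_
  rintro n _ ⟨P⟩
  let Q : Piece (bar F) n := Piece.map (etaApp F) P
  let P' : ∀ x : P.G.V, Piece F (P.G.Fl x) := fun x =>
    ⟨corShell (P.G.Fl x), corDec (at' P.dec x)⟩
  refine (muApp_cls Q P' (fun _ => rfl)).trans (cls_eq.2 ?_)
  let sh := fun x => (P' x).toShell
  let f : y.obj (glue P.G sh) ⟶ y.obj P.G := glueDesc (K := y.obj P.G) P.G sh
    id (fun _ => rfl) (fun x => y.map (P.G.star x)) (fun _ _ => rfl)
  let g : P.G ⟶ glue P.G sh :=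
    { a := Sum.inl
      h := fun h => ⟨P.G.p h, (⟨h, rfl⟩ : P.G.Fl (P.G.p h))⟩
      v := fun v => ⟨v, ()⟩
      a_i := fun _ => rfl
      a_s := fun h => (glueArc_iport sh (P.G.p h) ⟨h, rfl⟩).symm
      v_p := fun _ => rfl
      pull := by
        rintro w ⟨x, k, rfl⟩ e
        obtain ⟨rfl, -⟩ := Sigma.mk.inj e
        refine ⟨k, ⟨rfl, rfl⟩, ?_⟩
        rintro k' ⟨-, e2⟩
        exact congrArg (fun t : Σ x, P.G.Fl x => t.2.1) e2 }
  have hs : ∀ x, P.G.star x ≫ g = glueι P.G sh x := fun x =>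
    cor_ext (by rintro ⟨k, rfl⟩; rfl) rfl
  have hf : ∀ x, y.map (glueι P.G sh x) ≫ f = y.map (P.G.star x) :=
    fun x => glueι_desc P.G sh _ _ _ _ x
  refine rel_of f (y.map g) ?_ ?_ ?_ ?_
  · refine glue_ext P.G sh (fun _ => rfl) fun x => ?_
    refine Eq.trans (b := y.map (glueι P.G sh x)) ?_ (Category.comp_id _).symm
    refine chase (hf x) ?_
    rw [← hs x]
    exact (y.map_comp _ _).symm
  · refine star_ext (fun _ => rfl) fun x => ?_
    refine Eq.trans (b := y.map (P.G.star x)) ?_ (Category.comp_id _).symm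
    refine chase (j := y.map (glueι P.G sh x)) ?_ (hf x)
    rw [← hs x]
    exact (y.map_comp _ _).symm
  · intro k
    rfl
  · refine glue_ext P.G sh (fun _ => rfl) fun x => ?_
    refine Eq.trans ?_ (glueι_desc P.G sh _ _ _ _ x).symm
    exact chase (hf x) (star_dec P.dec x)

theorem mu_assoc (F : Species) : barMap (muApp F) ≫ muApp F = muApp (bar F) ≫ muApp F := by
  refine Species.hom_ext (fun _ => rfl) ?_
  rintro n _ ⟨Q⟩
  let B : ∀ v : Q.G.V, Piece (bar F) (Q.G.Fl v) := rep Q.dec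
  let C : ∀ v (w : (B v).G.V), Piece F ((B v).G.Fl w) := fun v => rep (B v).dec
  let D : ∀ v : Q.G.V, Piece F (Q.G.Fl v) := fun v => muOf (B v) (C v) (rep_spec (B v).dec)
  have hD : ∀ v, cls (D v) = at' (Q.dec ≫ muApp F) v := fun v =>
    congrArg (Species.Hom.o (muApp F)) (rep_spec Q.dec v)
  let N : Piece (bar F) n := muOf Q B (rep_spec Q.dec)
  let shB := fun v => (B v).toShell
  let C' : ∀ k : N.G.V, Piece F (N.G.Fl k) := fun k =>
    relabel (flMap (glueι Q.G shB k.1) k.2).symm (C k.1 k.2)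
  have hC' : ∀ k, cls (C' k) = at' N.dec k := by
    rintro ⟨v, w⟩
    refine Eq.trans ?_ (substPiece_at (F := bar F) Q.toShell (Species.Hom.c Q.dec) (Species.Hom.c_inv Q.dec) B
      (fun x => rep_col Q.dec x (B x) (rep_spec Q.dec x)) v w).symm
    exact congrArg ((bar F).act (flMap (glueι Q.G shB v) w).symm) (rep_spec (B v).dec w)
  refine (muApp_cls (Piece.map (muApp F) Q) D hD).trans
    (Eq.trans (cls_eq.2 ?_) (muApp_cls N C' hC').symm)
  let shC := fun v w => (C v w).toShell
  let shD := fun v => (D v).toShell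
  let shC' := fun k => (C' k).toShell
  let L := glue Q.G shD
  let M := glue N.G shC'
  let ιC : ∀ v w, (C v w).G ⟶ (D v).G := fun v => glueι (B v).G (shC v)
  let ιD : ∀ v, (D v).G ⟶ L := glueι Q.G shD
  let ιB : ∀ v, (B v).G ⟶ N.G := glueι Q.G shB
  let ιM : ∀ v w, (C v w).G ⟶ M := fun v w => glueι N.G shC' ⟨v, w⟩
  let fv : ∀ v, y.obj (D v).G ⟶ y.obj M := fun v =>
    glueDesc (K := y.obj M) (B v).G (shC v)
      (fun a => (Sum.inl (JKGraph.Hom.a (ιB v) a) : N.G.A ⊕ _))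
      (fun a => congrArg Sum.inl (JKGraph.Hom.a_i (ιB v) a))
      (fun w => y.map (ιM v w))
      (by
        intro w k
        have := glueι_port N.G shC' ⟨v, w⟩ (flMap (ιB v) w k)
        have e2 : ((shC' ⟨v, w⟩).port (flMap (ιB v) w k)) = (C v w).port k :=
          congrArg (C v w).port ((flMap (ιB v) w).symm_apply_apply k)
        rw [e2] at this
        refine this.trans (congrArg Sum.inl ?_)
        rw [flMap_val, ← JKGraph.Hom.a_s, ← JKGraph.Hom.a_i])
  let f : y.obj L ⟶ y.obj M := glueDesc (K := y.obj M) Q.G shD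
    (fun a => (Sum.inl (Sum.inl a : Q.G.A ⊕ _) : N.G.A ⊕ _))
    (fun a => rfl) fv
    (by
      intro v k
      exact congrArg Sum.inl (glueArc_port shB v k))
  let gA : N.G.A → L.A := Sum.elim (fun a => Sum.inl a)
    (fun t => JKGraph.Hom.a (ιD t.1) (Sum.inl t.2.1 : (B t.1).G.A ⊕ _))
  have gA_ι : ∀ v a, gA (JKGraph.Hom.a (ιB v) a) =
      JKGraph.Hom.a (ιD v) (Sum.inl a : (B v).G.A ⊕ _) := by
    intro v a
    rcases (B v).arc_cases a with h | ⟨k, rfl⟩ | ⟨k, rfl⟩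
    · exact congrArg gA (glueArc_inner shB v ⟨a, h⟩)
    · refine (congrArg gA (glueArc_port shB v k)).trans ?_
      exact (glueι_port Q.G shD v k).symm
    · refine (congrArg gA (glueArc_iport shB v k)).trans ?_
      exact (glueArc_iport shD v k).symm
  let g : y.obj M ⟶ y.obj L := glueDesc (K := y.obj L) N.G shC' gA
    (by
      rintro (a | ⟨v, a⟩)
      · rfl
      · exact JKGraph.Hom.a_i (ιD v) (Sum.inl a.1 : (B v).G.A ⊕ _))
    (fun k => y.map (ιC k.1 k.2) ≫ y.map (ιD k.1))
    (by
      rintro ⟨v, w⟩ k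
      obtain ⟨k, rfl⟩ := (flMap (ιB v) w).surjective k
      have e2 : ((shC' ⟨v, w⟩).port (flMap (ιB v) w k)) = (C v w).port k :=
        congrArg (C v w).port ((flMap (ιB v) w).symm_apply_apply k)
      rw [e2]
      have e3 : N.G.i (N.G.s (flMap (ιB v) w k).1) =
          JKGraph.Hom.a (ιB v) ((B v).G.i ((B v).G.s k.1)) := by
        rw [flMap_val, ← JKGraph.Hom.a_s, ← JKGraph.Hom.a_i]
      refine Eq.trans ?_ (congrArg gA e3).symm
      refine Eq.trans ?_ (gA_ι v _).symm
      exact congrArg (JKGraph.Hom.a (ιD v)) (glueι_port (B v).G (shC v) w k))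
  have hfv : ∀ v w, y.map (ιC v w) ≫ fv v = y.map (ιM v w) := fun v w =>
    glueι_desc (B v).G (shC v) _ _ _ _ w
  have hf : ∀ v, y.map (ιD v) ≫ f = fv v := fun v => glueι_desc Q.G shD _ _ _ _ v
  have hg : ∀ v w, y.map (ιM v w) ≫ g = y.map (ιC v w) ≫ y.map (ιD v) := fun v w =>
    glueι_desc N.G shC' _ _ _ _ (⟨v, w⟩ : Σ v, (B v).G.V)
  have hM : ∀ v w, y.map (ιM v w) ≫ (muOf N C' hC').dec = (C v w).dec := fun v w =>
    substPiece_ι N.toShell _ _ _ _ (⟨v, w⟩ : Σ v, (B v).G.V)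
  have hN : ∀ v, y.map (ιB v) ≫ N.dec = (B v).dec := fun v => substPiece_ι Q.toShell _ _ _ _ v
  have hDC : ∀ v w, y.map (ιC v w) ≫ (D v).dec = (C v w).dec := fun v w =>
    substPiece_ι (B v).toShell _ _ _ _ w
  refine rel_of f g ?_ ?_ (fun _ => rfl) ?_
  · refine glue_ext Q.G shD (fun _ => rfl) fun v => ?_
    refine Eq.trans (b := y.map (ιD v)) ?_ (Category.comp_id _).symm
    refine chase (hf v) ?_
    refine glue_ext (B v).G (shC v) (fun a => gA_ι v a) fun w => ?_
    exact chase (hfv v w) (hg v w)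
  · refine glue_ext N.G shC' ?_ ?_
    · intro b
      obtain ⟨a, rfl⟩ | ⟨v, a, rfl⟩ := glue_arc_cases Q.G shB b
      · rfl
      · refine (congrArg (Species.Hom.c f) (gA_ι v a)).trans ?_
        exact congrArg (fun t : y.obj (D v).G ⟶ y.obj M =>
          Species.Hom.c t (Sum.inl a : (B v).G.A ⊕ _)) (hf v)
    · rintro ⟨v, w⟩
      refine Eq.trans (b := y.map (ιM v w)) ?_ (Category.comp_id _).symm
      exact chase (hg v w) (chase2 (hf v) (hfv v w))
  · refine glue_ext Q.G shD (fun _ => rfl) fun v => ?_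
    refine Eq.trans ?_ (substPiece_ι Q.toShell _ _ D _ v).symm
    refine chase (hf v) ?_
    refine glue_ext (B v).G (shC v) ?_ fun w => ?_
    · intro a
      exact congrArg (fun t : y.obj (B v).G ⟶ bar F => Species.Hom.c t a) (hN v)
    · exact (chase (hfv v w) (hM v w)).trans (hDC v w).symm

end Mu

/-- The monad `F ↦ F̄` on graphical species, whose algebras are the compact coloured props. -/
def ccp : Monad Species where
  obj := bar
  map := barMap
  map_id := barFunctor.map_id
  map_comp := barFunctor.map_comp
  η := { app := etaApp, naturality := fun _ _ f => eta_nat f }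
  μ := { app := muApp, naturality := fun _ _ f => mu_nat f }
  assoc := mu_assoc
  left_unit := mu_left_unit
  right_unit := mu_right_unit

/-! ### The restricted Kleisli category -/

/-- The restricted Kleisli category: the full subcategory of the Kleisli category of the monad
`F ↦ F̄` spanned by the graphs without isolated edges. -/
abbrev KGr : Type 1 :=
  InducedCategory (Kleisli ccp)
    (fun G : {G : JKGraph // G.NoIsolatedEdges} => Kleisli.mk ccp (y.obj G.1))

/-- A Kleisli morphism from the graph `X` to the graph `Y` is a morphism of species from `X` to
`Ȳ`. -/
def KGr.ofMap {X Y : KGr} (d : y.obj X.1 ⟶ bar (y.obj Y.1)) : X ⟶ Y :=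
  InducedCategory.homMk ⟨d⟩

/-- The underlying morphism of species. -/
def KGr.toMap {X Y : KGr} (f : X ⟶ Y) : y.obj X.1 ⟶ bar (y.obj Y.1) := f.hom.of

theorem KGr.ext {X Y : KGr} {f g : X ⟶ Y} (h : KGr.toMap f = KGr.toMap g) : f = g :=
  InducedCategory.hom_ext (Kleisli.hom_ext h)

theorem KGr.toMap_comp {X Y Z : KGr} (f : X ⟶ Y) (g : Y ⟶ Z) :
    KGr.toMap (f ≫ g) = KGr.toMap f ≫ barMap (KGr.toMap g) ≫ muApp (y.obj Z.1) := rfl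

/-- The free morphism given by an etale map. -/
def KGr.free {X Y : KGr} (k : X.1 ⟶ Y.1) : X ⟶ Y :=
  InducedCategory.homMk ((Kleisli.Adjunction.toKleisli ccp).map (y.map k))

theorem KGr.free_id (X : KGr) : KGr.free (𝟙 X.1) = 𝟙 X := by
  refine InducedCategory.hom_ext ?_
  exact (congrArg (Kleisli.Adjunction.toKleisli ccp).map (y.map_id X.1)).trans
    ((Kleisli.Adjunction.toKleisli ccp).map_id _)

theorem KGr.free_comp {X Y Z : KGr} (k : X.1 ⟶ Y.1) (l : Y.1 ⟶ Z.1) :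
    KGr.free (k ≫ l) = (KGr.free k : X ⟶ Y) ≫ (KGr.free l : Y ⟶ Z) := by
  refine InducedCategory.hom_ext ?_
  exact (congrArg (Kleisli.Adjunction.toKleisli ccp).map (y.map_comp k l)).trans
    ((Kleisli.Adjunction.toKleisli ccp).map_comp _ _)

/-! ### Reduced covers -/

section Covers

variable {X Y Z : JKGraph}

/-- An etale map is a cover if it is surjective on edges and vertices. -/
def IsCover (f : X ⟶ Y) : Prop :=
  Function.Surjective (JKGraph.Hom.a f) ∧ Function.Surjective (JKGraph.Hom.v f)

/-- Open subgraph inclusions. -/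
def IsOpenInclusion (f : X ⟶ Y) : Prop :=
  Function.Injective (JKGraph.Hom.a f) ∧ Function.Injective (JKGraph.Hom.h f) ∧
    Function.Injective (JKGraph.Hom.v f)

/-- A cover is reduced when no part of its domain can be omitted: no proper open subgraph of the
domain still covers. (A covering family is regarded as a single etale map out of the sum of its
members.) -/
def IsReducedCover (f : X ⟶ Y) : Prop :=
  IsCover f ∧ ∀ (Z : JKGraph) (j : Z ⟶ X), IsOpenInclusion j → IsCover (j ≫ f) → IsIso j

theorem isIso_of_bijective (f : X ⟶ Y) (ha : Function.Bijective (JKGraph.Hom.a f))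
    (hh : Function.Bijective (JKGraph.Hom.h f)) (hv : Function.Bijective (JKGraph.Hom.v f)) :
    IsIso f := by
  let ea := Equiv.ofBijective _ ha
  let eh := Equiv.ofBijective _ hh
  let ev := Equiv.ofBijective _ hv
  have hp : ∀ t, ev.symm (Y.p t) = X.p (eh.symm t) := fun t => by
    obtain ⟨t, rfl⟩ := eh.surjective t
    rw [eh.symm_apply_apply, ev.symm_apply_eq]
    exact (JKGraph.Hom.v_p f t).symm
  let g : Y ⟶ X :=
    { a := ea.symm
      h := eh.symm
      v := ev.symm
      a_i := fun t => by
        obtain ⟨t, rfl⟩ := ea.surjective t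
        rw [ea.symm_apply_apply, ea.symm_apply_eq]
        exact (JKGraph.Hom.a_i f t).symm
      a_s := fun t => by
        obtain ⟨t, rfl⟩ := eh.surjective t
        rw [eh.symm_apply_apply, ea.symm_apply_eq]
        exact (JKGraph.Hom.a_s f t).symm
      v_p := hp
      pull := fun w z hz => by
        refine ⟨eh z, ⟨?_, eh.symm_apply_apply z⟩, ?_⟩
        · have := hp (eh z)
          rw [eh.symm_apply_apply, hz] at this
          exact ev.symm.injective this
        · rintro t ⟨-, rfl⟩
          exact (eh.apply_symm_apply t).symm }
  refine ⟨g, ?_, ?_⟩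
  · ext t
    · exact ea.symm_apply_apply t
    · exact eh.symm_apply_apply t
    · exact ev.symm_apply_apply t
  · ext t
    · exact ea.apply_symm_apply t
    · exact eh.apply_symm_apply t
    · exact ev.apply_symm_apply t

theorem bijective_of_isIso (f : X ⟶ Y) [IsIso f] : Function.Bijective (JKGraph.Hom.a f) ∧
    Function.Bijective (JKGraph.Hom.h f) ∧ Function.Bijective (JKGraph.Hom.v f) := by
  have h1 := IsIso.hom_inv_id f
  have h2 := IsIso.inv_hom_id f
  refine ⟨Function.bijective_iff_has_inverse.2 ⟨JKGraph.Hom.a (inv f), fun t => ?_, fun t => ?_⟩,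
    Function.bijective_iff_has_inverse.2 ⟨JKGraph.Hom.h (inv f), fun t => ?_, fun t => ?_⟩,
    Function.bijective_iff_has_inverse.2 ⟨JKGraph.Hom.v (inv f), fun t => ?_, fun t => ?_⟩⟩
  · exact congrArg (fun q => JKGraph.Hom.a q t) h1
  · exact congrArg (fun q => JKGraph.Hom.a q t) h2
  · exact congrArg (fun q => JKGraph.Hom.h q t) h1
  · exact congrArg (fun q => JKGraph.Hom.h q t) h2
  · exact congrArg (fun q => JKGraph.Hom.v q t) h1
  · exact congrArg (fun q => JKGraph.Hom.v q t) h2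

theorem h_surjective (f : X ⟶ Y) (hv : Function.Surjective (JKGraph.Hom.v f)) :
    Function.Surjective (JKGraph.Hom.h f) := fun z => by
  obtain ⟨w, hw⟩ := hv (Y.p z)
  obtain ⟨x, ⟨-, hx⟩, -⟩ := JKGraph.Hom.pull f w z hw.symm
  exact ⟨x, hx⟩

theorem h_injective (f : X ⟶ Y) (hv : Function.Injective (JKGraph.Hom.v f)) :
    Function.Injective (JKGraph.Hom.h f) := fun x x' e => by
  have hp : X.p x = X.p x' := hv (by rw [JKGraph.Hom.v_p, JKGraph.Hom.v_p, e])
  obtain ⟨t, -, ht⟩ := JKGraph.Hom.pull f (X.p x') (JKGraph.Hom.h f x')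
    (JKGraph.Hom.v_p f x').symm
  exact (ht x ⟨hp, e⟩).trans (ht x' ⟨rfl, rfl⟩).symm

theorem a_surjective (f : X ⟶ Y) (hY : Y.NoIsolatedEdges)
    (hv : Function.Surjective (JKGraph.Hom.v f)) : Function.Surjective (JKGraph.Hom.a f) := by
  intro z
  rcases hY z with ⟨t, rfl⟩ | ⟨t, ht⟩
  · obtain ⟨x, rfl⟩ := h_surjective f hv t
    exact ⟨X.s x, JKGraph.Hom.a_s f x⟩
  · obtain ⟨x, rfl⟩ := h_surjective f hv t
    exact ⟨X.i (X.s x), by rw [JKGraph.Hom.a_i, JKGraph.Hom.a_s, ht, Y.i_i]⟩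

/-- The open subgraph obtained by removing a vertex (but no edge). -/
@[reducible]
def removeVertex (X : JKGraph) (w : X.V) : JKGraph where
  A := X.A
  H := {h : X.H // X.p h ≠ w}
  V := {v : X.V // v ≠ w}
  finA := inferInstance
  finH := inferInstance
  finV := inferInstance
  i := X.i
  s := fun h => X.s h.1
  p := fun h => ⟨X.p h.1, h.2⟩
  i_i := X.i_i
  i_ne := X.i_ne
  s_inj := fun _ _ e => Subtype.ext (X.s_inj e)

/-- In the absence of isolated edges, a reduced cover is an etale map bijective on vertices. -/
theorem isReducedCover_iff (f : X ⟶ Y) (hX : X.NoIsolatedEdges) (hY : Y.NoIsolatedEdges) :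
    IsReducedCover f ↔ Function.Bijective (JKGraph.Hom.v f) := by
  constructor
  · rintro ⟨hf, hmin⟩
    refine ⟨fun w w' e => ?_, hf.2⟩
    by_contra hne
    let j : removeVertex X w ⟶ X :=
      { a := id
        h := Subtype.val
        v := Subtype.val
        a_i := fun _ => rfl
        a_s := fun _ => rfl
        v_p := fun _ => rfl
        pull := fun u z hz => ⟨⟨z, by rw [hz]; exact u.2⟩, ⟨Subtype.ext hz, rfl⟩,
          fun z' hz' => Subtype.ext hz'.2⟩ }
    have hj : IsIso j := by
      refine hmin _ j ⟨Function.injective_id, Subtype.val_injective, Subtype.val_injective⟩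
        ⟨hf.1, fun b => ?_⟩
      obtain ⟨u, rfl⟩ := hf.2 b
      by_cases hu : u = w
      · exact ⟨⟨w', Ne.symm hne⟩, by rw [hu, e]; rfl⟩
      · exact ⟨⟨u, hu⟩, rfl⟩
    obtain ⟨u, hu⟩ := (bijective_of_isIso j).2.2.2 w
    exact u.2 hu
  · intro hv
    refine ⟨⟨a_surjective f hY hv.2, hv.2⟩, fun Z j hj hc => ?_⟩
    have hjv : Function.Surjective (JKGraph.Hom.v j) := fun x => by
      obtain ⟨z, hz⟩ := hc.2 (JKGraph.Hom.v f x)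
      exact ⟨z, hv.1 hz⟩
    exact isIso_of_bijective j ⟨hj.1, a_surjective j hX hjv⟩ ⟨hj.2.1, h_surjective j hjv⟩
      ⟨hj.2.2, hjv⟩

end Covers

/-- Reduced covers in the restricted Kleisli category: the free morphisms on reduced covers. -/
def KGr.reducedCovers : MorphismProperty KGr := fun X Y f =>
  ∃ k : X.1 ⟶ Y.1, IsReducedCover k ∧ f = KGr.free k

instance : KGr.reducedCovers.IsMultiplicative where
  id_mem X := ⟨𝟙 X.1, (isReducedCover_iff _ X.2 X.2).2 Function.bijective_id, (KGr.free_id X).symm⟩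
  comp_mem {X Y Z} f g := by
    rintro ⟨k, hk, rfl⟩ ⟨l, hl, rfl⟩
    exact ⟨k ≫ l, (isReducedCover_iff _ X.2 Z.2).2
      (((isReducedCover_iff _ Y.2 Z.2).1 hl).comp ((isReducedCover_iff _ X.2 Y.2).1 hk)),
      (KGr.free_comp k l).symm⟩

/-! ### Generic morphisms -/

section Generic

variable {X Y Z : JKGraph} {F : Species}

/-- The colimit in `Gr ↓ F` of the diagram given by `d : X ⟶ F̄` (which sends each arc to a colour
of `F`, and each vertex to a decorated effective graph): the underlying graph. -/
def colimGraph (d : y.obj X ⟶ bar F) : JKGraph := glue X (fun x => (rep d x).toShell)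

/-- The structure map of the colimit. -/
def colimDec (d : y.obj X ⟶ bar F) : y.obj (colimGraph d) ⟶ F :=
  glueDesc X (fun x => (rep d x).toShell) (Species.Hom.c d) (Species.Hom.c_inv d)
    (fun x => (rep d x).dec) (fun x => rep_col d x (rep d x) (rep_spec d x))

/-- A Kleisli morphism from `X` to `Y` is generic if the etale map to `Y` from the colimit graph is
invertible. -/
def IsGenericMap (d : y.obj X ⟶ bar (y.obj Y)) : Prop := IsIso (yPre (colimDec d))

/-- The etale map determined by representatives `P`. -/
def colimMapOf (d : y.obj X ⟶ bar (y.obj Y)) (P : ∀ x, Piece (y.obj Y) (X.Fl x))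
    (hP : ∀ x, cls (P x) = at' d x) : glue X (fun x => (P x).toShell) ⟶ Y :=
  yPre (glueDesc X (fun x => (P x).toShell) (Species.Hom.c d) (Species.Hom.c_inv d)
    (fun x => (P x).dec) (fun x => rep_col d x (P x) (hP x)))

theorem isIso_of_empty (f : X ⟶ Y) [IsEmpty X.V] [IsEmpty Y.V] (hX : X.NoIsolatedEdges)
    (hY : Y.NoIsolatedEdges) : IsIso f := by
  have key : ∀ G : JKGraph, IsEmpty G.V → G.NoIsolatedEdges → IsEmpty G.A ∧ IsEmpty G.H := by
    intro G h hG
    have hH : IsEmpty G.H := ⟨fun t => h.false (G.p t)⟩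
    exact ⟨⟨fun a => (hG a).elim (fun ⟨t, _⟩ => hH.false t) (fun ⟨t, _⟩ => hH.false t)⟩, hH⟩
  obtain ⟨h1, h2⟩ := key X ‹_› hX
  obtain ⟨h3, h4⟩ := key Y ‹_› hY
  exact isIso_of_bijective f ⟨fun a => isEmptyElim a, fun a => isEmptyElim a⟩
    ⟨fun a => isEmptyElim a, fun a => isEmptyElim a⟩
    ⟨fun a => isEmptyElim a, fun a => isEmptyElim a⟩

theorem isGenericMap_of_empty (d : y.obj X ⟶ bar (y.obj Y)) [IsEmpty X.V] [IsEmpty Y.V]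
    (hX : X.NoIsolatedEdges) (hY : Y.NoIsolatedEdges) : IsGenericMap d := by
  have : IsEmpty (colimGraph d).V := ⟨fun t : Σ x, (rep d x).G.V => isEmptyElim t.1⟩
  exact isIso_of_empty _ (glue_noIsolatedEdges X (fun x => (rep d x).toShell) hX) hY

theorem empty_of_isGenericMap (d : y.obj X ⟶ bar (y.obj Y)) [IsEmpty X.V]
    (h : IsGenericMap d) : IsEmpty Y.V := by
  have : IsIso (yPre (colimDec d)) := h
  constructor
  intro v
  obtain ⟨t, -⟩ := (bijective_of_isIso (yPre (colimDec d))).2.2.2 v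
  exact isEmptyElim ((show Σ x, (rep d x).G.V from t).1)

/-- A graph with a decoration, regarded as a decorated graph with its own ports. -/
def selfPiece (hX : X.Effective) {n : Type} [Finite n] (e : n ≃ X.Port) (d : y.obj X ⟶ F) :
    Piece F n := ⟨⟨X, hX, e⟩, d⟩

instance (X : JKGraph) : Finite X.Port := inferInstanceAs (Finite {a : X.A // a ∉ Set.range X.s})

theorem isIso_yPre_iff {f : y.obj X ⟶ y.obj Y} : IsIso (yPre f) ↔ IsIso f := by
  constructor
  · intro h
    rw [← y_yPre f]
    infer_instance
  · intro h
    have : IsIso (y.map (yPre f)) := by rwa [y_yPre]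
    have : y.Full := yFF.full
    have : y.Faithful := yFF.faithful
    exact isIso_of_reflects_iso (yPre f) y

theorem isIso_dec_of_rel {n : Type} [Finite n] {P Q : Piece (y.obj Y) n} (h : Rel P Q)
    (hQ : IsIso Q.dec) : IsIso P.dec := by
  obtain ⟨θ, -, h2⟩ := h
  rw [← h2]
  infer_instance

theorem isGenericMap_of_rep (hX : X.Effective) (d : y.obj X ⟶ bar (y.obj Y))
    (P : ∀ x, Piece (y.obj Y) (X.Fl x)) (hP : ∀ x, cls (P x) = at' d x)
    (h : IsIso (colimMapOf d P hP)) : IsGenericMap d := by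
  have h1 := isIso_yPre_iff.1 h
  have h2 : Rel (muOf (selfPiece hX (Equiv.refl _) d) (rep d) (rep_spec d))
    (muOf (selfPiece hX (Equiv.refl _) d) P hP) := muOf_rel (rel_refl _)
  exact isIso_yPre_iff.2 (isIso_dec_of_rel h2 h1)

theorem isGenericMap_iff (hX : X.Effective) (hY : Y.Effective) (d : y.obj X ⟶ bar (y.obj Y)) :
    IsGenericMap d ↔ ∃ e : X.Port ≃ Y.Port,
      Species.Hom.o (muApp (y.obj Y)) (cls (selfPiece hX (Equiv.refl _) d)) =
        cls (selfPiece hY e (𝟙 (y.obj Y))) := by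
  have h0 := muApp_cls (selfPiece hX (Equiv.refl _) d) (rep d) (rep_spec d)
  constructor
  · intro h
    have : IsIso (yPre (colimDec d)) := h
    let θ := asIso (yPre (colimDec d))
    let M := muOf (selfPiece hX (Equiv.refl _) d) (rep d) (rep_spec d)
    have hport : ∀ a, a ∈ Set.range (colimGraph d).s ↔ JKGraph.Hom.a θ.hom a ∈ Set.range Y.s := by
      intro a
      constructor
      · rintro ⟨t, rfl⟩
        exact ⟨_, (JKGraph.Hom.a_s θ.hom t).symm⟩
      · rintro ⟨t, ht⟩
        have := congrArg (JKGraph.Hom.a θ.inv) ht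
        rw [← JKGraph.comp_a, θ.hom_inv_id, JKGraph.Hom.a_s] at this
        exact ⟨_, this⟩
    let e' : (colimGraph d).Port ≃ Y.Port :=
      (Equiv.ofBijective _ (bijective_of_isIso θ.hom).1).subtypeEquiv fun a => (hport a).not
    refine ⟨M.port.trans e', h0.trans (cls_eq.2 ⟨θ, fun k => rfl, ?_⟩)⟩
    exact (Category.comp_id _).trans (y_yPre (colimDec d))
  · rintro ⟨e, he⟩
    have := cls_eq.1 (h0.symm.trans he)
    have h2 := isIso_dec_of_rel this (inferInstanceAs (IsIso (𝟙 (y.obj Y))))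
    exact isIso_yPre_iff.2 h2

theorem effective_of_isGenericMap (hX : X.Effective) (hY : Y.NoIsolatedEdges)
    (d : y.obj X ⟶ bar (y.obj Y)) (_ : IsGenericMap d) : Y.Effective := by
  obtain ⟨v⟩ := (glue_effective X (fun x => (rep d x).toShell) hX).1
  exact ⟨⟨JKGraph.Hom.v (yPre (colimDec d)) v⟩, hY⟩

theorem isGenericMap_id (hX : X.NoIsolatedEdges) : IsGenericMap (etaApp (y.obj X)) := by
  by_cases hV : Nonempty X.V
  · refine (isGenericMap_iff ⟨hV, hX⟩ ⟨hV, hX⟩ _).2 ⟨Equiv.refl _, ?_⟩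
    have h1 : Species.Hom.o (barMap (etaApp (y.obj X)))
        (cls (selfPiece ⟨hV, hX⟩ (Equiv.refl _) (𝟙 (y.obj X)))) =
        cls (selfPiece ⟨hV, hX⟩ (Equiv.refl _) (etaApp (y.obj X))) := by
      rw [barMap_cls]
      exact congrArg (fun t => cls (selfPiece ⟨hV, hX⟩ (Equiv.refl _) t)) (Category.id_comp _)
    rw [← h1]
    exact congrArg (fun t : bar (y.obj X) ⟶ bar (y.obj X) => Species.Hom.o t
      (cls (selfPiece ⟨hV, hX⟩ (Equiv.refl _) (𝟙 (y.obj X))))) (mu_right_unit (y.obj X))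
  · have : IsEmpty X.V := not_nonempty_iff.1 hV
    exact isGenericMap_of_empty _ hX hX

theorem isGenericMap_comp (hX : X.NoIsolatedEdges) (hY : Y.NoIsolatedEdges)
    (hZ : Z.NoIsolatedEdges) (d : y.obj X ⟶ bar (y.obj Y)) (d' : y.obj Y ⟶ bar (y.obj Z))
    (h : IsGenericMap d) (h' : IsGenericMap d') :
    IsGenericMap (d ≫ barMap d' ≫ muApp (y.obj Z)) := by
  by_cases hV : Nonempty X.V
  · have eX : X.Effective := ⟨hV, hX⟩
    have eY := effective_of_isGenericMap eX hY d h
    have eZ := effective_of_isGenericMap eY hZ d' h'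
    obtain ⟨e, he⟩ := (isGenericMap_iff eX eY d).1 h
    obtain ⟨e', he'⟩ := (isGenericMap_iff eY eZ d').1 h'
    refine (isGenericMap_iff eX eZ _).2 ⟨e.trans e', ?_⟩
    let Q := selfPiece eX (Equiv.refl X.Port) d
    have a1 : cls (selfPiece eX (Equiv.refl _) (d ≫ barMap d' ≫ muApp (y.obj Z))) =
        Species.Hom.o (barMap (muApp (y.obj Z)))
          (Species.Hom.o (barMap (barMap d')) (cls Q)) := by
      rw [barMap_cls, barMap_cls]
      exact congrArg (fun t => cls (selfPiece eX (Equiv.refl _) t)) (Category.assoc _ _ _).symm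
    have a2 : Species.Hom.o (muApp (y.obj Z)) (Species.Hom.o (barMap (muApp (y.obj Z)))
        (Species.Hom.o (barMap (barMap d')) (cls Q))) =
        Species.Hom.o (muApp (y.obj Z)) (Species.Hom.o (muApp (bar (y.obj Z)))
          (Species.Hom.o (barMap (barMap d')) (cls Q))) :=
      congrArg (fun t : bar (bar (bar (y.obj Z))) ⟶ bar (y.obj Z) =>
        Species.Hom.o t (Species.Hom.o (barMap (barMap d')) (cls Q))) (mu_assoc (y.obj Z))
    have a3 : Species.Hom.o (muApp (bar (y.obj Z))) (Species.Hom.o (barMap (barMap d')) (cls Q)) =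
        Species.Hom.o (barMap d') (Species.Hom.o (muApp (y.obj Y)) (cls Q)) :=
      congrArg (fun t : bar (bar (y.obj Y)) ⟶ bar (bar (y.obj Z)) => Species.Hom.o t (cls Q))
        (mu_nat d')
    have a4 : Species.Hom.o (barMap d') (cls (selfPiece eY e (𝟙 (y.obj Y)))) =
        (bar (bar (y.obj Z))).act e (cls (selfPiece eY (Equiv.refl _) d')) := by
      rw [barMap_cls]
      exact congrArg (fun t => cls (selfPiece eY e t)) (Category.id_comp _)
    rw [a1, a2, a3, he, a4]
    exact (Species.Hom.o_act (muApp (y.obj Z)) e _).trans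
      (congrArg ((bar (y.obj Z)).act e) he')
  · have : IsEmpty X.V := not_nonempty_iff.1 hV
    have := empty_of_isGenericMap d h
    have := empty_of_isGenericMap d' h'
    exact isGenericMap_of_empty _ hX hZ

end Generic

/-- Generic morphisms in the restricted Kleisli category. -/
def KGr.generics : MorphismProperty KGr := fun _ _ f => IsGenericMap (KGr.toMap f)

instance : KGr.generics.IsMultiplicative where
  id_mem X := isGenericMap_id X.2
  comp_mem {X Y Z} f g hf hg := isGenericMap_comp X.2 Y.2 Z.2 (KGr.toMap f) (KGr.toMap g) hf hg

end JK

/-! ### The Borisov-Manin category -/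

namespace BM

open JK JK.Piece

/-- A (finite) graph in the sense of Borisov and Manin: vertices, flags, the map `bd` assigning to
a flag the vertex it originates from, and an involution `j` on flags whose orbits of length two are
the edges and whose fixpoints are the tails. -/
structure BMGraph where
  V : Type
  F : Type
  finV : Finite V
  finF : Finite F
  bd : F → V
  j : F → F
  j_j : ∀ f, j (j f) = f

namespace BMGraph

attribute [instance] finV finF

/-- The tails of a graph. -/
def tails (τ : BMGraph) : Set τ.F := {f | τ.j f = f}

/-- Morphisms of graphs: a triple `(hF, hV, jc)`. A fixpoint-free involution on the complement of
the image of `hF` is the same thing as an involution `jc` on all flags whose fixpoints are precisely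
the flags in the image of `hF`; this is how it is encoded. -/
@[ext]
structure Hom (τ σ : BMGraph) where
  hF : σ.F → τ.F
  hV : τ.V → σ.V
  jc : τ.F → τ.F
  jc_jc : ∀ f, jc (jc f) = f
  jc_fix : ∀ f, jc f = f ↔ f ∈ Set.range hF
  /-- (i) `hF` is injective, `hV` is surjective -/
  inj : Function.Injective hF
  surj : Function.Surjective hV
  /-- (ii) the image of `hF` and its complement are `j`-invariant -/
  j_range : ∀ f, τ.j f ∈ Set.range hF ↔ f ∈ Set.range hF
  /-- (ii') `jc` agrees with `j` on (contracted) edges -/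
  jc_edge : ∀ f, f ∉ Set.range hF → τ.j f ≠ f → jc f = τ.j f
  /-- (iii) incidences of non-contracted flags are preserved, and the two vertices of a contracted
  edge (actual or virtual) have the same image -/
  bd_hF : ∀ f, hV (τ.bd (hF f)) = σ.bd f
  bd_jc : ∀ f, f ∉ Set.range hF → hV (τ.bd (jc f)) = hV (τ.bd f)
  /-- (iv) the inverse of `hF` maps edges of `τ` to edges of `σ` -/
  edge : ∀ f, τ.j (hF f) ≠ hF f → hF (σ.j f) = τ.j (hF f)

namespace Hom

variable {τ σ ρ : BMGraph}

theorem jc_hF (h : Hom τ σ) (f : σ.F) : h.jc (h.hF f) = h.hF f := (h.jc_fix _).2 ⟨f, rfl⟩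

theorem jc_range (h : Hom τ σ) (f : τ.F) : h.jc f ∈ Set.range h.hF ↔ f ∈ Set.range h.hF := by
  rw [← h.jc_fix, ← h.jc_fix, h.jc_jc, eq_comm]

theorem bd_jc' (h : Hom τ σ) (f : τ.F) : h.hV (τ.bd (h.jc f)) = h.hV (τ.bd f) := by
  by_cases hf : f ∈ Set.range h.hF
  · rw [(h.jc_fix f).2 hf]
  · exact h.bd_jc f hf

open Classical in
/-- The involution of a composite: `j_g` on the complement of the image of `g`, and `j_c` on the
complement of the image of `c` (transported along `g`). -/
def compJc (g : Hom τ σ) (c : Hom σ ρ) (f : τ.F) : τ.F :=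
  if hf : ∃ r, g.hF r = f then g.hF (c.jc hf.choose) else g.jc f

theorem compJc_hF (g : Hom τ σ) (c : Hom σ ρ) (f : σ.F) :
    compJc g c (g.hF f) = g.hF (c.jc f) := by
  have hf : ∃ r, g.hF r = g.hF f := ⟨f, rfl⟩
  rw [compJc, dif_pos hf, g.inj hf.choose_spec]

theorem compJc_not (g : Hom τ σ) (c : Hom σ ρ) (f : τ.F) (hf : f ∉ Set.range g.hF) :
    compJc g c f = g.jc f := by
  exact dif_neg hf

/-- Composition. -/
def comp (g : Hom τ σ) (c : Hom σ ρ) : Hom τ ρ where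
  hF := g.hF ∘ c.hF
  hV := c.hV ∘ g.hV
  jc := compJc g c
  jc_jc f := by
    by_cases hf : f ∈ Set.range g.hF
    · obtain ⟨r, rfl⟩ := hf
      rw [compJc_hF, compJc_hF, c.jc_jc]
    · rw [compJc_not g c f hf, compJc_not _ _ _ ((g.jc_range f).not.2 hf), g.jc_jc]
  jc_fix f := by
    by_cases hf : f ∈ Set.range g.hF
    · obtain ⟨r, rfl⟩ := hf
      rw [compJc_hF, g.inj.eq_iff, c.jc_fix]
      constructor
      · rintro ⟨t, rfl⟩
        exact ⟨t, rfl⟩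
      · rintro ⟨t, ht⟩
        exact ⟨t, g.inj ht⟩
    · rw [compJc_not g c f hf, g.jc_fix]
      refine ⟨fun h => absurd h hf, ?_⟩
      rintro ⟨t, rfl⟩
      exact ⟨_, rfl⟩
  inj := g.inj.comp c.inj
  surj := c.surj.comp g.surj
  j_range f := by
    have key : ∀ f, f ∈ Set.range (g.hF ∘ c.hF) → τ.j f ∈ Set.range (g.hF ∘ c.hF) := by
      rintro _ ⟨t, rfl⟩
      by_cases hj : τ.j (g.hF (c.hF t)) = g.hF (c.hF t)
      · exact ⟨t, hj.symm⟩
      · have h1 := g.edge _ hj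
        obtain ⟨u, hu⟩ := (c.j_range _).2 ⟨t, rfl⟩
        exact ⟨u, by simp only [Function.comp]; rw [hu, h1]⟩
    exact ⟨fun h => by simpa [τ.j_j] using key _ h, key f⟩
  jc_edge f hf hj := by
    by_cases hg : f ∈ Set.range g.hF
    · obtain ⟨r, rfl⟩ := hg
      have h1 := g.edge r hj
      have hr : r ∉ Set.range c.hF := by
        rintro ⟨t, rfl⟩
        exact hf ⟨t, rfl⟩
      have hjr : σ.j r ≠ r := fun e => hj (by rw [← h1, e])
      rw [compJc_hF, c.jc_edge r hr hjr, h1]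
    · rw [compJc_not g c f hg, g.jc_edge f hg hj]
  bd_hF f := by simp [g.bd_hF, c.bd_hF]
  bd_jc f _ := by
    by_cases hg : f ∈ Set.range g.hF
    · obtain ⟨r, rfl⟩ := hg
      simp only [Function.comp]
      rw [compJc_hF, g.bd_hF, g.bd_hF, c.bd_jc']
    · simp only [Function.comp]
      rw [compJc_not g c f hg, g.bd_jc']
  edge f hj := by
    have h1 := g.edge _ hj
    have h2 : σ.j (c.hF f) ≠ c.hF f := fun e => hj (by
      simp only [Function.comp]
      rw [← h1, e])
    simp only [Function.comp]
    rw [c.edge f h2, h1]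

end Hom

/-- The Borisov-Manin category of graphs. -/
instance : Category BMGraph where
  Hom := Hom
  id τ :=
    { hF := id
      hV := id
      jc := id
      jc_jc := fun _ => rfl
      jc_fix := by simp
      inj := Function.injective_id
      surj := Function.surjective_id
      j_range := by simp
      jc_edge := by simp
      bd_hF := fun _ => rfl
      bd_jc := by simp
      edge := fun _ _ => rfl }
  comp := Hom.comp
  id_comp h := Hom.ext rfl rfl (funext fun f => Hom.compJc_hF _ h f)
  comp_id h := Hom.ext rfl rfl (funext fun f => by
    by_cases hf : f ∈ Set.range h.hF
    · obtain ⟨r, rfl⟩ := hf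
      exact (Hom.compJc_hF h _ r).trans (h.jc_hF r).symm
    · exact Hom.compJc_not h _ f hf)
  assoc f g h := Hom.ext rfl rfl (funext fun t => by
    by_cases ht : t ∈ Set.range f.hF
    · obtain ⟨r, rfl⟩ := ht
      refine Eq.trans ?_ (Hom.compJc_hF f (Hom.comp g h) r).symm
      by_cases hr : r ∈ Set.range g.hF
      · obtain ⟨u, rfl⟩ := hr
        refine (Hom.compJc_hF (Hom.comp f g) h u).trans ?_
        exact congrArg f.hF (Hom.compJc_hF g h u).symm
      · refine (Hom.compJc_not (Hom.comp f g) h _ ?_).trans ?_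
        · rintro ⟨u, hu⟩
          exact hr ⟨u, f.inj hu⟩
        · refine (Hom.compJc_hF f g r).trans ?_
          exact congrArg f.hF (Hom.compJc_not g h r hr).symm
    · refine (Hom.compJc_not (Hom.comp f g) h _ ?_).trans ?_
      · rintro ⟨u, rfl⟩
        exact ht ⟨_, rfl⟩
      · exact (Hom.compJc_not f g t ht).trans (Hom.compJc_not f (Hom.comp g h) t ht).symm)

/-- Graftings: both `hV` and `hF` are bijective. -/
def graftings : MorphismProperty BMGraph := fun _ _ h =>
  Function.Bijective (Hom.hV h) ∧ Function.Bijective (Hom.hF h)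

/-- Compressions: `hF` is bijective on tails. -/
def compressions : MorphismProperty BMGraph := fun τ σ h =>
  Set.BijOn (Hom.hF h) σ.tails τ.tails

instance : graftings.IsMultiplicative where
  id_mem _ := ⟨Function.bijective_id, Function.bijective_id⟩
  comp_mem _ _ hf hg := ⟨hg.1.comp hf.1, hf.2.comp hg.2⟩

instance : compressions.IsMultiplicative where
  id_mem _ := Set.bijOn_id _
  comp_mem _ _ hf hg := hf.comp hg

theorem comp_hF {τ σ ρ : BMGraph} (g : τ ⟶ σ) (c : σ ⟶ ρ) (f : ρ.F) :
    Hom.hF (g ≫ c) f = Hom.hF g (Hom.hF c f) := rfl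

theorem comp_hV {τ σ ρ : BMGraph} (g : τ ⟶ σ) (c : σ ⟶ ρ) (v : τ.V) :
    Hom.hV (g ≫ c) v = Hom.hV c (Hom.hV g v) := rfl

/-! ### The equivalences -/

open Classical in
/-- The graph (with arcs) corresponding to a Borisov-Manin graph: arcs are flags and tails, the
copies of the tails playing the role of ports. -/
@[reducible]
def toJK (τ : BMGraph) : JKGraph where
  A := τ.F ⊕ τ.tails
  H := τ.F
  V := τ.V
  finA := inferInstance
  finH := inferInstance
  finV := inferInstance
  i := Sum.elim (fun f => if hf : τ.j f = f then Sum.inr ⟨f, hf⟩ else Sum.inl (τ.j f))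
    (fun t => Sum.inl t.1)
  s := Sum.inl
  p := τ.bd
  i_i := by
    rintro (f | ⟨t, ht⟩)
    · by_cases hf : τ.j f = f
      · simp [hf]
      · have : τ.j (τ.j f) ≠ τ.j f := by
          rw [τ.j_j]
          exact Ne.symm hf
        simp [hf, τ.j_j, Ne.symm hf]
    · have : τ.j t = t := ht
      simp [this]
  i_ne := by
    rintro (f | ⟨t, ht⟩)
    · by_cases hf : τ.j f = f
      · simp [hf]
      · simp [hf]
    · simp
  s_inj := Sum.inl_injective

theorem toJK_i_tail (τ : BMGraph) (f : τ.F) (hf : f ∈ τ.tails) :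
    τ.toJK.i (Sum.inl f : τ.F ⊕ τ.tails) = Sum.inr ⟨f, hf⟩ := dif_pos hf

theorem toJK_i_edge (τ : BMGraph) (f : τ.F) (hf : τ.j f ≠ f) :
    τ.toJK.i (Sum.inl f : τ.F ⊕ τ.tails) = Sum.inl (τ.j f) := dif_neg hf

theorem toJK_noIsolatedEdges (τ : BMGraph) : τ.toJK.NoIsolatedEdges := by
  rintro (f | t)
  · exact Or.inl ⟨f, rfl⟩
  · exact Or.inr ⟨t.1, rfl⟩

/-- The corresponding object of the restricted Kleisli category. -/
def toKGr (τ : BMGraph) : KGr := ⟨τ.toJK, τ.toJK_noIsolatedEdges⟩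

/-- Two equivariant maps on arcs that agree on (the arcs given by) flags are equal. -/
theorem toJK_arc_ext {τ : BMGraph} {C : Type} {inv : C → C} {u v : τ.toJK.A → C}
    (hu : ∀ a, u (τ.toJK.i a) = inv (u a)) (hv : ∀ a, v (τ.toJK.i a) = inv (v a))
    (h : ∀ f : τ.F, u (Sum.inl f : τ.F ⊕ τ.tails) = v (Sum.inl f : τ.F ⊕ τ.tails)) (a) :
    u a = v a := by
  rcases a with f | t
  · exact h f
  · have h1 := hu (Sum.inl t.1 : τ.F ⊕ τ.tails)
    have h2 := hv (Sum.inl t.1 : τ.F ⊕ τ.tails)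
    rw [toJK_i_tail τ t.1 t.2] at h1 h2
    exact h1.trans ((congrArg inv (h t.1)).trans h2.symm)

section Phi1

variable {τ σ ρ : BMGraph}

/-- The inverse of the bijection on flags of a grafting. -/
def graftEquiv (h : τ ⟶ σ) (hh : graftings h) : τ.F ≃ σ.F := (Equiv.ofBijective _ hh.2).symm

theorem hF_graftEquiv (h : τ ⟶ σ) (hh : graftings h) (f : τ.F) :
    Hom.hF h (graftEquiv h hh f) = f := (Equiv.ofBijective _ hh.2).apply_symm_apply f

theorem graftEquiv_hF (h : τ ⟶ σ) (hh : graftings h) (f : σ.F) :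
    graftEquiv h hh (Hom.hF h f) = f := (Equiv.ofBijective _ hh.2).symm_apply_apply f

/-- The etale map corresponding to a grafting: on half-edges it is the inverse of `hF`, and the
port belonging to a tail goes to the arc opposite to the image of that tail. -/
def graftMap (h : τ ⟶ σ) (hh : graftings h) : τ.toJK ⟶ σ.toJK where
  a := Sum.elim (fun f => Sum.inl (graftEquiv h hh f))
    (fun t => σ.toJK.i (Sum.inl (graftEquiv h hh t.1) : σ.F ⊕ σ.tails))
  h := graftEquiv h hh
  v := Hom.hV h
  a_i := by
    rintro (f | t)
    · by_cases hf : τ.j f = f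
      · rw [toJK_i_tail τ f hf]
        rfl
      · rw [toJK_i_edge τ f hf]
        have h1 := Hom.edge h (graftEquiv h hh f) (by rw [hF_graftEquiv]; exact hf)
        rw [hF_graftEquiv] at h1
        have h2 : σ.j (graftEquiv h hh f) = graftEquiv h hh (τ.j f) := by
          rw [← h1, graftEquiv_hF]
        have h3 : σ.j (graftEquiv h hh f) ≠ graftEquiv h hh f := fun e =>
          hf ((graftEquiv h hh).injective (h2.symm.trans e))
        refine Eq.trans ?_ (toJK_i_edge σ _ h3).symm
        rw [h2]
        rfl
    · exact (σ.toJK.i_i _).symm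
  a_s := fun _ => rfl
  v_p := fun f => (congrArg (fun t => Hom.hV h (τ.bd t)) (hF_graftEquiv h hh f)).symm.trans
    (Hom.bd_hF h _)
  pull := fun w f hf => by
    refine ⟨Hom.hF h f, ⟨?_, graftEquiv_hF h hh f⟩, ?_⟩
    · exact hh.1.1 ((Hom.bd_hF h f).trans hf)
    · rintro f' ⟨-, rfl⟩
      exact (hF_graftEquiv h hh f').symm

theorem graftMap_reduced (h : τ ⟶ σ) (hh : graftings h) : IsReducedCover (graftMap h hh) :=
  (isReducedCover_iff _ τ.toJK_noIsolatedEdges σ.toJK_noIsolatedEdges).2 hh.1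

theorem toJK_hom_ext {Y : JKGraph} {f g : τ.toJK ⟶ Y}
    (hh : ∀ x, JKGraph.Hom.h f x = JKGraph.Hom.h g x)
    (hv : ∀ x, JKGraph.Hom.v f x = JKGraph.Hom.v g x) : f = g := by
  refine JKGraph.hom_ext (toJK_arc_ext (JKGraph.Hom.a_i f) (JKGraph.Hom.a_i g) fun x => ?_) hh hv
  exact (JKGraph.Hom.a_s f x).trans ((congrArg Y.s (hh x)).trans (JKGraph.Hom.a_s g x).symm)

/-- Graftings to reduced covers. -/
def Φ₁ : WideSubcategory graftings ⥤ WideSubcategory KGr.reducedCovers where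
  obj τ := ⟨τ.obj.toKGr⟩
  map {τ σ} h := ⟨KGr.free (X := τ.obj.toKGr) (Y := σ.obj.toKGr) (graftMap h.hom h.property),
    _, graftMap_reduced h.hom h.property, rfl⟩
  map_id τ := by
    apply WideSubcategory.hom_ext
    refine Eq.trans ?_ (KGr.free_id τ.obj.toKGr)
    refine congrArg KGr.free (toJK_hom_ext (fun f => ?_) fun _ => rfl)
    exact hF_graftEquiv (𝟙 τ.obj) (graftings.id_mem τ.obj) f
  map_comp {τ σ ρ} h k := by
    apply WideSubcategory.hom_ext
    refine Eq.trans ?_ (KGr.free_comp (X := τ.obj.toKGr) (Y := σ.obj.toKGr) (Z := ρ.obj.toKGr)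
      (graftMap h.hom h.property) (graftMap k.hom k.property))
    refine congrArg KGr.free (toJK_hom_ext (fun f => ?_) fun _ => rfl)
    refine (h.hom ≫ k.hom).inj ?_
    refine (hF_graftEquiv _ (h ≫ k).property f).trans ?_
    rw [comp_hF]
    refine Eq.symm ((congrArg (Hom.hF h.hom) (hF_graftEquiv k.hom k.property _)).trans ?_)
    exact hF_graftEquiv h.hom h.property f

end Phi1

section Phi2

variable {τ σ ρ : BMGraph}

open Classical in
/-- For a morphism `h : σ ⟶ ρ` and a vertex `x` of `ρ`, the graph that is contracted to `x`: it is
spanned by the vertices of `σ` over `x`, its inner edges are the edges contracted by `h`, and it has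
one port for each flag of `ρ` at `x`. -/
@[reducible]
def fibre (h : σ ⟶ ρ) (x : ρ.V) : JKGraph where
  A := {f : σ.F // Hom.hV h (σ.bd f) = x} ⊕ {r : ρ.F // ρ.bd r = x}
  H := {f : σ.F // Hom.hV h (σ.bd f) = x}
  V := {v : σ.V // Hom.hV h v = x}
  finA := inferInstance
  finH := inferInstance
  finV := inferInstance
  i := Sum.elim
    (fun f => if hf : ∃ r, Hom.hF h r = f.1
      then Sum.inr ⟨hf.choose, by rw [← Hom.bd_hF h, hf.choose_spec, f.2]⟩
      else Sum.inl ⟨Hom.jc h f.1, by rw [Hom.bd_jc', f.2]⟩)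
    (fun r => Sum.inl ⟨Hom.hF h r.1, by rw [Hom.bd_hF, r.2]⟩)
  s := Sum.inl
  p := fun f => ⟨σ.bd f.1, f.2⟩
  i_i := by
    rintro (⟨f, hfx⟩ | ⟨r, hr⟩)
    · by_cases hf : ∃ r, Hom.hF h r = f
      · simp [hf, hf.choose_spec]
      · have : ¬ ∃ r, Hom.hF h r = Hom.jc h f := (Hom.jc_range h f).not.2 hf
        simp [hf, this, Hom.jc_jc]
    · have hf : ∃ r', Hom.hF h r' = Hom.hF h r := ⟨r, rfl⟩
      have := Hom.inj h hf.choose_spec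
      simp [this]
  i_ne := by
    rintro (⟨f, hfx⟩ | ⟨r, hr⟩)
    · by_cases hf : ∃ r, Hom.hF h r = f
      · simp [hf]
      · have : Hom.jc h f ≠ f := (Hom.jc_fix h f).not.2 hf
        simp [hf, this]
    · simp
  s_inj := Sum.inl_injective

theorem fibre_i_inr (h : σ ⟶ ρ) (x : ρ.V) (r : {r : ρ.F // ρ.bd r = x}) :
    (fibre h x).i (Sum.inr r : {f : σ.F // Hom.hV h (σ.bd f) = x} ⊕ _) =
      Sum.inl ⟨Hom.hF h r.1, by rw [Hom.bd_hF, r.2]⟩ := rfl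

theorem fibre_i_not (h : σ ⟶ ρ) (x : ρ.V) (f : {f : σ.F // Hom.hV h (σ.bd f) = x})
    (hf : f.1 ∉ Set.range (Hom.hF h)) :
    (fibre h x).i (Sum.inl f : _ ⊕ {r : ρ.F // ρ.bd r = x}) =
      Sum.inl ⟨Hom.jc h f.1, by rw [Hom.bd_jc', f.2]⟩ := dif_neg hf

/-- The fibre with its ports, as an effective graph with the same interface as `x`. -/
def fibreShell (h : σ ⟶ ρ) (x : ρ.V) : Shell (ρ.toJK.Fl x) where
  G := fibre h x
  eff := by
    constructor
    · obtain ⟨v, hv⟩ := Hom.surj h x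
      exact ⟨⟨v, hv⟩⟩
    · rintro (f | r)
      · exact Or.inl ⟨f, rfl⟩
      · exact Or.inr ⟨_, rfl⟩
  port := Equiv.ofBijective (fun r => ⟨Sum.inr r, by simp⟩)
    ⟨fun a b e => Sum.inr_injective (congrArg Subtype.val e), by
      rintro ⟨f | r, hr⟩
      · exact absurd ⟨f, rfl⟩ hr
      · exact ⟨r, rfl⟩⟩

/-- A compression commutes with the involutions. -/
theorem compression_j (h : σ ⟶ ρ) (hh : compressions h) (r : ρ.F) :
    Hom.hF h (ρ.j r) = σ.j (Hom.hF h r) := by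
  by_cases hr : σ.j (Hom.hF h r) = Hom.hF h r
  · obtain ⟨t, ht, e⟩ := hh.2.2 hr
    have := Hom.inj h e
    subst this
    exact (congrArg (Hom.hF h) ht).trans hr.symm
  · exact Hom.edge h r hr

/-- A compression contracts actual edges only. -/
theorem compression_jc (h : σ ⟶ ρ) (hh : compressions h) (f : σ.F)
    (hf : f ∉ Set.range (Hom.hF h)) : σ.j f ≠ f ∧ Hom.jc h f = σ.j f := by
  have h1 : σ.j f ≠ f := fun e => by
    obtain ⟨t, -, ht⟩ := hh.2.2 (show f ∈ σ.tails from e)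
    exact hf ⟨t, ht⟩
  exact ⟨h1, Hom.jc_edge h f hf h1⟩

/-- The etale map from the fibre of a compression. -/
def fibreMap (h : σ ⟶ ρ) (hh : compressions h) (x : ρ.V) : fibre h x ⟶ σ.toJK where
  a := Sum.elim (fun f => Sum.inl f.1)
    (fun r => σ.toJK.i (Sum.inl (Hom.hF h r.1) : σ.F ⊕ σ.tails))
  h := Subtype.val
  v := Subtype.val
  a_i := by
    rintro (f | r)
    · by_cases hf : f.1 ∈ Set.range (Hom.hF h)
      · obtain ⟨f, hfx⟩ := f
        obtain ⟨r, rfl⟩ := hf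
        have hr : ρ.bd r = x := by rw [← Hom.bd_hF h]; exact hfx
        have e := (fibre h x).i_i (Sum.inr ⟨r, hr⟩ : {f : σ.F // Hom.hV h (σ.bd f) = x} ⊕ _)
        rw [fibre_i_inr] at e
        rw [e]
        rfl
      · obtain ⟨h1, h2⟩ := compression_jc h hh f.1 hf
        rw [fibre_i_not h x f hf]
        refine Eq.trans ?_ (toJK_i_edge σ f.1 h1).symm
        exact congrArg Sum.inl h2
    · exact (σ.toJK.i_i _).symm
  a_s := fun _ => rfl
  v_p := fun _ => rfl
  pull := fun w f hf => ⟨⟨f, (congrArg (Hom.hV h) hf).trans w.2⟩, ⟨Subtype.ext hf, rfl⟩,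
    fun f' hf' => Subtype.ext hf'.2⟩

/-- The fibre of a compression, as a graph decorated by `σ`. -/
def fibrePiece (h : σ ⟶ ρ) (hh : compressions h) (x : ρ.V) :
    Piece (y.obj σ.toJK) (ρ.toJK.Fl x) where
  toShell := fibreShell h x
  dec := y.map (fibreMap h hh x)

/-- The map on arcs corresponding to a compression. -/
def comprArc (h : σ ⟶ ρ) (hh : compressions h) : ρ.F ⊕ ρ.tails → σ.F ⊕ σ.tails :=
  Sum.map (Hom.hF h) (fun t => ⟨Hom.hF h t.1, hh.1 t.2⟩)

theorem comprArc_i (h : σ ⟶ ρ) (hh : compressions h) (a : ρ.toJK.A) :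
    comprArc h hh (ρ.toJK.i a) = σ.toJK.i (comprArc h hh a) := by
  rcases a with f | t
  · by_cases hf : ρ.j f = f
    · rw [toJK_i_tail ρ f hf]
      exact (toJK_i_tail σ _ (hh.1 hf)).symm
    · rw [toJK_i_edge ρ f hf]
      have h1 : σ.j (Hom.hF h f) ≠ Hom.hF h f := fun e => hf (Hom.inj h (by
        rw [compression_j h hh, e]))
      refine Eq.trans ?_ (toJK_i_edge σ _ h1).symm
      exact congrArg Sum.inl (compression_j h hh f)
  · rfl

/-- The Kleisli morphism corresponding to a compression `h : σ ⟶ ρ`: each vertex of `ρ` is refined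
into the graph contracted to it. -/
def comprMap (h : σ ⟶ ρ) (hh : compressions h) : y.obj ρ.toJK ⟶ bar (y.obj σ.toJK) :=
  mkDec (comprArc h hh) (comprArc_i h hh) (fun x => cls (fibrePiece h hh x)) (by
    rintro x ⟨r, rfl⟩
    exact (comprArc_i h hh (Sum.inl r : ρ.F ⊕ ρ.tails)).symm)

theorem comprMap_at (h : σ ⟶ ρ) (hh : compressions h) (x : ρ.V) :
    at' (comprMap h hh) x = cls (fibrePiece h hh x) := mkDec_at _ _ _ _ _

theorem toJK_not_mem_range (τ : BMGraph) (t : τ.tails) :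
    (Sum.inr t : τ.F ⊕ τ.tails) ∉ Set.range τ.toJK.s := by simp

theorem isIso_of_ports {X Y : JKGraph} (f : X ⟶ Y) (hv : Function.Bijective (JKGraph.Hom.v f))
    (h1 : ∀ a, a ∉ Set.range X.s → JKGraph.Hom.a f a ∉ Set.range Y.s)
    (h2 : ∀ a b, a ∉ Set.range X.s → b ∉ Set.range X.s → JKGraph.Hom.a f a = JKGraph.Hom.a f b →
      a = b)
    (h3 : ∀ b, b ∉ Set.range Y.s → ∃ a, JKGraph.Hom.a f a = b) : IsIso f := by
  have hi := h_injective f hv.1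
  have hs := h_surjective f hv.2
  have key : ∀ a, a ∈ Set.range X.s → JKGraph.Hom.a f a ∈ Set.range Y.s := by
    rintro _ ⟨t, rfl⟩
    exact ⟨_, (JKGraph.Hom.a_s f t).symm⟩
  refine isIso_of_bijective f ⟨fun a b e => ?_, fun b => ?_⟩ ⟨hi, hs⟩ hv
  · by_cases ha : a ∈ Set.range X.s
    · by_cases hb : b ∈ Set.range X.s
      · obtain ⟨t, rfl⟩ := ha
        obtain ⟨u, rfl⟩ := hb
        rw [JKGraph.Hom.a_s, JKGraph.Hom.a_s] at e
        rw [hi (Y.s_inj e)]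
      · exact absurd (e ▸ key a ha) (h1 b hb)
    · by_cases hb : b ∈ Set.range X.s
      · exact absurd (e ▸ key b hb) (h1 a ha)
      · exact h2 a b ha hb e
  · by_cases hb : b ∈ Set.range Y.s
    · obtain ⟨t, rfl⟩ := hb
      obtain ⟨u, rfl⟩ := hs t
      exact ⟨_, JKGraph.Hom.a_s f u⟩
    · exact h3 b hb

theorem rel_of_bijective {F : Species} {n : Type} [Finite n] {P Q : Piece F n} (f : P.G ⟶ Q.G)
    (hv : Function.Bijective (JKGraph.Hom.v f))
    (hp : ∀ k, JKGraph.Hom.a f (P.port k).1 = (Q.port k).1)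
    (hd : y.map f ≫ Q.dec = P.dec) : Rel P Q := by
  have hP : ∀ a (h : a ∉ Set.range P.G.s), a = (P.port (P.port.symm ⟨a, h⟩)).1 := by
    intro a h
    simp
  have : IsIso f := by
    refine isIso_of_ports f hv ?_ ?_ ?_
    · intro a ha
      rw [hP a ha, hp]
      exact (Q.port _).2
    · intro a b ha hb e
      rw [hP a ha, hP b hb, hp, hp] at e
      have := Q.port.injective (Subtype.ext e)
      rw [hP a ha, hP b hb, this]
    · intro b hb
      refine ⟨(P.port (Q.port.symm ⟨b, hb⟩)).1, ?_⟩
      rw [hp]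
      simp
  exact ⟨asIso f, hp, hd⟩

theorem comprMap_generic (h : σ ⟶ ρ) (hh : compressions h) : IsGenericMap (comprMap h hh) := by
  by_cases hV : Nonempty ρ.V
  · refine isGenericMap_of_rep ⟨hV, ρ.toJK_noIsolatedEdges⟩ _ (fibrePiece h hh)
      (fun x => (comprMap_at h hh x).symm) ?_
    let sh := fun x => (fibrePiece h hh x).toShell
    have hport : ∀ a : (glue ρ.toJK sh).A, a ∉ Set.range (glue ρ.toJK sh).s →
        ∃ t : ρ.tails, a = Sum.inl (Sum.inr t) := by
      intro a ha
      have e : a = (gluePort ρ.toJK sh ((gluePort ρ.toJK sh).symm ⟨a, ha⟩)).1 := by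
        rw [Equiv.apply_symm_apply]
      rcases hq : (gluePort ρ.toJK sh).symm ⟨a, ha⟩ with ⟨b, hb⟩
      rw [hq] at e
      rcases b with f | t
      · exact absurd ⟨f, rfl⟩ hb
      · exact ⟨t, e⟩
    have hval : ∀ t : ρ.tails, JKGraph.Hom.a (colimMapOf (comprMap h hh) (fibrePiece h hh)
        (fun x => (comprMap_at h hh x).symm)) (Sum.inl (Sum.inr t)) =
        (Sum.inr ⟨Hom.hF h t.1, hh.1 t.2⟩ : σ.F ⊕ σ.tails) := fun t => rfl
    refine isIso_of_ports _ ?_ ?_ ?_ ?_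
    · have hval' : ∀ (x : ρ.V) (v : {v : σ.V // Hom.hV h v = x}),
          JKGraph.Hom.v (colimMapOf (comprMap h hh) (fibrePiece h hh)
            (fun x => (comprMap_at h hh x).symm))
            (⟨x, v⟩ : Σ x : ρ.V, {v : σ.V // Hom.hV h v = x}) = v.1 := fun x v => rfl
      constructor
      · rintro ⟨x, v, rfl⟩ ⟨x', v', rfl⟩ e
        have e2 : v = v' := e
        subst e2
        rfl
      · intro v
        exact ⟨(⟨Hom.hV h v, v, rfl⟩ : Σ x : ρ.V, {v : σ.V // Hom.hV h v = x}), rfl⟩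
    · intro a ha
      obtain ⟨t, rfl⟩ := hport a ha
      rw [hval]
      exact toJK_not_mem_range σ _
    · intro a b ha hb e
      obtain ⟨t, rfl⟩ := hport a ha
      obtain ⟨t', rfl⟩ := hport b hb
      rw [hval, hval] at e
      have e2 := Hom.inj h (congrArg Subtype.val (Sum.inr_injective e))
      rw [Subtype.ext e2]
    · rintro (f | t) hb
      · exact absurd ⟨f, rfl⟩ hb
      · obtain ⟨u, hu, e⟩ := hh.2.2 t.2
        refine ⟨_, (hval ⟨u, hu⟩).trans (congrArg Sum.inr (Subtype.ext e))⟩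
  · have hE : IsEmpty ρ.V := not_nonempty_iff.1 hV
    have hE' : IsEmpty σ.V := ⟨fun v => hE.false (Hom.hV h v)⟩
    have : IsEmpty ρ.toJK.V := hE
    have : IsEmpty σ.toJK.V := hE'
    exact isGenericMap_of_empty _ ρ.toJK_noIsolatedEdges σ.toJK_noIsolatedEdges

theorem comprMap_id (τ : BMGraph) :
    comprMap (𝟙 τ) (compressions.id_mem τ) = etaApp (y.obj τ.toJK) := by
  refine dec_ext ?_ fun x => ?_
  · rintro (f | t) <;> rfl
  · rw [comprMap_at]
    refine Eq.symm (cls_eq.2 ?_)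
    let e : τ.toJK.Fl x ≃ (fibre (𝟙 τ) x).Fl ⟨x, rfl⟩ :=
      ⟨fun k => ⟨k, Subtype.ext k.2⟩, fun k => k.1, fun _ => rfl, fun _ => rfl⟩
    refine rel_of_bijective (P := ⟨corShell (τ.toJK.Fl x), corDec (F := y.obj τ.toJK)
      ⟨τ.toJK.star x⟩⟩) (Q := fibrePiece (𝟙 τ) (compressions.id_mem τ) x)
      (JKGraph.mkCor (X := fibre (𝟙 τ) x) ⟨x, rfl⟩ e) ?_ ?_ ?_
    · exact ⟨fun _ _ _ => rfl, fun v => ⟨(), Subtype.ext v.2.symm⟩⟩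
    · intro k
      exact (fibre (𝟙 τ) x).i_i (Sum.inr k)
    · refine cor_dec_ext (Eq.trans ?_ (corDec_id _).symm)
      exact ULift.ext _ _ (JKGraph.cor_ext (fun _ => rfl) rfl)

theorem fibre_i_hF (h : σ ⟶ ρ) (x : ρ.V) (r : ρ.F) (hr : ρ.bd r = x)
    (hp : Hom.hV h (σ.bd (Hom.hF h r)) = x) :
    (fibre h x).i (Sum.inl ⟨Hom.hF h r, hp⟩ :
      {f : σ.F // Hom.hV h (σ.bd f) = x} ⊕ {r : ρ.F // ρ.bd r = x}) =
      (Sum.inr ⟨r, hr⟩ : {f : σ.F // Hom.hV h (σ.bd f) = x} ⊕ {r : ρ.F // ρ.bd r = x}) :=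
  (fibre h x).i_i (Sum.inr ⟨r, hr⟩ : {f : σ.F // Hom.hV h (σ.bd f) = x} ⊕ {r : ρ.F // ρ.bd r = x})

/-- The inclusion of half-edges of fibres for a composite. -/
def fibreFl (h : τ ⟶ σ) (k : σ ⟶ ρ) (x : ρ.V) (v : σ.V) (hv : Hom.hV k v = x)
    (f : {f : τ.F // Hom.hV h (τ.bd f) = v}) : {f : τ.F // Hom.hV (h ≫ k) (τ.bd f) = x} :=
  ⟨f.1, (congrArg (Hom.hV k) f.2).trans hv⟩

/-- The inclusion of arcs of fibres for a composite. -/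
def fibreArc (h : τ ⟶ σ) (k : σ ⟶ ρ) (x : ρ.V) (v : σ.V) (hv : Hom.hV k v = x) :
    {f : τ.F // Hom.hV h (τ.bd f) = v} ⊕ {r : σ.F // σ.bd r = v} →
    {f : τ.F // Hom.hV (h ≫ k) (τ.bd f) = x} ⊕ {r : ρ.F // ρ.bd r = x} :=
  Sum.elim (fun f => Sum.inl (fibreFl h k x v hv f))
    (fun r => (fibre (h ≫ k) x).i (Sum.inl (fibreFl h k x v hv
      ⟨Hom.hF h r.1, (Hom.bd_hF h r.1).trans r.2⟩) :
      {f : τ.F // Hom.hV (h ≫ k) (τ.bd f) = x} ⊕ {r : ρ.F // ρ.bd r = x}))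

/-- The inclusion of fibres for a composite. -/
def fibreIncl (h : τ ⟶ σ) (k : σ ⟶ ρ) (x : ρ.V) (v : σ.V) (hv : Hom.hV k v = x) :
    fibre h v ⟶ fibre (h ≫ k) x where
  a := fibreArc h k x v hv
  h := fibreFl h k x v hv
  v := fun w => ⟨w.1, (congrArg (Hom.hV k) w.2).trans hv⟩
  a_i := by
    rintro (⟨f, hf⟩ | r)
    · by_cases hr : f ∈ Set.range (Hom.hF h)
      · obtain ⟨r, rfl⟩ := hr
        have hr : σ.bd r = v := by rw [← Hom.bd_hF h]; exact hf
        exact congrArg (fibreArc h k x v hv) (fibre_i_hF h v r hr hf)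
      · refine (congrArg (fibreArc h k x v hv) (fibre_i_not h v ⟨f, hf⟩ hr)).trans ?_
        have hr' : f ∉ Set.range (Hom.hF (h ≫ k)) := by
          rintro ⟨t, rfl⟩
          exact hr ⟨_, rfl⟩
        refine Eq.trans ?_ (fibre_i_not (h ≫ k) x ⟨f, (congrArg (Hom.hV k) hf).trans hv⟩ hr').symm
        exact congrArg Sum.inl (Subtype.ext (Hom.compJc_not h k f hr).symm)
    · exact ((fibre (h ≫ k) x).i_i _).symm
  a_s := fun _ => rfl
  v_p := fun _ => rfl
  pull := by
    rintro ⟨w, hw⟩ ⟨f, hf⟩ e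
    have e1 : τ.bd f = w := congrArg Subtype.val e
    subst e1
    exact ⟨(⟨f, hw⟩ : {f : τ.F // Hom.hV h (τ.bd f) = v}), ⟨rfl, rfl⟩,
      fun f' hf' => Subtype.ext (congrArg (fun t => t.1) hf'.2 : f'.1 = f)⟩

theorem comprMap_comp (h : τ ⟶ σ) (hh : compressions h) (k : σ ⟶ ρ) (hk : compressions k) :
    comprMap (h ≫ k) (compressions.comp_mem h k hh hk) =
      comprMap k hk ≫ barMap (comprMap h hh) ≫ muApp (y.obj τ.toJK) := by
  refine dec_ext ?_ fun x => ?_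
  · rintro (f | t) <;> rfl
  · rw [comprMap_at]
    let Q : Piece (bar (y.obj τ.toJK)) (ρ.toJK.Fl x) :=
      Piece.map (comprMap h hh) (fibrePiece k hk x)
    let P : ∀ v : (fibre k x).V, Piece (y.obj τ.toJK) ((fibre k x).Fl v) := fun v =>
      relabel (JKGraph.flMap (fibreMap k hk x) v) (fibrePiece h hh v.1)
    have hP : ∀ v, cls (P v) = at' Q.dec v := fun v => by
      refine Eq.trans ?_ (at_map (fibreMap k hk x) (comprMap h hh) v).symm
      exact congrArg ((bar (y.obj τ.toJK)).act (JKGraph.flMap (fibreMap k hk x) v))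
        (comprMap_at h hh v.1).symm
    have e1 : at' (comprMap k hk ≫ barMap (comprMap h hh) ≫ muApp (y.obj τ.toJK)) x =
        Species.Hom.o (muApp (y.obj τ.toJK)) (cls Q) :=
      congrArg (fun t => Species.Hom.o (muApp (y.obj τ.toJK))
        (Species.Hom.o (barMap (comprMap h hh)) t)) (comprMap_at k hk x)
    refine Eq.trans ?_ (e1.trans (muApp_cls Q P hP)).symm
    refine Eq.symm (cls_eq.2 ?_)
    let W := fibre (h ≫ k) x
    let sh := fun v => (P v).toShell
    let cA : (fibre k x).A → W.A := Sum.elim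
      (fun f => Sum.inl ⟨Hom.hF h f.1, by rw [comp_hV, Hom.bd_hF, f.2]⟩) Sum.inr
    have cA_i : ∀ a, cA ((fibre k x).i a) = W.i (cA a) := by
      rintro (f | r)
      · by_cases hr : f.1 ∈ Set.range (Hom.hF k)
        · obtain ⟨f, hf⟩ := f
          obtain ⟨r, rfl⟩ := hr
          have hr : ρ.bd r = x := by rw [← Hom.bd_hF k]; exact hf
          exact (congrArg cA (fibre_i_hF k x r hr hf)).trans
            (fibre_i_hF (h ≫ k) x r hr _).symm
        · refine (congrArg cA (fibre_i_not k x f hr)).trans ?_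
          have hr' : Hom.hF h f.1 ∉ Set.range (Hom.hF (h ≫ k)) := by
            rintro ⟨t, ht⟩
            exact hr ⟨t, Hom.inj h ht⟩
          refine Eq.trans ?_ (fibre_i_not (h ≫ k) x ⟨Hom.hF h f.1, _⟩ hr').symm
          exact congrArg Sum.inl (Subtype.ext (Hom.compJc_hF h k f.1).symm)
      · rfl
    let φ : y.obj (glue (fibre k x) sh) ⟶ y.obj W := glueDesc (K := y.obj W) (fibre k x) sh cA cA_i
      (fun v => y.map (fibreIncl h k x v.1 v.2))
      (by
        rintro v ⟨r, rfl⟩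
        exact (cA_i (Sum.inl r : {f : σ.F // Hom.hV k (σ.bd f) = x} ⊕
          {r : ρ.F // ρ.bd r = x})).symm)
    have hφ : ∀ v, y.map (glueι (fibre k x) sh v) ≫ φ = y.map (fibreIncl h k x v.1 v.2) :=
      fun v => glueι_desc (fibre k x) sh _ _ _ _ v
    have hval : ∀ (v : {v : σ.V // Hom.hV k v = x}) (w : {w : τ.V // Hom.hV h w = v.1}),
      (JKGraph.Hom.v (yPre φ) (⟨v, w⟩ : Σ v : {v : σ.V // Hom.hV k v = x},
        {w : τ.V // Hom.hV h w = v.1})).1 = w.1 := fun v w => rfl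
    refine rel_of_bijective (Q := fibrePiece (h ≫ k) (compressions.comp_mem h k hh hk) x)
      (yPre φ) ?_ (fun _ => rfl) ?_
    · constructor
      · rintro ⟨⟨v, hv⟩, w, hw⟩ ⟨⟨v', hv'⟩, w', hw'⟩ e
        have e2 : w = w' := congrArg Subtype.val e
        subst e2
        have e3 : v = v' := hw.symm.trans hw'
        subst e3
        rfl
      · rintro ⟨w, hw⟩
        exact ⟨(⟨⟨Hom.hV h w, hw⟩, w, rfl⟩ : Σ v : {v : σ.V // Hom.hV k v = x},
          {w : τ.V // Hom.hV h w = v.1}), Subtype.ext (hval ⟨Hom.hV h w, hw⟩ ⟨w, rfl⟩)⟩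
    · refine Eq.trans (congrArg (· ≫ y.map (fibreMap (h ≫ k)
        (compressions.comp_mem h k hh hk) x)) (y_yPre φ)) ?_
      refine glue_ext (fibre k x) sh ?_ fun v => ?_
      · rintro (f | r)
        · rfl
        · exact (comprArc_i h hh (Sum.inl (Hom.hF k r.1) : σ.F ⊕ σ.tails)).symm
      · refine (chase (hφ v) ?_).trans (substPiece_ι Q.toShell _ _ P _ v).symm
        refine (y.map_comp _ _).symm.trans ?_
        refine congrArg y.map (?_ : _ = fibreMap h hh v.1)
        refine JKGraph.hom_ext ?_ (fun _ => rfl) (fun _ => rfl)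
        rintro (f | r)
        · rfl
        · exact JKGraph.Hom.a_i (fibreMap (h ≫ k) (compressions.comp_mem h k hh hk) x)
            (Sum.inl (fibreFl h k x v.1 v.2 ⟨Hom.hF h r.1, (Hom.bd_hF h r.1).trans r.2⟩) :
              {f : τ.F // Hom.hV (h ≫ k) (τ.bd f) = x} ⊕ {r : ρ.F // ρ.bd r = x})

/-- Compressions to generic morphisms, read backwards. -/
def Φ₂ : WideSubcategory compressions ⥤ (WideSubcategory KGr.generics)ᵒᵖ where
  obj τ := Opposite.op ⟨τ.obj.toKGr⟩
  map {σ ρ} h := Quiver.Hom.op ⟨KGr.ofMap (X := ρ.obj.toKGr) (Y := σ.obj.toKGr)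
    (comprMap h.hom h.property), comprMap_generic h.hom h.property⟩
  map_id τ := by
    apply Quiver.Hom.unop_inj
    apply WideSubcategory.hom_ext
    exact KGr.ext (comprMap_id τ.obj)
  map_comp {τ σ ρ} h k := by
    apply Quiver.Hom.unop_inj
    apply WideSubcategory.hom_ext
    exact KGr.ext (comprMap_comp h.hom h.property k.hom k.property)

end Phi2

end BMGraph

end BM

end

/-!
A graph that is etale over `Y` and injective on vertices is determined by the vertices it covers
and by the colours of its ports, which tell which edges of `Y` have been cut. The graphs of a
generic morphism from `X` to `Y` are of this kind and partition the vertices of `Y`, so the morphism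
amounts to a surjection from the vertices of `Y` to those of `X` together with an injection of arcs
in the other direction, which is a compression.

A morphism of Borisov-Manin graphs contracts virtual edges; grafting all of these first leaves only
actual edges to contract, which gives the factorisation. Both composites of the square then
substitute graphs with the same vertices and port colours, so it commutes. As covers are
epimorphisms for the Kleisli composition, a cocone descends along the reduced cover as soon as its
colours do, and these only have to match at the newly grafted edges.
-/

noncomputable section

theorem isPushout_of_epi_of_exists_desc {C : Type*} [Category* C] {W X Y Z : C} {f : W ⟶ X}
    {g : W ⟶ Y} {inl : X ⟶ Z} {inr : Y ⟶ Z} [Epi f] [Epi inr] (comm : f ≫ inl = g ≫ inr)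
    (desc : ∀ {T : C} (α : X ⟶ T) (β : Y ⟶ T), f ≫ α = g ≫ β → ∃ γ, inr ≫ γ = β) :
    IsPushout f g inl inr := by
  choose γ hγ using @desc
  refine ⟨⟨comm⟩, ⟨Limits.PushoutCocone.IsColimit.mk comm (fun s => γ s.inl s.inr s.condition)
    (fun s => ?_) (fun s => hγ _ _ s.condition) fun s m _ hm => ?_⟩⟩
  · rw [← cancel_epi f, ← Category.assoc, comm, Category.assoc, hγ, s.condition]
  · rw [← cancel_epi inr, hm, hγ]

namespace JK

open JKGraph Piece

namespace JKGraph

variable {X Y Z : JKGraph}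

/-! ### Etale maps -/

theorem NoIsolatedEdges.exists_eq_s_or_eq_i_s (hX : X.NoIsolatedEdges) (a : X.A) :
    ∃ t, a = X.s t ∨ a = X.i (X.s t) := by
  rcases hX a with ⟨t, rfl⟩ | ⟨t, ht⟩
  · exact ⟨t, .inl rfl⟩
  · exact ⟨t, .inr (by rw [ht, X.i_i])⟩

theorem hom_ext_of_noIsolatedEdges (hX : X.NoIsolatedEdges) {f g : X ⟶ Y}
    (hh : ∀ t, Hom.h f t = Hom.h g t) (hv : ∀ x, Hom.v f x = Hom.v g x) : f = g := by
  refine hom_ext (fun a => ?_) hh hv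
  obtain ⟨t, rfl | rfl⟩ := hX.exists_eq_s_or_eq_i_s a
  · rw [Hom.a_s, Hom.a_s, hh]
  · rw [Hom.a_i, Hom.a_i, Hom.a_s, Hom.a_s, hh]

theorem Hom.a_i_s (f : X ⟶ Y) (t : X.H) : Hom.a f (X.i (X.s t)) = Y.i (Y.s (Hom.h f t)) := by
  rw [Hom.a_i, Hom.a_s]

theorem i_injective (X : JKGraph) : Function.Injective X.i :=
  Function.LeftInverse.injective X.i_i

theorem a_mem_range_s_iff_of_isIso (f : X ⟶ Y) [IsIso f] (a : X.A) :
    Hom.a f a ∈ Set.range Y.s ↔ a ∈ Set.range X.s := by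
  constructor
  · rintro ⟨t, ht⟩
    obtain ⟨t, rfl⟩ := (bijective_of_isIso f).2.1.2 t
    exact ⟨t, (bijective_of_isIso f).1.1 ((Hom.a_s f t).trans ht)⟩
  · rintro ⟨t, rfl⟩
    exact ⟨_, (Hom.a_s f t).symm⟩

theorem exists_hom_of_flags (hX : X.NoIsolatedEdges) (eh : X.H → Y.H) (ev : X.V → Y.V)
    (hp : ∀ t, ev (X.p t) = Y.p (eh t))
    (pull : ∀ w z, Y.p z = ev w → ∃! t, X.p t = w ∧ eh t = z)
    (inner : ∀ t u, X.i (X.s t) = X.s u → Y.i (Y.s (eh t)) = Y.s (eh u)) :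
    ∃ f : X ⟶ Y, Hom.h f = eh ∧ Hom.v f = ev := by
  have exists_arc : ∀ a, ∃ b, (∀ t, a = X.s t → b = Y.s (eh t)) ∧
      ∀ t, a = X.i (X.s t) → b = Y.i (Y.s (eh t)) := fun a => by
    obtain ⟨t, rfl | rfl⟩ := hX.exists_eq_s_or_eq_i_s a
    · exact ⟨Y.s (eh t), fun u hu => by rw [X.s_inj hu], fun u hu => (inner u t hu.symm).symm⟩
    · exact ⟨Y.i (Y.s (eh t)), fun u hu => inner t u hu,
        fun u hu => by rw [X.s_inj (X.i_injective hu)]⟩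
  choose a a_s a_i_s using exists_arc
  refine ⟨⟨a, eh, ev, fun b => ?_, fun t => a_s _ t rfl, hp, pull⟩, rfl, rfl⟩
  obtain ⟨t, rfl | rfl⟩ := hX.exists_eq_s_or_eq_i_s b
  · rw [a_s _ t rfl, a_i_s _ t rfl]
  · rw [a_i_s _ t rfl, a_s _ t (X.i_i _), Y.i_i]

/-- Etale maps are determined at each vertex, so only the inner edges can obstruct a lift. -/
theorem exists_lift (hX : X.NoIsolatedEdges) (p : X ⟶ Y) (q : Z ⟶ Y)
    (hq : Function.Injective (Hom.v q)) (hr : Set.range (Hom.v p) ⊆ Set.range (Hom.v q))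
    (inner : ∀ t u, X.i (X.s t) ∈ Set.range X.s → Hom.h q u = Hom.h p t →
      Z.i (Z.s u) ∈ Set.range Z.s) : ∃ f : X ⟶ Z, f ≫ q = p := by
  choose ev hev using fun x => hr ⟨x, rfl⟩
  have exists_flag : ∀ t, ∃ u, Z.p u = ev (X.p t) ∧ Hom.h q u = Hom.h p t := fun t =>
    (Hom.pull q _ _ (by rw [hev, Hom.v_p])).exists
  choose eh heh using exists_flag
  have hqh := h_injective q hq
  obtain ⟨f, hfh, hfv⟩ := exists_hom_of_flags hX eh ev (fun t => (heh t).1.symm)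
    (fun w z hz => by
      obtain ⟨t, ⟨rfl, ht⟩, huniq⟩ :=
        Hom.pull p w (Hom.h q z) (by rw [← Hom.v_p, hz, hev])
      refine ⟨t, ⟨rfl, hqh ((heh t).2.trans ht)⟩, fun u hu => huniq u ⟨hu.1, ?_⟩⟩
      rw [← (heh u).2, hu.2])
    (fun t u htu => by
      obtain ⟨u', hu'⟩ := inner t (eh t) ⟨u, htu.symm⟩ (heh t).2
      have hqu := congrArg (Hom.a q) hu'
      rw [Hom.a_s, Hom.a_i_s, (heh t).2, ← Hom.a_i_s, htu, Hom.a_s, ← (heh u).2] at hqu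
      rw [← hu', hqh (Y.s_inj hqu)])
  exact ⟨f, hom_ext_of_noIsolatedEdges hX (fun t => (congrArg _ (congrFun hfh t)).trans (heh t).2)
    fun x => (congrArg _ (congrFun hfv x)).trans (hev x)⟩

/-- The bijection between the ports of isomorphic graphs. -/
def portEquiv (e : X ≅ Y) : X.Port ≃ Y.Port :=
  (Equiv.ofBijective _ (bijective_of_isIso e.hom).1).subtypeEquiv fun a =>
    (a_mem_range_s_iff_of_isIso e.hom a).symm.not

end JKGraph

/-! ### Decorations -/

theorem Species.act_symm_act (F : Species) {n m : Type} [Finite n] [Finite m] (e : m ≃ n)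
    (x : F.Op n) : F.act e.symm (F.act e x) = x := by
  rw [F.act_trans, Equiv.symm_trans_self, F.act_refl]

theorem Species.act_act_symm (F : Species) {n m : Type} [Finite n] [Finite m] (e : m ≃ n)
    (x : F.Op m) : F.act e (F.act e.symm x) = x :=
  F.act_symm_act e.symm x

section Decoration

variable {X Y : JKGraph} {F : Species}

theorem dec_ext_of_isCover (f : X ⟶ Y) (hf : IsCover f) {d d' : y.obj Y ⟶ F}
    (h : y.map f ≫ d = y.map f ≫ d') : d = d' := by
  refine dec_ext (fun b => ?_) fun w => ?_
  · obtain ⟨a, rfl⟩ := hf.1 b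
    exact congrArg (fun d => Species.Hom.c d a) h
  · obtain ⟨x, rfl⟩ := hf.2 w
    have hx : F.act (flMap f x) (at' d _) = F.act (flMap f x) (at' d' _) := by
      rw [← at_map, h, at_map]
    rw [← F.act_symm_act (flMap f x) (at' d _), hx, F.act_symm_act]

theorem exists_map_comp_eq_of_bijective (f : X ⟶ Y)
    (hv : Function.Bijective (JKGraph.Hom.v f)) (d : y.obj X ⟶ F) (c : Y.A → F.Col)
    (c_i : ∀ b, c (Y.i b) = F.inv (c b))
    (hc : ∀ a, c (JKGraph.Hom.a f a) = Species.Hom.c d a) :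
    ∃ d' : y.obj Y ⟶ F, y.map f ≫ d' = d := by
  let e := Equiv.ofBijective _ hv
  let o : ∀ w, F.Op (Y.Fl w) := e.piCongrLeft (fun w => F.Op (Y.Fl w))
    (fun x => F.act (flMap f x).symm (at' d x))
  have o_v : ∀ x, o (JKGraph.Hom.v f x) = F.act (flMap f x).symm (at' d x) :=
    e.piCongrLeft_apply_apply (fun w => F.Op (Y.Fl w)) _
  refine ⟨mkDec c c_i o ?_, dec_ext hc fun x => ?_⟩
  · intro w k
    obtain ⟨x, rfl⟩ := hv.2 w
    obtain ⟨k, rfl⟩ := (flMap f x).surjective k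
    rw [o_v, F.col_act, Equiv.symm_apply_apply, col_at, ← hc, Hom.a_i_s, flMap_val]
  · rw [at_map, mkDec_at, o_v, F.act_act_symm]

end Decoration

section Piece

variable {Y : JKGraph} {n : Type} [Finite n]

theorem Shell.exists_port_eq_i_s (S : Shell n) (k : n) :
    ∃ t, (S.port k).1 = S.G.i (S.G.s t) := by
  obtain ⟨t, ht⟩ := S.iport_mem k
  exact ⟨t, by rw [ht, S.G.i_i]⟩

theorem Shell.i_s_eq_port_of_a_eq (S : Shell n) (p : S.G ⟶ Y)
    (hp : Function.Injective (JKGraph.Hom.h p)) {t : S.G.H} {k : n}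
    (h : JKGraph.Hom.a p (S.G.i (S.G.s t)) = JKGraph.Hom.a p (S.port k).1) :
    S.G.i (S.G.s t) = (S.port k).1 := by
  obtain ⟨u, hu⟩ := S.exists_port_eq_i_s k
  rw [hu, Hom.a_i_s, Hom.a_i_s] at h
  rw [hu, hp (Y.s_inj (Y.i_injective h))]

theorem Shell.exists_port_eq_of_notMem_range_s (S : Shell n) {a : S.G.A}
    (ha : a ∉ Set.range S.G.s) : ∃ k, (S.port k).1 = a :=
  ⟨S.port.symm ⟨a, ha⟩, by rw [Equiv.apply_symm_apply]⟩

/-- An edge of `Y` may join two of the chosen vertices without being an inner edge of the piece: it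
is the colours of the ports that tell which edges have been cut. -/
theorem rel_of_range_v_eq {P Q : Piece (y.obj Y) n}
    (hP : Function.Injective (JKGraph.Hom.v (yPre P.dec)))
    (hQ : Function.Injective (JKGraph.Hom.v (yPre Q.dec)))
    (hr : Set.range (JKGraph.Hom.v (yPre P.dec)) = Set.range (JKGraph.Hom.v (yPre Q.dec)))
    (hport : ∀ k, JKGraph.Hom.a (yPre P.dec) (P.port k).1 =
      JKGraph.Hom.a (yPre Q.dec) (Q.port k).1) : Rel P Q := by
  have hPh := h_injective _ hP
  have hQh := h_injective _ hQ
  obtain ⟨f, hf⟩ : ∃ f : P.G ⟶ Q.G, f ≫ yPre Q.dec = yPre P.dec := by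
    refine exists_lift P.eff.2 _ _ hQ hr.subset fun t u ht hut => ?_
    by_contra hu
    obtain ⟨k, hk⟩ := Q.exists_port_eq_of_notMem_range_s hu
    refine (P.port k).2 (P.i_s_eq_port_of_a_eq (yPre P.dec) hPh ?_ ▸ ht)
    rw [hport, hk, Hom.a_i_s, Hom.a_i_s, hut]
  have hfa : ∀ a, JKGraph.Hom.a (yPre Q.dec) (JKGraph.Hom.a f a) = JKGraph.Hom.a (yPre P.dec) a :=
    fun a => congrArg (fun q => JKGraph.Hom.a q a) hf
  have hfv : ∀ x, JKGraph.Hom.v (yPre Q.dec) (JKGraph.Hom.v f x) = JKGraph.Hom.v (yPre P.dec) x :=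
    fun x => congrArg (fun q => JKGraph.Hom.v q x) hf
  refine BM.BMGraph.rel_of_bijective f ⟨fun x x' e => hP ?_, fun w => ?_⟩ (fun k => ?_) ?_
  · rw [← hfv, e, hfv]
  · obtain ⟨x, hx⟩ := hr.superset ⟨w, rfl⟩
    exact ⟨x, hQ ((hfv x).trans hx)⟩
  · obtain ⟨t, ht⟩ := P.exists_port_eq_i_s k
    have hk := hport k
    rw [← hfa, ht, Hom.a_i_s] at hk
    rw [ht, Hom.a_i_s, Q.i_s_eq_port_of_a_eq _ hQh hk]
  · rw [← y_yPre P.dec, ← hf, y.map_comp, y_yPre]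

theorem dec_ext_of_range_v_eq {X : JKGraph} {d d' : y.obj X ⟶ bar (y.obj Y)}
    (hc : ∀ a, Species.Hom.c d a = Species.Hom.c d' a) (P Q : ∀ x, Piece (y.obj Y) (X.Fl x))
    (hP : ∀ x, cls (P x) = at' d x) (hQ : ∀ x, cls (Q x) = at' d' x)
    (hPv : ∀ x, Function.Injective (JKGraph.Hom.v (yPre (P x).dec)))
    (hQv : ∀ x, Function.Injective (JKGraph.Hom.v (yPre (Q x).dec)))
    (hr : ∀ x, Set.range (JKGraph.Hom.v (yPre (P x).dec)) =
      Set.range (JKGraph.Hom.v (yPre (Q x).dec))) : d = d' := by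
  refine dec_ext hc fun x => ?_
  have hrel : Rel (P x) (Q x) := rel_of_range_v_eq (hPv x) (hQv x) (hr x) fun k =>
    (rep_col d x (P x) (hP x) k).trans ((hc _).trans (rep_col d' x (Q x) (hQ x) k).symm)
  exact (hP x).symm.trans ((cls_eq.2 hrel).trans (hQ x))

end Piece

/-! ### Generic morphisms -/

section Generic

variable {X Y : JKGraph} {d : y.obj X ⟶ bar (y.obj Y)}

theorem glueι_colimDec (d : y.obj X ⟶ bar (y.obj Y)) (x : X.V) :
    glueι X (fun x => (rep d x).toShell) x ≫ yPre (colimDec d) = yPre (rep d x).dec :=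
  y_inj <| calc
    _ = y.map (glueι X (fun x => (rep d x).toShell) x) ≫ colimDec d :=
      (y.map_comp _ _).trans (congrArg (_ ≫ ·) (y_yPre (colimDec d)))
    _ = (rep d x).dec := glueι_desc ..
    _ = _ := (y_yPre _).symm

theorem a_colimDec_glueArc (d : y.obj X ⟶ bar (y.obj Y)) (x : X.V) (a : (rep d x).G.A) :
    JKGraph.Hom.a (yPre (colimDec d)) (glueArc X (fun x => (rep d x).toShell) x a) =
      JKGraph.Hom.a (yPre (rep d x).dec) a :=
  congrArg (fun q => JKGraph.Hom.a q a) (glueι_colimDec d x)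

theorem h_colimDec (d : y.obj X ⟶ bar (y.obj Y)) (x : X.V) (t : (rep d x).G.H) :
    JKGraph.Hom.h (yPre (colimDec d)) (⟨x, t⟩ : Σ x, (rep d x).G.H) =
      JKGraph.Hom.h (yPre (rep d x).dec) t :=
  congrArg (fun q => JKGraph.Hom.h q t) (glueι_colimDec d x)

theorem v_colimDec (d : y.obj X ⟶ bar (y.obj Y)) (x : X.V) (w : (rep d x).G.V) :
    JKGraph.Hom.v (yPre (colimDec d)) (⟨x, w⟩ : Σ x, (rep d x).G.V) =
      JKGraph.Hom.v (yPre (rep d x).dec) w :=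
  congrArg (fun q => JKGraph.Hom.v q w) (glueι_colimDec d x)

namespace IsGenericMap

theorem bijective (hd : IsGenericMap d) :
    Function.Bijective (JKGraph.Hom.a (yPre (colimDec d))) ∧
      Function.Bijective (JKGraph.Hom.h (yPre (colimDec d))) ∧
        Function.Bijective (JKGraph.Hom.v (yPre (colimDec d))) :=
  have : IsIso (yPre (colimDec d)) := hd
  bijective_of_isIso _

theorem c_injective (hd : IsGenericMap d) : Function.Injective (Species.Hom.c d) := fun a b h =>
  Sum.inl_injective (hd.bijective.1.1 (a₁ := (Sum.inl a : X.A ⊕ _)) (a₂ := (Sum.inl b : X.A ⊕ _)) h)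

theorem c_mem_range_s_iff (hd : IsGenericMap d) (a : X.A) :
    Species.Hom.c d a ∈ Set.range Y.s ↔ a ∈ Set.range X.s :=
  have : IsIso (yPre (colimDec d)) := hd
  (a_mem_range_s_iff_of_isIso (yPre (colimDec d)) (Sum.inl a : X.A ⊕ _)).trans
    (glue_range_s X _ a)

/-- A generic morphism from `X` to `Y` decomposes `Y` into graphs indexed by the vertices of `X`:
this is the vertex of `X` whose graph contains a given vertex of `Y`. -/
def base (hd : IsGenericMap d) (w : Y.V) : X.V :=
  ((Equiv.ofBijective _ hd.bijective.2.2).symm w).1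

theorem base_v_rep (hd : IsGenericMap d) (x : X.V) (w : (rep d x).G.V) :
    hd.base (JKGraph.Hom.v (yPre (rep d x).dec) w) = x := by
  rw [← v_colimDec]
  exact congrArg Sigma.fst (Equiv.ofBijective_symm_apply_apply _ hd.bijective.2.2 ⟨x, w⟩)

theorem base_surjective (hd : IsGenericMap d) : Function.Surjective hd.base := fun x =>
  have ⟨w⟩ := (rep d x).eff.1
  ⟨_, hd.base_v_rep x w⟩

theorem v_rep_injective (hd : IsGenericMap d) (x : X.V) :
    Function.Injective (JKGraph.Hom.v (yPre (rep d x).dec)) := fun w w' h => by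
  rw [← v_colimDec, ← v_colimDec] at h
  exact eq_of_heq (Sigma.mk.inj (hd.bijective.2.2.1 h)).2

theorem range_v_rep (hd : IsGenericMap d) (x : X.V) :
    Set.range (JKGraph.Hom.v (yPre (rep d x).dec)) = {w | hd.base w = x} := by
  refine Set.Subset.antisymm (Set.range_subset_iff.2 (hd.base_v_rep x)) ?_
  rintro w rfl
  obtain ⟨⟨x, u⟩, rfl⟩ := hd.bijective.2.2.2 w
  rw [v_colimDec, base_v_rep]
  exact ⟨u, rfl⟩

theorem base_p_of_s_eq_c (hd : IsGenericMap d) {t : Y.H} {r : X.H}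
    (h : Y.s t = Species.Hom.c d (X.s r)) : hd.base (Y.p t) = X.p r := by
  obtain ⟨u, hu⟩ := (rep d (X.p r)).iport_mem ⟨r, rfl⟩
  have hut : JKGraph.Hom.h (yPre (rep d (X.p r)).dec) u = t := by
    refine Y.s_inj ?_
    rw [← Hom.a_s, hu, ← a_colimDec_glueArc, glueArc_iport, h]
    rfl
  rw [← hut, ← Hom.v_p, base_v_rep]

theorem exists_i_s_eq_of_notMem_range_c (hd : IsGenericMap d) {t : Y.H}
    (ht : Y.s t ∉ Set.range (Species.Hom.c d)) :
    ∃ u, Y.i (Y.s t) = Y.s u ∧ hd.base (Y.p u) = hd.base (Y.p t) := by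
  obtain ⟨⟨x, t⟩, rfl⟩ := hd.bijective.2.1.2 t
  rw [h_colimDec] at ht ⊢
  rcases (rep d x).arc_cases ((rep d x).G.s t) with ⟨-, u, hu⟩ | ⟨k, hk⟩ | ⟨k, hk⟩
  · refine ⟨JKGraph.Hom.h (yPre (rep d x).dec) u, ?_, ?_⟩
    · rw [← Hom.a_i_s, ← hu, Hom.a_s]
    · rw [← Hom.v_p, ← Hom.v_p, base_v_rep, base_v_rep]
  · exact absurd ⟨t, hk⟩ ((rep d x).port k).2
  · refine absurd ⟨X.s k.1, ?_⟩ ht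
    rw [← Hom.a_s, hk, ← a_colimDec_glueArc, glueArc_iport]
    rfl

end IsGenericMap

end Generic

/-! ### Free morphisms -/

theorem etaApp_o_injective (F : Species) (n : Type) [Finite n] :
    Function.Injective (Species.Hom.o (etaApp F) (n := n)) := fun x x' h => by
  obtain ⟨θ, hport, hdec⟩ :=
    cls_eq.1 (show cls ⟨corShell n, corDec x⟩ = cls ⟨corShell n, corDec x'⟩ from h)
  have hθ : θ.hom = 𝟙 (corolla n) := cor_ext (q := θ.hom) (fun k =>
    Sum.inl_injective ((hom_a_inl (X := corolla n) θ.hom k).symm.trans (hport k))) rfl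
  have hxx' : corDec x' = corDec x :=
    (Category.id_comp _).symm.trans <| (congrArg (· ≫ corDec x')
      ((congrArg y.map hθ).trans (y.map_id _)).symm).trans hdec
  rw [← corDec_id x, ← hxx', corDec_id]

theorem map_etaApp_injective {X Y : JKGraph} {k l : X ⟶ Y}
    (h : y.map k ≫ etaApp (y.obj Y) = y.map l ≫ etaApp (y.obj Y)) : k = l :=
  y_inj (Species.hom_ext
    (fun a => congrArg (fun t : y.obj X ⟶ bar (y.obj Y) => Species.Hom.c t a) h)
    fun n _ x => etaApp_o_injective _ n
      (congrArg (fun t : y.obj X ⟶ bar (y.obj Y) => Species.Hom.o t x) h))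

namespace KGr

variable {X Y Z : KGr}

theorem toMap_free (k : X.1 ⟶ Y.1) :
    toMap (free k : X ⟶ Y) = y.map k ≫ etaApp (y.obj Y.1) := rfl

theorem free_injective : Function.Injective (free : (X.1 ⟶ Y.1) → (X ⟶ Y)) := fun _ _ h =>
  map_etaApp_injective (congrArg toMap h)

theorem toMap_free_comp (k : X.1 ⟶ Y.1) (f : Y ⟶ Z) :
    toMap ((free k : X ⟶ Y) ≫ f) = y.map k ≫ toMap f := by
  rw [toMap_comp, toMap_free, Category.assoc, ← Category.assoc (etaApp _), ← eta_nat,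
    Category.assoc, mu_left_unit]
  exact congrArg (y.map k ≫ ·) (Category.comp_id _)

theorem toMap_comp_free (f : X ⟶ Y) (k : Y.1 ⟶ Z.1) :
    toMap (f ≫ (free k : Y ⟶ Z)) = toMap f ≫ barMap (y.map k) := by
  have barMap_comp : barMap (y.map k ≫ etaApp (y.obj Z.1)) =
      barMap (y.map k) ≫ barMap (etaApp (y.obj Z.1)) := barFunctor.map_comp _ _
  rw [toMap_comp, toMap_free, barMap_comp, Category.assoc, mu_right_unit]
  exact congrArg (toMap f ≫ ·) (Category.comp_id _)

/-- The isomorphism in the restricted Kleisli category given by an isomorphism of graphs. -/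
def freeIso (e : X.1 ≅ Y.1) : X ≅ Y where
  hom := free e.hom
  inv := free e.inv
  hom_inv_id := by rw [← free_comp, e.hom_inv_id, free_id]
  inv_hom_id := by rw [← free_comp, e.inv_hom_id, free_id]

theorem reducedCovers_freeIso (e : X.1 ≅ Y.1) : reducedCovers (freeIso e).hom :=
  ⟨e.hom, (isReducedCover_iff _ X.2 Y.2).2 (bijective_of_isIso e.hom).2.2, rfl⟩

theorem generics_freeIso (e : X.1 ≅ Y.1) : generics (freeIso e).hom := by
  by_cases hV : Nonempty X.1.V
  · have hX : X.1.Effective := ⟨hV, X.2⟩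
    have hY : Y.1.Effective := ⟨hV.map (JKGraph.Hom.v e.hom), Y.2⟩
    refine (isGenericMap_iff hX hY _).2 ⟨portEquiv e, ?_⟩
    refine (congrArg (fun q => Species.Hom.o q (cls (selfPiece hX (Equiv.refl _) (y.map e.hom))))
      (mu_right_unit (y.obj Y.1))).trans ?_
    exact cls_eq.2 ⟨e, fun _ => rfl, Category.comp_id _⟩
  · have : IsEmpty X.1.V := not_nonempty_iff.1 hV
    have : IsEmpty Y.1.V := ⟨fun w => this.false (JKGraph.Hom.v e.inv w)⟩
    exact isGenericMap_of_empty _ X.2 Y.2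

theorem epi_free (k : X.1 ⟶ Y.1) (hk : IsCover k) : Epi (free k : X ⟶ Y) where
  left_cancellation u v h := by
    have hmap := congrArg toMap h
    rw [toMap_free_comp, toMap_free_comp] at hmap
    exact KGr.ext (dec_ext_of_isCover k hk hmap)

theorem exists_free_comp_eq (k : X.1 ⟶ Y.1) (hk : IsReducedCover k) (f : X ⟶ Z)
    (c : Y.1.A → Z.1.A) (c_i : ∀ b, c (Y.1.i b) = Z.1.i (c b))
    (hc : ∀ a, c (JKGraph.Hom.a k a) = Species.Hom.c (toMap f) a) :
    ∃ g : Y ⟶ Z, (free k : X ⟶ Y) ≫ g = f := by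
  obtain ⟨d, hd⟩ := exists_map_comp_eq_of_bijective k ((isReducedCover_iff k X.2 Y.2).1 hk)
    (toMap f) c c_i hc
  exact ⟨ofMap d, KGr.ext ((toMap_free_comp k (ofMap d : Y ⟶ Z)).trans hd)⟩

end KGr

end JK

namespace BM

open JK JK.Piece

namespace BMGraph

variable {τ σ ρ ω : BMGraph}

/-! ### Graftings and compressions -/

theorem grafting_jc (h : τ ⟶ σ) (hh : graftings h) (f : τ.F) : Hom.jc h f = f :=
  (Hom.jc_fix h f).2 (hh.2.2 f)

theorem grafting_ext {h k : τ ⟶ σ} (hh : graftings h) (hk : graftings k)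
    (hF : Hom.hF h = Hom.hF k) (hV : Hom.hV h = Hom.hV k) : h = k :=
  Hom.ext hF hV (funext fun f => (grafting_jc h hh f).trans (grafting_jc k hk f).symm)

theorem compression_ext {h k : σ ⟶ ρ} (hh : compressions h) (hk : compressions k)
    (hF : Hom.hF h = Hom.hF k) (hV : Hom.hV h = Hom.hV k) : h = k := by
  refine Hom.ext hF hV (funext fun f => ?_)
  by_cases hf : f ∈ Set.range (Hom.hF h)
  · exact ((Hom.jc_fix h f).2 hf).trans ((Hom.jc_fix k f).2 (hF ▸ hf)).symm
  · exact (compression_jc h hh f hf).2.trans (compression_jc k hk f (hF ▸ hf)).2.symm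

theorem exists_grafting_of_equiv (e : τ.F ≃ σ.F) (v : τ.V ≃ σ.V)
    (bd : ∀ f, v (τ.bd f) = σ.bd (e f)) (edge : ∀ f, τ.j f ≠ f → σ.j (e f) = e (τ.j f)) :
    ∃ h : τ ⟶ σ, graftings h ∧ Hom.hF h = e.symm ∧ Hom.hV h = v :=
  have he : ∀ f, f ∈ Set.range e.symm := e.symm.surjective
  ⟨{  hF := e.symm
      hV := v
      jc := id
      jc_jc := fun _ => rfl
      jc_fix := fun f => iff_of_true rfl (he f)
      inj := e.symm.injective
      surj := v.surjective
      j_range := fun f => iff_of_true (he _) (he f)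
      jc_edge := fun f hf => absurd (he f) hf
      bd_hF := fun f => by rw [bd, e.apply_symm_apply]
      bd_jc := fun _ _ => rfl
      edge := fun f hf => by rw [e.symm_apply_eq, ← edge _ hf, e.apply_symm_apply] },
    ⟨v.bijective, e.symm.bijective⟩, rfl, rfl⟩

theorem exists_compression_of_flags (hF : ρ.F → σ.F) (hV : σ.V → ρ.V)
    (inj : Function.Injective hF) (surj : Function.Surjective hV)
    (hF_j : ∀ r, hF (ρ.j r) = σ.j (hF r)) (j_ne : ∀ f, f ∉ Set.range hF → σ.j f ≠ f)
    (bd_hF : ∀ r, hV (σ.bd (hF r)) = ρ.bd r)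
    (bd_j : ∀ f, f ∉ Set.range hF → hV (σ.bd (σ.j f)) = hV (σ.bd f)) :
    ∃ h : σ ⟶ ρ, compressions h ∧ Hom.hF h = hF ∧ Hom.hV h = hV := by
  classical
  have j_mem : ∀ f, f ∈ Set.range hF → σ.j f ∈ Set.range hF := by
    rintro _ ⟨r, rfl⟩
    exact ⟨_, hF_j r⟩
  have j_range : ∀ f, σ.j f ∈ Set.range hF ↔ f ∈ Set.range hF := fun f =>
    ⟨fun hf => σ.j_j f ▸ j_mem _ hf, j_mem f⟩
  -- A compression leaves no choice: off the image of `hF`, its involution agrees with `σ.j`.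
  let jc : σ.F → σ.F := fun f => if f ∈ Set.range hF then f else σ.j f
  have jc_of_mem : ∀ f, f ∈ Set.range hF → jc f = f := fun _ hf => if_pos hf
  have jc_of_notMem : ∀ f, f ∉ Set.range hF → jc f = σ.j f := fun _ hf => if_neg hf
  have jc_jc : ∀ f, jc (jc f) = f := fun f => by
    by_cases hf : f ∈ Set.range hF
    · rw [jc_of_mem f hf, jc_of_mem f hf]
    · rw [jc_of_notMem f hf, jc_of_notMem _ ((j_range f).not.2 hf), σ.j_j]
  have jc_fix : ∀ f, jc f = f ↔ f ∈ Set.range hF := fun f =>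
    ⟨not_imp_not.1 fun hf hjc => j_ne f hf (jc_of_notMem f hf ▸ hjc), jc_of_mem f⟩
  have bd_jc : ∀ f, f ∉ Set.range hF → hV (σ.bd (jc f)) = hV (σ.bd f) := fun f hf => by
    rw [jc_of_notMem f hf, bd_j f hf]
  refine ⟨Hom.mk hF hV jc jc_jc jc_fix inj surj j_range (fun f hf _ => jc_of_notMem f hf) bd_hF
    bd_jc (fun r _ => hF_j r), ⟨fun r hr => ?_, inj.injOn, fun f hf => ?_⟩, rfl, rfl⟩
  · exact (hF_j r).symm.trans (congrArg hF hr)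
  · obtain ⟨r, rfl⟩ : f ∈ Set.range hF := not_imp_comm.1 (j_ne f) (fun hn => hn hf)
    exact ⟨r, inj ((hF_j r).trans hf), rfl⟩

/-! ### Graftings and reduced covers -/

theorem toJK_i_eq_inl {f g : τ.F}
    (h : τ.toJK.i (Sum.inl f : τ.F ⊕ τ.tails) = (Sum.inl g : τ.F ⊕ τ.tails)) :
    τ.j f ≠ f ∧ τ.j f = g := by
  have hf : τ.j f ≠ f := fun e => by
    rw [toJK_i_tail τ f e] at h
    cases h
  rw [toJK_i_edge τ f hf] at h
  exact ⟨hf, Sum.inl_injective h⟩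

open Classical in
/-- The other half-edge of the edge to which a half-edge belongs, or the half-edge itself if the
other end of the edge is a port. -/
def matchingFlag (X : JKGraph) (f : X.H) : X.H :=
  if hf : ∃ g, X.s g = X.i (X.s f) then hf.choose else f

theorem matchingFlag_eq (X : JKGraph) {f g : X.H} (h : X.s g = X.i (X.s f)) :
    matchingFlag X f = g := by
  have hf : ∃ g, X.s g = X.i (X.s f) := ⟨g, h⟩
  rw [matchingFlag, dif_pos hf]
  exact X.s_inj (hf.choose_spec.trans h.symm)

theorem matchingFlag_of_notMem_range_s (X : JKGraph) {f : X.H}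
    (h : X.i (X.s f) ∉ Set.range X.s) : matchingFlag X f = f :=
  dif_neg h

/-- The Borisov-Manin graph of a graph without isolated edges: inner edges become edges, the other
half-edges become tails. -/
def ofJK (X : JKGraph) : BMGraph where
  V := X.V
  F := X.H
  finV := X.finV
  finF := X.finH
  bd := X.p
  j := matchingFlag X
  j_j f := by
    by_cases hf : X.i (X.s f) ∈ Set.range X.s
    · obtain ⟨g, hg⟩ := hf
      rw [matchingFlag_eq X hg, matchingFlag_eq X (g := f) (by rw [hg, X.i_i])]
    · rw [matchingFlag_of_notMem_range_s X hf, matchingFlag_of_notMem_range_s X hf]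

theorem i_s_notMem_range_s_of_mem_tails {X : JKGraph} {f : X.H} (hf : f ∈ (ofJK X).tails) :
    X.i (X.s f) ∉ Set.range X.s := by
  rintro ⟨g, hg⟩
  have hgf : g = f := (matchingFlag_eq X hg).symm.trans hf
  exact X.i_ne (X.s f) (hgf ▸ hg.symm)

/-- The comparison of `X` with the graph of its Borisov-Manin graph, which replaces the ports of `X`
by copies of tails. -/
def ofJKMap (X : JKGraph) : (ofJK X).toJK ⟶ X where
  a := Sum.elim X.s (fun t => X.i (X.s t.1))
  h := id
  v := id
  a_i := by
    rintro (f | t)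
    · by_cases hf : X.i (X.s f) ∈ Set.range X.s
      · have hj : (ofJK X).j f ≠ f := fun h => i_s_notMem_range_s_of_mem_tails h hf
        obtain ⟨g, hg⟩ := hf
        rw [toJK_i_edge (ofJK X) f hj]
        exact (congrArg X.s (matchingFlag_eq X hg)).trans hg
      · rw [toJK_i_tail (ofJK X) f (matchingFlag_of_notMem_range_s X hf)]
        rfl
    · exact (X.i_i _).symm
  a_s := fun _ => rfl
  v_p := fun _ => rfl
  pull := fun _ z hz => ⟨z, ⟨hz, rfl⟩, fun _ ht => ht.2⟩

theorem isIso_ofJKMap (X : JKGraph) (hX : X.NoIsolatedEdges) : IsIso (ofJKMap X) := by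
  refine isIso_of_bijective _ ⟨?_, a_surjective _ hX Function.surjective_id⟩
    Function.bijective_id Function.bijective_id
  refine Function.Injective.sumElim X.s_inj (fun t u htu => ?_) fun f t hft =>
    i_s_notMem_range_s_of_mem_tails t.2 ⟨f, hft⟩
  exact Subtype.ext (X.s_inj (X.i_injective htu))

/-- Every graph without isolated edges comes from a Borisov-Manin graph. -/
def ofJKIso (X : KGr) : (ofJK X.1).toJK ≅ X.1 :=
  haveI := isIso_ofJKMap X.1 X.2
  asIso (ofJKMap X.1)

theorem graftMap_injective {h k : τ ⟶ σ} (hh : graftings h) (hk : graftings k)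
    (e : graftMap h hh = graftMap k hk) : h = k := by
  refine grafting_ext hh hk (funext fun f => ?_) (congrArg JKGraph.Hom.v e)
  have hf : graftEquiv h hh (Hom.hF k f) = graftEquiv k hk (Hom.hF k f) :=
    congrArg (fun q : τ.toJK ⟶ σ.toJK => (JKGraph.Hom.h q (Hom.hF k f) : σ.F)) e
  rw [← hF_graftEquiv h hh (Hom.hF k f), hf, graftEquiv_hF]

theorem exists_graftMap_eq (k : τ.toJK ⟶ σ.toJK) (hk : Function.Bijective (JKGraph.Hom.v k)) :
    ∃ (h : τ ⟶ σ) (hh : graftings h), graftMap h hh = k := by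
  let e : τ.F ≃ σ.F :=
    Equiv.ofBijective (JKGraph.Hom.h k) ⟨h_injective k hk.1, h_surjective k hk.2⟩
  obtain ⟨h, hh, hF, hV⟩ := exists_grafting_of_equiv e (Equiv.ofBijective _ hk)
    (JKGraph.Hom.v_p k) fun f hf => by
      have hi := JKGraph.Hom.a_i_s k f
      rw [toJK_i_edge τ f hf] at hi
      exact (toJK_i_eq_inl (hi.symm.trans (JKGraph.Hom.a_s k (τ.j f)))).2
  refine ⟨h, hh, toJK_hom_ext (fun f => Hom.inj h ?_) fun w => congrFun hV w⟩
  calc Hom.hF h (graftEquiv h hh f) = e.symm (e f) :=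
        (hF_graftEquiv h hh f).trans (e.symm_apply_apply f).symm
    _ = Hom.hF h (e f) := by rw [hF]

theorem Φ₁_isEquivalence : Φ₁.IsEquivalence where
  faithful := ⟨fun {τ σ} h k e => by
    apply WideSubcategory.hom_ext
    exact graftMap_injective h.property k.property
      (KGr.free_injective (X := τ.obj.toKGr) (Y := σ.obj.toKGr) (congrArg (fun t => t.hom) e))⟩
  full := ⟨fun {τ σ} f => by
    obtain ⟨f, k, hk, rfl⟩ := f
    obtain ⟨h, hh, e⟩ := exists_graftMap_eq k
      ((isReducedCover_iff k τ.obj.toJK_noIsolatedEdges σ.obj.toJK_noIsolatedEdges).1 hk)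
    refine ⟨⟨h, hh⟩, WideSubcategory.hom_ext _ ?_⟩
    exact congrArg (KGr.free (X := τ.obj.toKGr) (Y := σ.obj.toKGr)) e⟩
  essSurj := ⟨fun X =>
    let τ := ofJK X.obj.1
    ⟨⟨τ⟩, ⟨WideSubcategory.isoMk (X := ⟨τ.toKGr⟩) (Y := X)
      (KGr.freeIso (X := τ.toKGr) (Y := X.obj) (ofJKIso X.obj))
      (KGr.reducedCovers_freeIso (X := τ.toKGr) (Y := X.obj) (ofJKIso X.obj))
      (KGr.reducedCovers_freeIso (X := X.obj) (Y := τ.toKGr) (ofJKIso X.obj).symm)⟩⟩⟩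

/-! ### Compressions and generic morphisms -/

theorem v_fibreMap_injective (h : σ ⟶ ρ) (hh : compressions h) (x : ρ.V) :
    Function.Injective (JKGraph.Hom.v (fibreMap h hh x)) :=
  Subtype.val_injective

theorem range_v_fibreMap (h : σ ⟶ ρ) (hh : compressions h) (x : ρ.V) :
    Set.range (JKGraph.Hom.v (fibreMap h hh x)) = {w | Hom.hV h w = x} :=
  Subtype.range_val

theorem comprMap_injective {h k : σ ⟶ ρ} (hh : compressions h) (hk : compressions k)
    (e : comprMap h hh = comprMap k hk) : h = k := by
  refine compression_ext hh hk (funext fun f => ?_) (funext fun w => ?_)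
  · exact Sum.inl_injective (congrArg (fun t : y.obj ρ.toJK ⟶ bar (y.obj σ.toJK) =>
      Species.Hom.c t (Sum.inl f : ρ.F ⊕ ρ.tails)) e)
  · have hcls : cls (fibrePiece h hh (Hom.hV h w)) = cls (fibrePiece k hk (Hom.hV h w)) := by
      rw [← comprMap_at, ← comprMap_at, e]
    obtain ⟨θ, -, hθ⟩ := cls_eq.1 hcls
    have hmap : θ.hom ≫ fibreMap k hk (Hom.hV h w) = fibreMap h hh (Hom.hV h w) :=
      y_inj ((y.map_comp _ _).trans hθ)
    have hw : w ∈ Set.range (JKGraph.Hom.v (fibreMap k hk (Hom.hV h w))) :=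
      ⟨JKGraph.Hom.v θ.hom (⟨w, rfl⟩ : {u // Hom.hV h u = Hom.hV h w}),
        congrArg (fun q : fibre h (Hom.hV h w) ⟶ σ.toJK => JKGraph.Hom.v q
          (⟨w, rfl⟩ : {u // Hom.hV h u = Hom.hV h w})) hmap⟩
    exact ((range_v_fibreMap k hk _).subset hw).symm

theorem exists_flag_map_of_isGenericMap {d : y.obj ρ.toJK ⟶ bar (y.obj σ.toJK)}
    (hd : IsGenericMap d) :
    ∃ hF : ρ.F → σ.F,
      (∀ r, Species.Hom.c d (Sum.inl r : ρ.F ⊕ ρ.tails) = (Sum.inl (hF r) : σ.F ⊕ σ.tails)) ∧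
        ∀ r, hF (ρ.j r) = σ.j (hF r) := by
  choose hF hc using fun r : ρ.F => (hd.c_mem_range_s_iff (ρ.toJK.s r)).2 ⟨r, rfl⟩
  have hc_i : ∀ r, Species.Hom.c d (ρ.toJK.i (ρ.toJK.s r)) = σ.toJK.i (σ.toJK.s (hF r)) :=
    fun r => (Species.Hom.c_inv d _).trans (congrArg σ.toJK.i (hc r).symm)
  refine ⟨hF, fun r => (hc r).symm, fun r => ?_⟩
  by_cases hr : ρ.j r = r
  · have htail : ρ.toJK.i (ρ.toJK.s r) ∉ Set.range ρ.toJK.s :=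
      (toJK_i_tail ρ r hr).symm ▸ toJK_not_mem_range ρ ⟨r, hr⟩
    have hport : σ.toJK.i (σ.toJK.s (hF r)) ∉ Set.range σ.toJK.s :=
      hc_i r ▸ (hd.c_mem_range_s_iff _).not.2 htail
    by_contra hne
    rw [hr] at hne
    exact hport ⟨_, (toJK_i_edge σ _ (Ne.symm hne)).symm⟩
  · refine (toJK_i_eq_inl ((hc_i r).symm.trans ?_)).2.symm
    exact (congrArg (Species.Hom.c d) (toJK_i_edge ρ r hr)).trans (hc (ρ.j r)).symm

theorem exists_comprMap_eq (d : y.obj ρ.toJK ⟶ bar (y.obj σ.toJK)) (hd : IsGenericMap d) :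
    ∃ (h : σ ⟶ ρ) (hh : compressions h), comprMap h hh = d := by
  obtain ⟨hF, hc, hF_j⟩ := exists_flag_map_of_isGenericMap hd
  have inj : Function.Injective hF := fun r r' hr => Sum.inl_injective <|
    hd.c_injective ((hc r).trans ((congrArg Sum.inl hr).trans (hc r').symm))
  have inner : ∀ f, f ∉ Set.range hF →
      σ.j f ≠ f ∧ hd.base (σ.bd (σ.j f)) = hd.base (σ.bd f) := fun f hf => by
    have hfc : σ.toJK.s f ∉ Set.range (Species.Hom.c d) := by
      rintro ⟨a, ha⟩
      obtain ⟨r, rfl⟩ := (hd.c_mem_range_s_iff a).1 ⟨f, ha.symm⟩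
      exact hf ⟨r, Sum.inl_injective ((hc r).symm.trans ha)⟩
    obtain ⟨u, hu, hbase⟩ := hd.exists_i_s_eq_of_notMem_range_c hfc
    obtain ⟨hj, rfl⟩ := toJK_i_eq_inl hu
    exact ⟨hj, hbase⟩
  obtain ⟨h, hh, rfl, hV⟩ := exists_compression_of_flags hF hd.base inj hd.base_surjective hF_j
    (fun f hf => (inner f hf).1)
    (fun r => hd.base_p_of_s_eq_c (t := hF r) (r := r) (hc r).symm) fun f hf => (inner f hf).2
  refine ⟨h, hh, dec_ext_of_range_v_eq ?_ (fibrePiece h hh) (rep d)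
    (fun x => (comprMap_at h hh x).symm) (rep_spec d) (v_fibreMap_injective h hh)
    hd.v_rep_injective fun x => ?_⟩
  · exact toJK_arc_ext (comprArc_i h hh) (Species.Hom.c_inv d) fun r => (hc r).symm
  · exact (range_v_fibreMap h hh x).trans (hV ▸ (hd.range_v_rep x).symm)

theorem Φ₂_isEquivalence : Φ₂.IsEquivalence where
  faithful := ⟨fun {σ ρ} h k e => by
    apply WideSubcategory.hom_ext
    exact comprMap_injective h.property k.property
      (congrArg (fun t : Φ₂.obj σ ⟶ Φ₂.obj ρ =>
        KGr.toMap (X := ρ.obj.toKGr) (Y := σ.obj.toKGr) t.unop.hom) e)⟩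
  full := ⟨fun {σ ρ} f => by
    obtain ⟨h, hh, e⟩ := exists_comprMap_eq
      (KGr.toMap (X := ρ.obj.toKGr) (Y := σ.obj.toKGr) f.unop.hom) f.unop.property
    refine ⟨⟨h, hh⟩, Quiver.Hom.unop_inj (WideSubcategory.hom_ext _ ?_)⟩
    exact KGr.ext e⟩
  essSurj := ⟨fun X =>
    let τ := ofJK X.unop.obj.1
    let e : X.unop.obj.1 ≅ τ.toJK := (ofJKIso X.unop.obj).symm
    ⟨⟨τ⟩, ⟨(WideSubcategory.isoMk (X := X.unop) (Y := ⟨τ.toKGr⟩)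
      (KGr.freeIso (X := X.unop.obj) (Y := τ.toKGr) e)
      (KGr.generics_freeIso (X := X.unop.obj) (Y := τ.toKGr) e)
      (KGr.generics_freeIso (X := τ.toKGr) (Y := X.unop.obj) e.symm)).op⟩⟩⟩

/-! ### The commutation laws -/

open Classical in
/-- The graph obtained from `τ` by grafting all the virtual edges of `m : τ ⟶ ρ`, namely the edges
of `ρ` and the pairs of flags contracted by `m`. -/
def regraft (m : τ ⟶ ρ) : BMGraph where
  V := τ.V
  F := τ.F
  finV := τ.finV
  finF := τ.finF
  bd := τ.bd
  j f := if hf : f ∈ Set.range (Hom.hF m) then Hom.hF m (ρ.j hf.choose) else Hom.jc m f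
  j_j f := by
    by_cases hf : f ∈ Set.range (Hom.hF m)
    · have hr : Hom.hF m (ρ.j hf.choose) ∈ Set.range (Hom.hF m) := ⟨_, rfl⟩
      rw [dif_pos hf, dif_pos hr, Hom.inj m hr.choose_spec, ρ.j_j, hf.choose_spec]
    · rw [dif_neg hf, dif_neg ((Hom.jc_range m f).not.2 hf), Hom.jc_jc]

theorem regraft_j_hF (m : τ ⟶ ρ) (r : ρ.F) :
    (regraft m).j (Hom.hF (τ := τ) m r) = Hom.hF (τ := τ) m (ρ.j r) := by
  have hr : Hom.hF m r ∈ Set.range (Hom.hF m) := ⟨r, rfl⟩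
  exact (dif_pos hr).trans (congrArg (fun t => Hom.hF m (ρ.j t)) (Hom.inj m hr.choose_spec))

theorem regraft_j_of_notMem_range (m : τ ⟶ ρ) {f : τ.F} (hf : f ∉ Set.range (Hom.hF m)) :
    (regraft m).j f = Hom.jc m f :=
  dif_neg hf

theorem regraft_j_of_edge (m : τ ⟶ ρ) {f : τ.F} (hf : τ.j f ≠ f) :
    (regraft m).j f = τ.j f := by
  by_cases hm : f ∈ Set.range (Hom.hF m)
  · obtain ⟨r, rfl⟩ := hm
    exact (regraft_j_hF m r).trans (Hom.edge m r hf)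
  · rw [regraft_j_of_notMem_range m hm, Hom.jc_edge m f hm hf]

theorem exists_grafting_comp_compression (m : τ ⟶ ρ) : ∃ (σ : BMGraph) (g : τ ⟶ σ) (c : σ ⟶ ρ),
    graftings g ∧ compressions c ∧ g ≫ c = m := by
  obtain ⟨g, hg, g_hF, g_hV⟩ := exists_grafting_of_equiv (σ := regraft m) (Equiv.refl τ.F)
    (Equiv.refl τ.V) (fun _ => rfl) fun _ => regraft_j_of_edge m
  obtain ⟨c, hc, c_hF, c_hV⟩ := exists_compression_of_flags (σ := regraft m)
    (Hom.hF (τ := τ) m) (Hom.hV (τ := τ) m) (Hom.inj m) (Hom.surj m)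
    (fun r => (regraft_j_hF m r).symm)
    (fun f hf => ne_of_eq_of_ne (regraft_j_of_notMem_range m hf) ((Hom.jc_fix m f).not.2 hf))
    (Hom.bd_hF m)
    (fun f hf => (congrArg (fun t => Hom.hV m (τ.bd t)) (regraft_j_of_notMem_range m hf)).trans
      (Hom.bd_jc m f hf))
  have g_id : ∀ f, Hom.hF g f = f := congrFun g_hF
  have c_jc : ∀ f, Hom.jc c f = Hom.jc m f := fun f => by
    by_cases hf : f ∈ Set.range (Hom.hF m)
    · exact ((Hom.jc_fix c f).2 (c_hF ▸ hf)).trans ((Hom.jc_fix m f).2 hf).symm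
    · exact (compression_jc c hc f (c_hF ▸ hf)).2.trans (regraft_j_of_notMem_range m hf)
  refine ⟨_, g, c, hg, hc, Hom.ext ?_ ?_ ?_⟩
  · exact funext fun r => (g_id _).trans (congrFun c_hF r)
  · exact funext fun v => (congrArg (Hom.hV c) (congrFun g_hV v)).trans (congrFun c_hV v)
  · funext f
    calc Hom.compJc g c f = Hom.compJc g c (Hom.hF g f) :=
          congrArg (Hom.compJc g c) (g_id f).symm
      _ = Hom.hF g (Hom.jc c f) := Hom.compJc_hF g c f
      _ = Hom.jc m f := (g_id _).trans (c_jc f)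

theorem hF_graftEquiv_eq_graftEquiv_hF {h : τ ⟶ ω} {k : ω ⟶ ρ} (hk : graftings k) {g : τ ⟶ σ}
    (hg : graftings g) {c : σ ⟶ ρ} (e : g ≫ c = h ≫ k) (t : ω.F) :
    Hom.hF c (graftEquiv k hk t) = graftEquiv g hg (Hom.hF h t) := by
  have hF : Hom.hF g (Hom.hF c (graftEquiv k hk t)) = Hom.hF h (Hom.hF k (graftEquiv k hk t)) :=
    congrFun (congrArg Hom.hF e) _
  rw [hF_graftEquiv] at hF
  rw [← hF, graftEquiv_hF]

theorem map_graftMap_comp_comprMap {h : τ ⟶ ω} (hh : compressions h) {k : ω ⟶ ρ} (hk : graftings k)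
    {g : τ ⟶ σ} (hg : graftings g) {c : σ ⟶ ρ} (hc : compressions c) (e : g ≫ c = h ≫ k) :
    y.map (graftMap k hk) ≫ comprMap c hc = comprMap h hh ≫ barMap (y.map (graftMap g hg)) := by
  have hV : ∀ v, Hom.hV c (Hom.hV g v) = Hom.hV k (Hom.hV h v) :=
    congrFun (congrArg Hom.hV e)
  refine dec_ext_of_range_v_eq ?_
    (fun x => relabel (JKGraph.flMap (graftMap k hk) x) (fibrePiece c hc (Hom.hV k x)))
    (fun x => Piece.map (y.map (graftMap g hg)) (fibrePiece h hh x))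
    (fun x => ?_) (fun x => ?_) (fun x => ?_) (fun x => ?_) fun x => ?_
  · exact toJK_arc_ext (Species.Hom.c_inv (y.map (graftMap k hk) ≫ comprMap c hc))
      (Species.Hom.c_inv (comprMap h hh ≫ barMap (y.map (graftMap g hg))))
      fun t => congrArg Sum.inl (hF_graftEquiv_eq_graftEquiv_hF hk hg e t)
  · exact ((at_map (graftMap k hk) (comprMap c hc) x).trans
      (congrArg ((bar (y.obj σ.toJK)).act (JKGraph.flMap (graftMap k hk) x))
        (comprMap_at c hc (Hom.hV k x)))).symm
  · exact (congrArg (Species.Hom.o (barMap (y.map (graftMap g hg)))) (comprMap_at h hh x)).symm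
  · exact v_fibreMap_injective c hc (Hom.hV k x)
  · exact hg.1.1.comp (v_fibreMap_injective h hh x)
  · calc
      _ = {w | Hom.hV c w = Hom.hV k x} := range_v_fibreMap c hc _
      _ = Hom.hV g '' {v | Hom.hV h v = x} := by
        ext w
        obtain ⟨v, rfl⟩ := hg.1.2 w
        rw [hg.1.1.mem_set_image, Set.mem_ofPred_eq, hV, hk.1.1.eq_iff, Set.mem_ofPred_eq]
      _ = Hom.hV g '' Set.range (JKGraph.Hom.v (fibreMap h hh x)) := by rw [range_v_fibreMap]
      _ = _ := (Set.range_comp _ _).symm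

theorem exists_arc_extension {C : Type*} {inv : C → C} (inv_inv : ∀ x, inv (inv x) = x)
    (b : τ.F → C) (hb : ∀ f, τ.j f ≠ f → b (τ.j f) = inv (b f)) :
    ∃ c : τ.toJK.A → C, (∀ a, c (τ.toJK.i a) = inv (c a)) ∧
      ∀ f, c (Sum.inl f : τ.F ⊕ τ.tails) = b f := by
  refine ⟨(Sum.elim b fun t => inv (b t.1) : τ.F ⊕ τ.tails → C), ?_, fun _ => rfl⟩
  rintro (f | t)
  · by_cases hf : τ.j f = f
    · rw [toJK_i_tail τ f hf]
      rfl
    · rw [toJK_i_edge τ f hf]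
      exact hb f hf
  · exact (inv_inv _).symm

theorem exists_arc_map_desc {h : τ ⟶ ω} (hh : compressions h) {k : ω ⟶ ρ} (hk : graftings k)
    {g : τ ⟶ σ} (hg : graftings g) {c : σ ⟶ ρ} (hc : compressions c) (e : g ≫ c = h ≫ k)
    {C : Type} {inv : C → C} (inv_inv : ∀ x, inv (inv x) = x)
    {a : ρ.toJK.A → C} (a_i : ∀ r, a (ρ.toJK.i r) = inv (a r))
    {b : τ.toJK.A → C} (b_i : ∀ t, b (τ.toJK.i t) = inv (b t))
    (hab : ∀ t, a (JKGraph.Hom.a (graftMap k hk) t) = b (comprArc h hh t)) :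
    ∃ γ : σ.toJK.A → C, (∀ s, γ (σ.toJK.i s) = inv (γ s)) ∧
      ∀ t, γ (JKGraph.Hom.a (graftMap g hg) t) = b t := by
  have a_inl : ∀ r, a (Sum.inl r : ρ.F ⊕ ρ.tails) =
      b (Sum.inl (Hom.hF g (Hom.hF c r)) : τ.F ⊕ τ.tails) := fun r => by
    have hr : a (Sum.inl (graftEquiv k hk (Hom.hF k r)) : ρ.F ⊕ ρ.tails) =
      b (Sum.inl (Hom.hF h (Hom.hF k r)) : τ.F ⊕ τ.tails) :=
        hab (Sum.inl (Hom.hF k r) : ω.F ⊕ ω.tails)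
    rw [graftEquiv_hF] at hr
    exact hr.trans (congrArg (fun q : τ ⟶ ρ => b (Sum.inl (Hom.hF q r) : τ.F ⊕ τ.tails)) e.symm)
  have b_j : ∀ f, σ.j f ≠ f → b (Sum.inl (Hom.hF g (σ.j f)) : τ.F ⊕ τ.tails) =
      inv (b (Sum.inl (Hom.hF g f) : τ.F ⊕ τ.tails)) := fun f hf => by
    by_cases hj : τ.j (Hom.hF g f) = Hom.hF g f
    -- The tails glued by `g` come from those glued by `k`, so `a` relates their colours.
    · obtain ⟨t, -, ht⟩ := hh.2.2 hj
      obtain ⟨r, rfl⟩ := hk.2.2 t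
      obtain rfl : Hom.hF c r = f := Hom.inj g <|
        (congrFun (congrArg Hom.hF e) r).trans ht
      have hr : ρ.j r ≠ r := fun hr => hf (by rw [← compression_j c hc, hr])
      rw [← compression_j c hc, ← a_inl, ← a_inl, ← a_i, toJK_i_edge ρ r hr]
    · rw [Hom.edge g f hj, ← b_i, toJK_i_edge τ _ hj]
  obtain ⟨γ, γ_i, hγ⟩ := exists_arc_extension inv_inv
    (fun f => b (Sum.inl (Hom.hF g f) : τ.F ⊕ τ.tails)) b_j
  refine ⟨γ, γ_i, toJK_arc_ext (inv := inv) (fun t => ?_) b_i fun f => ?_⟩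
  · rw [JKGraph.Hom.a_i, γ_i]
  · refine (hγ (graftEquiv g hg f)).trans ?_
    rw [hF_graftEquiv]

theorem isPushout_of_comp_eq_comp {h : τ ⟶ ω} (hh : compressions h) {k : ω ⟶ ρ} (hk : graftings k)
    {g : τ ⟶ σ} (hg : graftings g) {c : σ ⟶ ρ} (hc : compressions c) (e : g ≫ c = h ≫ k) :
    IsPushout (KGr.free (X := ω.toKGr) (Y := ρ.toKGr) (graftMap k hk))
      (KGr.ofMap (X := ω.toKGr) (Y := τ.toKGr) (comprMap h hh))
      (KGr.ofMap (X := ρ.toKGr) (Y := σ.toKGr) (comprMap c hc))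
      (KGr.free (X := τ.toKGr) (Y := σ.toKGr) (graftMap g hg)) := by
  have hg' : IsReducedCover (graftMap g hg) := graftMap_reduced g hg
  have := KGr.epi_free (X := ω.toKGr) (Y := ρ.toKGr) (graftMap k hk) (graftMap_reduced k hk).1
  have := KGr.epi_free (X := τ.toKGr) (Y := σ.toKGr) (graftMap g hg) hg'.1
  refine isPushout_of_epi_of_exists_desc (KGr.ext ?_) fun {T} α β hαβ => ?_
  · exact (KGr.toMap_free_comp (X := ω.toKGr) (Y := ρ.toKGr) (Z := σ.toKGr) (graftMap k hk) _).trans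
      ((map_graftMap_comp_comprMap hh hk hg hc e).trans
        (KGr.toMap_comp_free (X := ω.toKGr) (Y := τ.toKGr) (Z := σ.toKGr)
          (KGr.ofMap (comprMap h hh)) (graftMap g hg)).symm)
  · have hmap := (KGr.toMap_free_comp (X := ω.toKGr) (Y := ρ.toKGr) (graftMap k hk) α).symm.trans
      (congrArg KGr.toMap hαβ)
    obtain ⟨γ, γ_i, hγ⟩ := exists_arc_map_desc hh hk hg hc e T.1.i_i
      (Species.Hom.c_inv (KGr.toMap α)) (Species.Hom.c_inv (KGr.toMap β))
      fun t => congrArg (fun d : y.obj ω.toJK ⟶ bar (y.obj T.1) => Species.Hom.c d t) hmap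
    exact KGr.exists_free_comp_eq (X := τ.toKGr) (Y := σ.toKGr) (graftMap g hg) hg' β γ γ_i hγ

end BMGraph

end BM

end

/-- The equivalences `Φ₁` (graftings are reduced covers) and `Φ₂` (compressions are generic
morphisms read backwards) exchange the two commutation laws: given a compression `h` followed by a
grafting `k`, there is a grafting `g` followed by a compression `c` with the same composite, and for
all such `g` and `c` the images of the four morphisms form a pushout square. -/
theorem mainTheorem7 :
    BM.BMGraph.Φ₁.IsEquivalence ∧ BM.BMGraph.Φ₂.IsEquivalence ∧
    ∀ (τ ω ρ : BM.BMGraph) (h : τ ⟶ ω) (hh : BM.BMGraph.compressions h)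
      (k : ω ⟶ ρ) (hk : BM.BMGraph.graftings k),
      (∃ (σ : BM.BMGraph) (g : τ ⟶ σ) (c : σ ⟶ ρ),
        BM.BMGraph.graftings g ∧ BM.BMGraph.compressions c ∧ g ≫ c = h ≫ k) ∧
      ∀ (σ : BM.BMGraph) (g : τ ⟶ σ) (hg : BM.BMGraph.graftings g)
        (c : σ ⟶ ρ) (hc : BM.BMGraph.compressions c), g ≫ c = h ≫ k →
        IsPushout
          (BM.BMGraph.Φ₁.map (X := ⟨ω⟩) (Y := ⟨ρ⟩) ⟨k, hk⟩).hom
          (BM.BMGraph.Φ₂.map (X := ⟨τ⟩) (Y := ⟨ω⟩) ⟨h, hh⟩).unop.hom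
          (BM.BMGraph.Φ₂.map (X := ⟨σ⟩) (Y := ⟨ρ⟩) ⟨c, hc⟩).unop.hom
          (BM.BMGraph.Φ₁.map (X := ⟨τ⟩) (Y := ⟨σ⟩) ⟨g, hg⟩).hom :=
  ⟨BM.BMGraph.Φ₁_isEquivalence, BM.BMGraph.Φ₂_isEquivalence, fun _ _ _ h _ k hk =>
    ⟨BM.BMGraph.exists_grafting_comp_compression (h ≫ k), fun _ _ hg _ hc e =>
      BM.BMGraph.isPushout_of_comp_eq_comp _ hk hg hc e⟩⟩
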